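/- For $m$ universal variables $X$ and $n$ existential variables $Y$, consider formulas $\forall X\,\exists Y\,\varphi$ where $\varphi$ is a set of clauses, each consisting of one universal literal and two existential literals with different underlying variables. Such a formula is true if for every assignment to $X$ there is an assignment to $Y$ that satisfies all its clauses. In the random formula each of the $4mn(n-1)$ possible clauses is chosen independently with probability $p=\frac{c}{4mn}$. A pure snake of length $s+1=2t\ge 4$ is a set of clauses $C_r=(v_r\lor\overline{w_r}\lor w_{r+1})$, $0\le r\le s$, where $w_1,\dots,w_s$ are existential literals with pairwise different underlying variables, $w_0=w_{s+1}=\overline{w_t}$, and $v_0,\dots,v_s$ are universal literals among which no literal occurs together with its negation. Let $X_s$ be the number of pure snakes of length $s+1$ in the random formula, $\mathbb{E}_{m,c}(X_s)$ its expectation, and $\mathbb{P}_{m,c}(n)$ the probability that the random formula is true. For a pure snake $A$ of length $s+1$ let $N_{m,s}(i)=N_{m,s}(i;A)$ be the number of pure snakes of length $s+1$ that share exactly $i$ clauses with $A$. Let $\alpha>1/\ln 2$ and $1<c<2$ be such that $\alpha H(c)>1$, where $H(c)=\ln c+\left(\frac2c-1\right)\ln(2-c)$. Put $m=\lfloor\alpha\ln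 n\rfloor$ and $\hat\gamma=-\frac{2\alpha\ln(2-c)}{c}$, and let $s+1$ be the largest even integer that is at most $\lfloor\hat\gamma\ln n\rfloor$ (so $s+1=\lfloor\hat\gamma\ln n\rfloor$ whenever this is even). Then there exist $0<\delta<2(\alpha H(c)-1)$, $C>0$ and $D>0$, depending only on $\alpha$ and $c$, such that for all sufficiently large $n$ $$\mathbb{E}_{m,c}(X_s)\ \ge\ C\,n^{\alpha H(c)-1-\frac{\delta}{2}}$$ and, for every pure snake $A$ of length $s+1$, $$\sum_{i=1}^{s}N_{m,s}(i;A)\left(\frac{c}{4mn}\right)^{s+1-i}\ \le\ D\,n^{\alpha H(c)-1-\frac{2\delta}{3}}.$$ Moreover, $\mathbb{P}_{\lfloor\alpha\ln n\rfloor,c}(n)\to 0$ as $n\to\infty$. -/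

import Mathlib

open Filter Topology Finset

noncomputable section

namespace QSat

/-- A literal over a set `V` of variables: `(x, true)` is `x` and `(x, false)` is its negation. -/
abbrev Lit (V : Type) := V × Bool

/-- The complementary literal. -/
def Lit.neg {V : Type} (l : Lit V) : Lit V := (l.1, !l.2)

/-- A universal literal together with the set of the existential literals of a clause, for `m`
universal and `n` existential variables. -/
abbrev PreClause (m n : ℕ) := Lit (Fin m) × Finset (Lit (Fin n))

/-- All the clauses with one universal literal and two existential literals whose underlying
variables are different; there are `4 * m * n * (n - 1)` of them. -/
def allClauses (m n : ℕ) : Finset (PreClause m n) :=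
  univ.filter fun C => #C.2 = 2 ∧ #(C.2.image Prod.fst) = 2

/-- Truth of the quantified formula `∀ X ∃ Y, ⋀ F`, where `F` is a set of clauses. -/
def IsTrue {m n : ℕ} (F : Finset (PreClause m n)) : Prop :=
  ∀ I : Fin m → Bool, ∃ J : Fin n → Bool,
    ∀ C ∈ F, I C.1.1 = C.1.2 ∨ ∃ l ∈ C.2, J l.1 = l.2

/-- `A` is a pure snake of length `s + 1`. -/
def IsPureSnake {m n : ℕ} (s : ℕ) (A : Finset (PreClause m n)) : Prop :=
  4 ≤ s + 1 ∧ ∃ t : ℕ, s + 1 = 2 * t ∧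
    ∃ (w : ℕ → Lit (Fin n)) (v : ℕ → Lit (Fin m)),
      -- the literals `w 1, …, w s` are strictly distinct
      Set.InjOn (fun r => (w r).1) (Set.Icc 1 s) ∧
      w 0 = (w t).neg ∧ w (s + 1) = (w t).neg ∧
      -- the sequence `v 0, …, v s` is pure
      (∀ r ≤ s, ∀ r' ≤ s, v r ≠ (v r').neg) ∧
      A = (range (s + 1)).image fun r => (v r, {(w r).neg, w (r + 1)})

open Classical in
/-- The pure snakes of length `s + 1` over `m` universal and `n` existential variables. -/
def pureSnakes (m n s : ℕ) : Finset (Finset (PreClause m n)) :=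
  (allClauses m n).powerset.filter (IsPureSnake s)

/-- The number of pure snakes of length `s + 1` contained in the formula `F`. -/
def snakeCount {m n : ℕ} (s : ℕ) (F : Finset (PreClause m n)) : ℕ :=
  #((pureSnakes m n s).filter (· ⊆ F))

/-- The number of pure snakes of length `s + 1` that share exactly `i` clauses with `A`. -/
def overlapCount {m n : ℕ} (s : ℕ) (A : Finset (PreClause m n)) (i : ℕ) : ℕ :=
  #((pureSnakes m n s).filter fun B => #(A ∩ B) = i)

/-- The probability of the formula `F` when every clause is chosen independently with
probability `p`. -/
def weight {m n : ℕ} (p : ℝ) (F : Finset (PreClause m n)) : ℝ :=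
  p ^ #F * (1 - p) ^ (#(allClauses m n) - #F)

/-- The expected number of pure snakes of length `s + 1` in the random formula. -/
def expectedSnakes (m n s : ℕ) (p : ℝ) : ℝ :=
  ∑ F ∈ (allClauses m n).powerset, weight p F * (snakeCount s F : ℝ)

open Classical in
/-- The probability that the random formula is true. -/
def probTrue (m n : ℕ) (p : ℝ) : ℝ :=
  ∑ F ∈ (allClauses m n).powerset.filter IsTrue, weight p F

/-- The clause probability `c / (4 m n)`. -/
def clauseProb (c : ℝ) (m n : ℕ) : ℝ := c / (4 * (m : ℝ) * (n : ℝ))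

/-- `H(c) = ln c + (2/c - 1) ln (2 - c)`. -/
def H (c : ℝ) : ℝ := Real.log c + (2 / c - 1) * Real.log (2 - c)

/-- `γ̂ = -2 α ln (2 - c) / c`. -/
def gammaHat (α c : ℝ) : ℝ := -2 * α * Real.log (2 - c) / c

/-- The number `⌊α ln n⌋` of universal variables. -/
def numUniv (α : ℝ) (n : ℕ) : ℕ := ⌊α * Real.log n⌋₊

end QSat

end

/-! The proof is a second moment argument for the number of pure snakes. A pure snake refutes the
formula: purity allows all its universal literals to be made false, and its clauses then form the
chain of implications from `¬w_t` to `w_t` and back to `¬w_t` (`not_isTrue_of_snake`). So truth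
forces the count to be `0`. If `R` bounds the overlap sum for every snake and `E` is the
expectation, Chebyshev gives probability at most `(R + 1) / E` (`probTrue_le`).

Expectation. A snake with `2t` clauses has only `2t - 1` free existential variables, so `E` is, up
to a factor of order at most `t`, at least `pureCount m (2t) * (c / (2m)) ^ (2t) / n`. Pure
sequences have the exponential generating function `(2 e^x - 1)^m`, hence `pureCount m j * (c /
(2m)) ^ j` is about `exp (m * rate c x)` with `x = c j / (2m)`. The rate is maximal at `ρ = -log (2
- c)`, with value `H c`, and the length `γ̂ ln n` is the one that places `x` at `ρ`. The upper bound
uses positivity of the series (`pureCount_mul_pow_le_rate`); the lower bound uses exponential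
tilting and slowly varying terms (`eventually_le_pureTerm`).

Overlaps. Fix a snake `A`. The universal literals of another snake are forced on the set `S` of
shared positions, and the steps at `S` follow implications of `A` or their contrapositives. After
guessing which of at most 8 edges at the middle variable to delete, these edges form a partial
injection (`IsCode.exists_isPartialInj`). If a step outside `S` is weighted as a jump with
probability `1/(2n)`, the sum over snakes and sets `S` is governed by powers of the matrix "relation
plus uniform jump". If neither half of the walk lies in `S`, the main term comes from `S = ∅` and
cancels exactly, which leaves `polylog / n^2`. If one half lies in `S`, only `polylog / n` is
gained, but at most `t` universal literals remain free, and there the rate is strictly below `H c`.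
Both cases lose a fixed power of `n` against `n ^ (α H c - 1)` (`sum_overlapCount_le`,
`overlap_asymptotic`). -/

namespace QSat

/-! ### Pure sequences and their generating function -/

/-- A family of literals is pure if no literal occurs together with its negation. -/
def IsPure {ι V : Type} (v : ι → Lit V) : Prop := ∀ i j, v i ≠ (v j).neg

noncomputable instance {ι V : Type} (v : ι → Lit V) : Decidable (IsPure v) :=
  Classical.propDecidable _

/-- The number of pure sequences of length `j` over `m` variables, organised by the underlying
sequence of variables. -/
def pureCount (m j : ℕ) : ℕ := ∑ u : Fin j → Fin m, 2 ^ #(univ.image u)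

/-- Purity gives every occurring variable a single sign, so over a fixed variable sequence `u` the
pure sequences correspond to the subsets `T` of its image, the variables used positively. -/
theorem card_isPure (m : ℕ) (ι : Type) [Fintype ι] [DecidableEq ι] :
    #(univ.filter fun v : ι → Lit (Fin m) => IsPure v) = pureCount m (Fintype.card ι) := by
  have h1 : #(univ.filter fun v : ι → Lit (Fin m) => IsPure v) =
      ∑ u : ι → Fin m, 2 ^ #(univ.image u) := by
    rw [card_eq_sum_card_fiberwise (f := fun v i => (v i).1) (t := univ) (by simp)]
    refine sum_congr rfl fun u _ => ?_
    rw [← card_powerset]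
    symm
    refine card_bij (fun T _ r => (u r, decide (u r ∈ T))) ?_ ?_ ?_
    · intro T hT
      simp only [mem_filter, mem_univ, true_and, and_true]
      intro i j h
      simp only [Lit.neg, Prod.mk.injEq] at h
      rw [h.1] at h
      simp at h
    · intro T hT T' hT' h
      ext a
      rw [mem_powerset] at hT hT'
      have key : ∀ r, u r ∈ T ↔ u r ∈ T' := fun r => by
        have := congrFun h r
        simpa using this
      constructor
      · intro ha
        obtain ⟨r, -, rfl⟩ := mem_image.1 (hT ha)
        exact (key r).1 ha
      · intro ha
        obtain ⟨r, -, rfl⟩ := mem_image.1 (hT' ha)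
        exact (key r).2 ha
    · intro v hv
      simp only [mem_filter, mem_univ, true_and] at hv
      obtain ⟨hv, rfl⟩ := hv
      refine ⟨(univ.filter fun r => (v r).2 = true).image fun r => (v r).1, ?_, ?_⟩
      · rw [mem_powerset]
        exact image_subset_image (filter_subset _ _)
      · funext r
        refine Prod.ext rfl ?_
        simp only [mem_image, mem_filter, mem_univ, true_and]
        by_cases h : (v r).2 = true
        · rw [h, decide_eq_true_eq]; exact ⟨r, h, rfl⟩
        · have h' : (v r).2 = false := by simpa using h
          rw [h', decide_eq_false_iff_not]
          rintro ⟨a, ha, hb⟩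
          refine hv a r (Prod.ext hb ?_)
          simp [Lit.neg, ha, h']
  rw [h1, pureCount]
  let e := Fintype.equivFin ι
  refine Fintype.sum_equiv (e.arrowCongr (Equiv.refl _)) _ _ fun u => ?_
  congr 2
  ext a
  simp only [mem_image, mem_univ, true_and]
  constructor
  · rintro ⟨r, rfl⟩; exact ⟨e r, by simp [Equiv.arrowCongr]⟩
  · rintro ⟨r, rfl⟩; exact ⟨e.symm r, by simp [Equiv.arrowCongr]⟩

theorem pureCount_succ (m j : ℕ) : pureCount m (j + 1) =
    ∑ x : Fin m, ∑ u : Fin j → Fin m, 2 ^ #(insert x (univ.image u)) := by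
  rw [pureCount, ← Fintype.sum_prod_type']
  symm
  refine Fintype.sum_equiv (Fin.consEquiv fun _ => Fin m) _ _ ?_
  rintro ⟨x, u⟩
  congr 2
  ext a
  simp [Fin.exists_fin_succ, eq_comm]

/-- A pure sequence extends by any variable with one or two admissible signs. With
`pureCount_succ_le` this confines the ratio of consecutive counts to `[m, 2m]`, which makes the
terms of the generating series vary slowly. -/
theorem mul_pureCount_le (m j : ℕ) : m * pureCount m j ≤ pureCount m (j + 1) := by
  rw [pureCount_succ, pureCount]
  calc m * ∑ u : Fin j → Fin m, 2 ^ #(univ.image u)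
      = ∑ x : Fin m, ∑ u : Fin j → Fin m, 2 ^ #(univ.image u) := by simp
    _ ≤ _ := sum_le_sum fun x _ => sum_le_sum fun u _ =>
        Nat.pow_le_pow_right (by norm_num) (card_le_card (subset_insert _ _))

theorem pureCount_succ_le (m j : ℕ) : pureCount m (j + 1) ≤ 2 * m * pureCount m j := by
  rw [pureCount_succ, pureCount]
  calc _ ≤ ∑ x : Fin m, ∑ u : Fin j → Fin m, 2 ^ (#(univ.image u) + 1) :=
        sum_le_sum fun x _ => sum_le_sum fun u _ =>
        Nat.pow_le_pow_right (by norm_num) (card_insert_le _ _)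
    _ = _ := by
        simp only [pow_succ, ← sum_mul, sum_const, card_univ, Fintype.card_fin, smul_eq_mul]
        ring

/-- Inclusion and exclusion over the variables that do not occur. -/
theorem pureCount_eq_sum_powerset (m j : ℕ) : (pureCount m j : ℝ) =
    ∑ T ∈ (univ : Finset (Fin m)).powerset, 2 ^ #T * (-1) ^ #(univ \ T) * (#T : ℝ) ^ j := by
  have h : ∀ u : Fin j → Fin m, (2 : ℝ) ^ #(univ.image u) =
      ∑ T ∈ (univ : Finset (Fin m)).powerset,
        2 ^ #T * (-1) ^ #(univ \ T) * (if ∀ r, u r ∈ T then 1 else 0) := by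
    intro u
    -- Each factor is 2 on the image and 1 off it; in the expansion only the sets `T` that contain
    -- the image survive.
    have h1 : (2 : ℝ) ^ #(univ.image u) =
        ∏ x : Fin m, (2 + -(if x ∈ univ.image u then 0 else 1)) := by
      rw [← prod_const, ← prod_subset (subset_univ (univ.image u))]
      · exact prod_congr rfl fun x hx => by rw [if_pos hx]; norm_num
      · intro x _ hx; rw [if_neg hx]; norm_num
    rw [h1, prod_add]
    refine sum_congr rfl fun T _ => ?_
    rw [prod_const, mul_assoc]
    congr 1
    rw [prod_neg]
    congr 1
    split_ifs with hT
    · refine prod_eq_one fun x hx => if_neg ?_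
      simp only [mem_image, mem_univ, true_and, not_exists]
      rintro r rfl
      exact (mem_sdiff.1 hx).2 (hT r)
    · push Not at hT
      obtain ⟨r, hr⟩ := hT
      exact prod_eq_zero (i := u r) (by simp [hr]) (by simp)
  rw [pureCount]
  push_cast
  simp_rw [h]
  rw [sum_comm]
  refine sum_congr rfl fun T _ => ?_
  rw [← mul_sum]
  congr 1
  rw [sum_boole]
  have : (univ.filter fun u : Fin j → Fin m => ∀ r, u r ∈ T) = Fintype.piFinset fun _ => T := by
    ext u; simp
  rw [this, Fintype.card_piFinset]
  simp

/-- The exponential generating function of the numbers of pure sequences. -/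
theorem hasSum_pureCount (m : ℕ) (x : ℝ) :
    HasSum (fun j : ℕ => (pureCount m j : ℝ) * x ^ j / (j.factorial : ℝ))
      ((2 * Real.exp x - 1) ^ m) := by
  have h : (2 * Real.exp x - 1) ^ m =
      ∑ T ∈ (univ : Finset (Fin m)).powerset,
        2 ^ #T * (-1) ^ #(univ \ T) * Real.exp (#T * x) := by
    have : (2 * Real.exp x - 1) ^ m = ∏ _i : Fin m, (2 * Real.exp x + -1) := by
      simp [sub_eq_add_neg]
    rw [this, prod_add]
    refine sum_congr rfl fun T _ => ?_
    rw [prod_const, prod_const, Real.exp_nat_mul, mul_pow]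
    ring
  rw [h]
  have h2 : (fun j : ℕ => (pureCount m j : ℝ) * x ^ j / (j.factorial : ℝ)) = fun j : ℕ =>
      ∑ T ∈ (univ : Finset (Fin m)).powerset,
        2 ^ #T * (-1) ^ #(univ \ T) * ((#T * x) ^ j / (j.factorial : ℝ)) := by
    funext j
    rw [pureCount_eq_sum_powerset, sum_mul, sum_div]
    refine sum_congr rfl fun T _ => ?_
    rw [mul_pow]
    ring
  rw [h2]
  refine hasSum_sum fun T _ => HasSum.mul_left _ ?_
  rw [Real.exp_eq_exp_ℝ]
  exact NormedSpace.expSeries_div_hasSum_exp _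

/-- A single term of a series with nonnegative terms is at most its sum. -/
theorem pureCount_mul_pow_le (m j : ℕ) {x : ℝ} (hx : 0 ≤ x) :
    (pureCount m j : ℝ) * x ^ j ≤ (j.factorial : ℝ) * (2 * Real.exp x - 1) ^ m := by
  have h := (hasSum_pureCount m x).summable.le_tsum j (fun i _ => by positivity)
  rw [(hasSum_pureCount m x).tsum_eq, div_le_iff₀ (by positivity)] at h
  linarith

/-! ### Walks that follow a partial injection or jump uniformly -/

section Walks

variable {V : Type} [Fintype V] [DecidableEq V]

/-- The entries of a power of a matrix are sums over walks. -/
theorem sum_walks_prod (M : Matrix V V ℝ) (k : ℕ) (a b : V) :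
    ∑ x : Fin (k + 1) → V, (if x 0 = a ∧ x (Fin.last k) = b then
      ∏ i : Fin k, M (x i.castSucc) (x i.succ) else 0) = (M ^ k) a b := by
  induction k generalizing a with
  | zero =>
    rw [← Equiv.sum_comp (Equiv.funUnique (Fin 1) V).symm]
    simp only [pow_zero, Matrix.one_apply]
    by_cases h : a = b
    · subst h; simp [Equiv.funUnique]
    · simp only [h, if_false]
      refine sum_eq_zero fun x _ => if_neg ?_
      rintro ⟨h1, h2⟩
      exact h (h1.symm.trans h2)
  | succ k ih =>
    rw [pow_succ', Matrix.mul_apply, ← Equiv.sum_comp (Fin.consEquiv fun _ => V),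
      Fintype.sum_prod_type, sum_eq_single a]
    · simp_rw [← ih, mul_sum]
      rw [sum_comm]
      refine sum_congr rfl fun x _ => ?_
      rw [sum_eq_single (x 0)]
      · simp only [Fin.consEquiv_apply, Fin.cons_zero, true_and, mul_ite, mul_zero,
          Fin.prod_univ_succ, Fin.castSucc_zero, Fin.cons_succ, ← Fin.succ_last, ← Fin.succ_castSucc]
      · intro c _ hc
        rw [if_neg (fun h => hc h.1.symm), mul_zero]
      · simp
    · intro c _ hc
      refine sum_eq_zero fun x _ => if_neg ?_
      simp [hc]
    · simp

/-- The adjacency matrix of a relation. -/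
def stepMat (P : Finset (V × V)) : Matrix V V ℝ :=
  Matrix.of fun a b => if (a, b) ∈ P then 1 else 0

/-- A step is either a step of the relation, or a uniformly random jump. -/
noncomputable def mixMat (P : Finset (V × V)) : Matrix V V ℝ :=
  Matrix.of fun a b => stepMat P a b + 1 / (Fintype.card V : ℝ)

/-- The relation is the graph of a partial injection. -/
def IsPartialInj (P : Finset (V × V)) : Prop :=
  ∀ e ∈ P, ∀ e' ∈ P, e.1 = e'.1 ∨ e.2 = e'.2 → e = e'

noncomputable instance (P : Finset (V × V)) : Decidable (IsPartialInj P) :=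
  Classical.propDecidable _

variable {P : Finset (V × V)}

theorem stepMat_apply (a b : V) : stepMat P a b = if (a, b) ∈ P then 1 else 0 := rfl

theorem mixMat_apply (a b : V) : mixMat P a b = stepMat P a b + 1 / (Fintype.card V : ℝ) := rfl

theorem stepMat_nonneg (a b : V) : 0 ≤ stepMat P a b := by
  rw [stepMat_apply]; split_ifs <;> norm_num

theorem mixMat_nonneg (a b : V) : 0 ≤ mixMat P a b :=
  add_nonneg (stepMat_nonneg a b) (by positivity)

theorem pow_apply_nonneg {M : Matrix V V ℝ} (hM : ∀ a b, 0 ≤ M a b) (k : ℕ) (a b : V) :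
    0 ≤ (M ^ k) a b := by
  rw [← sum_walks_prod]
  refine sum_nonneg fun x _ => ?_
  split_ifs
  · exact prod_nonneg fun i _ => hM _ _
  · exact le_rfl

theorem sum_stepMat_row (hP : IsPartialInj P) (a : V) :
    ∑ b, stepMat P a b ≤ if a ∈ P.image Prod.fst then 1 else 0 := by
  split_ifs with h
  · obtain ⟨⟨a', b⟩, he, rfl⟩ := mem_image.1 h
    rw [sum_eq_single b]
    · rw [stepMat_apply]; split_ifs <;> norm_num
    · intro c _ hc
      rw [stepMat_apply, if_neg]
      intro h'
      exact hc (congrArg Prod.snd (hP _ h' _ he (Or.inl rfl)))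
    · simp
  · refine (sum_eq_zero fun b _ => ?_).le
    rw [stepMat_apply, if_neg]
    exact fun h' => h (mem_image_of_mem Prod.fst h')

theorem sum_stepMat_col (hP : IsPartialInj P) (b : V) :
    ∑ a, stepMat P a b ≤ if b ∈ P.image Prod.snd then 1 else 0 := by
  split_ifs with h
  · obtain ⟨⟨a, b'⟩, he, rfl⟩ := mem_image.1 h
    rw [sum_eq_single a]
    · rw [stepMat_apply]; split_ifs <;> norm_num
    · intro c _ hc
      rw [stepMat_apply, if_neg]
      intro h'
      exact hc (congrArg Prod.fst (hP _ h' _ he (Or.inr rfl)))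
    · simp
  · refine (sum_eq_zero fun a _ => ?_).le
    rw [stepMat_apply, if_neg]
    exact fun h' => h (mem_image_of_mem Prod.snd h')

theorem sum_mul_stepMat_le (hP : IsPartialInj P) {f : V → ℝ} {B : ℝ} (hB : 0 ≤ B)
    (hf : ∀ a, f a ≤ B) (b : V) :
    ∑ a, f a * stepMat P a b ≤ if b ∈ P.image Prod.snd then B else 0 := by
  calc ∑ a, f a * stepMat P a b ≤ ∑ a, B * stepMat P a b :=
        sum_le_sum fun a _ => mul_le_mul_of_nonneg_right (hf a) (stepMat_nonneg _ _)
    _ = B * ∑ a, stepMat P a b := by rw [mul_sum]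
    _ ≤ B * _ := mul_le_mul_of_nonneg_left (sum_stepMat_col hP b) hB
    _ = _ := by split_ifs <;> simp

theorem sum_stepMat_mul_le (hP : IsPartialInj P) {f : V → ℝ} {B : ℝ} (hB : 0 ≤ B)
    (hf : ∀ a, f a ≤ B) (a : V) :
    ∑ b, stepMat P a b * f b ≤ if a ∈ P.image Prod.fst then B else 0 := by
  calc ∑ b, stepMat P a b * f b ≤ ∑ b, stepMat P a b * B :=
        sum_le_sum fun b _ => mul_le_mul_of_nonneg_left (hf b) (stepMat_nonneg _ _)
    _ = (∑ b, stepMat P a b) * B := by rw [sum_mul]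
    _ ≤ _ * B := mul_le_mul_of_nonneg_right (sum_stepMat_row hP a) hB
    _ = _ := by split_ifs <;> simp

theorem sum_stepMat_all : ∑ a, ∑ b, stepMat P a b = #P := by
  simp_rw [stepMat_apply]
  rw [← Fintype.sum_prod_type']
  simp

theorem stepMat_pow_le_one (hP : IsPartialInj P) (k : ℕ) (a b : V) : (stepMat P ^ k) a b ≤ 1 := by
  induction k generalizing a with
  | zero => rw [pow_zero, Matrix.one_apply]; split_ifs <;> norm_num
  | succ k ih =>
    rw [pow_succ', Matrix.mul_apply]
    refine (sum_stepMat_mul_le hP zero_le_one ih a).trans ?_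
    split_ifs <;> norm_num

theorem stepMat_pow_le (hP : IsPartialInj P) {k : ℕ} (hk : 1 ≤ k) (a b : V) :
    (stepMat P ^ k) a b ≤ if a ∈ P.image Prod.fst then 1 else 0 := by
  obtain ⟨k, rfl⟩ := Nat.exists_eq_add_of_le' hk
  rw [pow_succ', Matrix.mul_apply]
  exact sum_stepMat_mul_le hP zero_le_one (fun c => stepMat_pow_le_one hP k c b) a

/-- The column sums of the powers of the mixed matrix. -/
noncomputable def colSum (P : Finset (V × V)) (k : ℕ) (b : V) : ℝ := ∑ a, (mixMat P ^ k) a b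

theorem colSum_succ (k : ℕ) (b : V) : colSum P (k + 1) b =
    ∑ a, colSum P k a * stepMat P a b + (∑ a, colSum P k a) / (Fintype.card V : ℝ) := by
  simp only [colSum, pow_succ, Matrix.mul_apply]
  rw [sum_comm, sum_div, ← sum_add_distrib]
  refine sum_congr rfl fun a _ => ?_
  rw [← sum_mul, mixMat_apply]
  ring

variable {K : ℕ}

/-- The two bounds feed each other. A relation step contributes at most the previous maximum to a
column, a jump contributes the average, which is at most 2. The average grows by at most `(2k+1) K /
N`, since the relation has at most `K` edges, and these increments add up to `K k² / N`. -/
theorem colSum_bounds [Nonempty V] (hP : IsPartialInj P) (hK : #P ≤ K) (k : ℕ)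
    (hk : K * k ^ 2 ≤ Fintype.card V) :
    (∑ b, colSum P k b) / (Fintype.card V : ℝ) ≤ 1 + K * k ^ 2 / (Fintype.card V : ℝ) ∧
      ∀ b, colSum P k b ≤ 2 * k + 1 := by
  have hN : (0 : ℝ) < Fintype.card V := by exact_mod_cast Fintype.card_pos
  induction k with
  | zero =>
    have h : ∀ b : V, colSum P 0 b = 1 := fun b => by simp [colSum, Matrix.one_apply]
    simp [h, hN.ne']
  | succ k ih =>
    have hk' : K * k ^ 2 ≤ Fintype.card V := le_trans (by gcongr; omega) hk
    obtain ⟨h1, h2⟩ := ih hk'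
    have hkr : (K * k ^ 2 / (Fintype.card V : ℝ) : ℝ) ≤ 1 := by
      rw [div_le_one hN]; exact_mod_cast hk'
    have hB : (0 : ℝ) ≤ 2 * k + 1 := by positivity
    constructor
    · have h3 : ∑ b, colSum P (k + 1) b ≤ (2 * k + 1) * K + ∑ b, colSum P k b := by
        calc ∑ b, colSum P (k + 1) b
            = ∑ a, ∑ b, colSum P k a * stepMat P a b + ∑ b, colSum P k b := by
              simp_rw [colSum_succ]
              rw [sum_add_distrib, sum_comm]
              congr 1
              rw [sum_const, card_univ, nsmul_eq_mul]
              field_simp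
          _ ≤ ∑ a, ∑ b, (2 * k + 1) * stepMat P a b + ∑ b, colSum P k b := by
              gcongr with a _ b _
              · exact stepMat_nonneg _ _
              · exact h2 a
          _ = (2 * k + 1) * (#P : ℝ) + ∑ b, colSum P k b := by
              simp_rw [← mul_sum]
              rw [sum_stepMat_all]
          _ ≤ _ := by gcongr
      calc _ ≤ ((2 * k + 1) * K + ∑ b, colSum P k b) / (Fintype.card V : ℝ) := by gcongr
        _ = (2 * k + 1) * K / (Fintype.card V : ℝ) + (∑ b, colSum P k b) / (Fintype.card V : ℝ) := by
            rw [add_div]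
        _ ≤ (2 * k + 1) * K / (Fintype.card V : ℝ) + (1 + K * k ^ 2 / (Fintype.card V : ℝ)) := by gcongr
        _ = _ := by push_cast; ring
    · intro b
      rw [colSum_succ]
      have h4 := sum_mul_stepMat_le hP hB h2 b
      have h5 : (if b ∈ P.image Prod.snd then (2 * k + 1 : ℝ) else 0) ≤ 2 * k + 1 := by
        split_ifs <;> linarith
      push_cast
      linarith

/-- A vertex that is no target is entered by jumps only, so its column sum is the previous average.
-/
theorem colSum_le_of_notMem [Nonempty V] (hP : IsPartialInj P) (hK : #P ≤ K) (k : ℕ)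
    (hk : K * k ^ 2 ≤ Fintype.card V) {b : V} (hb : b ∉ P.image Prod.snd) :
    colSum P k b ≤ 1 + K * k ^ 2 / (Fintype.card V : ℝ) := by
  cases k with
  | zero => simp [colSum, Matrix.one_apply]
  | succ k =>
    have hk' : K * k ^ 2 ≤ Fintype.card V := le_trans (by gcongr; omega) hk
    obtain ⟨h1, h2⟩ := colSum_bounds hP hK k hk'
    rw [colSum_succ]
    have h4 := sum_mul_stepMat_le hP (by positivity) h2 b
    rw [if_neg hb] at h4
    have h5 : (K * k ^ 2 / (Fintype.card V : ℝ) : ℝ) ≤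
        K * ((k + 1 : ℕ) : ℝ) ^ 2 / (Fintype.card V : ℝ) := by
      gcongr; omega
    linarith

/-- The part of a power of the mixed matrix that uses at least one jump. -/
noncomputable def gap (P : Finset (V × V)) (k : ℕ) (a b : V) : ℝ := (mixMat P ^ k) a b - (stepMat P ^ k) a b

/-- Split by the first step: after a relation step a jump is still owed, whereas after a jump the
rest is free and its end points sum to a column sum. -/
theorem gap_succ (k : ℕ) (a b : V) : gap P (k + 1) a b =
    ∑ c, stepMat P a c * gap P k c b + colSum P k b / (Fintype.card V : ℝ) := by
  simp only [gap, colSum, pow_succ', Matrix.mul_apply, mul_sub, sum_sub_distrib, mixMat_apply,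
    add_mul, sum_add_distrib, sum_div]
  have : ∀ c : V, 1 / (Fintype.card V : ℝ) * (mixMat P ^ k) c b =
    (mixMat P ^ k) c b / (Fintype.card V : ℝ) := fun c => by ring
  simp_rw [this]
  ring

theorem colSum_nonneg (k : ℕ) (b : V) : 0 ≤ colSum P k b :=
  sum_nonneg fun a _ => pow_apply_nonneg mixMat_nonneg k a b

theorem gap_nonneg (k : ℕ) (a b : V) : 0 ≤ gap P k a b := by
  induction k generalizing a with
  | zero => simp [gap]
  | succ k ih =>
    rw [gap_succ]
    exact add_nonneg (sum_nonneg fun c _ => mul_nonneg (stepMat_nonneg _ _) (ih c))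
      (div_nonneg (colSum_nonneg _ _) (Nat.cast_nonneg _))

/-- The first jump occurs at one of `k` steps, it is reached by at most one relation path, and what
follows costs a column sum over `N`. -/
theorem gap_le [Nonempty V] (hP : IsPartialInj P) (hK : #P ≤ K) (k : ℕ)
    (hk : K * k ^ 2 ≤ Fintype.card V) (a b : V) :
    gap P k a b ≤ 3 * k ^ 2 / (Fintype.card V : ℝ) := by
  have hN : (0 : ℝ) < Fintype.card V := by exact_mod_cast Fintype.card_pos
  have main : gap P k a b ≤ k * (2 * k + 1) / (Fintype.card V : ℝ) := by
    induction k generalizing a with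
    | zero => simp [gap]
    | succ k ih =>
      have hk' : K * k ^ 2 ≤ Fintype.card V := le_trans (by gcongr; omega) hk
      have h1 := (colSum_bounds hP hK k hk').2 b
      rw [gap_succ]
      have h4 := sum_stepMat_mul_le hP (f := fun c => gap P k c b)
        (B := k * (2 * k + 1) / (Fintype.card V : ℝ)) (by positivity) (fun c => ih hk' c) a
      have h5 : (if a ∈ P.image Prod.fst then (k * (2 * k + 1) / (Fintype.card V : ℝ) : ℝ) else 0)
          ≤ k * (2 * k + 1) / (Fintype.card V : ℝ) := by
        split_ifs
        · exact le_rfl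
        · positivity
      calc _ ≤ k * (2 * k + 1) / (Fintype.card V : ℝ) + (2 * k + 1) / (Fintype.card V : ℝ) := by
            gcongr; exact h4.trans h5
        _ = (k + 1) * (2 * k + 1) / (Fintype.card V : ℝ) := by ring
        _ ≤ _ := by push_cast; gcongr <;> linarith
  refine main.trans (div_le_div_of_nonneg_right ?_ hN.le)
  have : k ≤ k ^ 2 := Nat.le_self_pow (by norm_num) k
  have h : (k : ℝ) ≤ k ^ 2 := by exact_mod_cast this
  nlinarith

/-- The first step must be a jump because `a` is no source, and the remaining column sum is close to
1 because `b` is no target. The leading constant 1 is what later cancels the disjoint snakes. -/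
theorem gap_le_of_notMem [Nonempty V] (hP : IsPartialInj P) (hK : #P ≤ K) {k : ℕ} (hk1 : 1 ≤ k)
    (hk : K * k ^ 2 ≤ Fintype.card V) {a b : V} (ha : a ∉ P.image Prod.fst)
    (hb : b ∉ P.image Prod.snd) :
    gap P k a b ≤ (1 + K * k ^ 2 / (Fintype.card V : ℝ)) / (Fintype.card V : ℝ) := by
  obtain ⟨k, rfl⟩ := Nat.exists_eq_add_of_le' hk1
  have hk' : K * k ^ 2 ≤ Fintype.card V := le_trans (by gcongr; omega) hk
  have h4 := sum_stepMat_mul_le hP (f := fun c => gap P k c b) (by positivity)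
    (fun c => gap_le hP hK k hk' c b) a
  rw [if_neg ha] at h4
  rw [gap_succ]
  calc _ ≤ 0 + (1 + K * k ^ 2 / (Fintype.card V : ℝ)) / (Fintype.card V : ℝ) := by
        gcongr; exact colSum_le_of_notMem hP hK k hk' hb
    _ ≤ _ := by rw [zero_add]; gcongr; omega

/-- Both halves of a closed walk contain a jump, and not all steps are jumps. -/
theorem sum_gap_mul_gap_le [Nonempty V] (hP : IsPartialInj P) (hK : #P ≤ K) {t : ℕ} (ht : 1 ≤ t)
    (hk : K * t ^ 2 ≤ Fintype.card V) {ν : V → V} (hν : Function.Injective ν) :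
    ∑ u, (gap P t (ν u) u * gap P t u (ν u) - 1 / (Fintype.card V : ℝ) ^ 2) ≤
      39 * K * t ^ 4 / (Fintype.card V : ℝ) ^ 2 := by
  have hN : (0 : ℝ) < Fintype.card V := by exact_mod_cast Fintype.card_pos
  set N : ℝ := ((Fintype.card V : ℕ) : ℝ) with hNdef
  let A := P.image Prod.fst ∪ P.image Prod.snd
  have hA : #A ≤ 2 * K := by
    refine (card_union_le _ _).trans ?_
    have h1 : #(P.image Prod.fst) ≤ #P := card_image_le
    have h2 : #(P.image Prod.snd) ≤ #P := card_image_le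
    omega
  -- Away from `Bad` the product of gaps is `1/N²` up to a factor `1 + O(K t²/N)`; on the at most
  -- `4K` vertices of `Bad` the crude bound `gap_le` suffices. This yields `39 = 4 * 9 + 3`.
  let Bad := A ∪ univ.filter fun u => ν u ∈ A
  have hBad : #Bad ≤ 4 * K := by
    refine (card_union_le _ _).trans ?_
    have h1 : #(univ.filter fun u => ν u ∈ A) ≤ #A :=
      card_le_card_of_injOn ν (fun u hu => (mem_filter.1 hu).2) hν.injOn
    omega
  have hx : (K : ℝ) * t ^ 2 / N ≤ 1 := by
    rw [div_le_one hN, hNdef]; exact_mod_cast hk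
  have hterm : ∀ u, gap P t (ν u) u * gap P t u (ν u) - 1 / N ^ 2 ≤
      (if u ∈ Bad then (3 * t ^ 2 / N) ^ 2 else 0) + 3 * (K * t ^ 2 / N) / N ^ 2 := by
    intro u
    split_ifs with hu
    · have h1 : gap P t (ν u) u * gap P t u (ν u) ≤ (3 * t ^ 2 / N) ^ 2 := by
        rw [pow_two (3 * _ / N)]
        exact mul_le_mul (gap_le hP hK t hk _ _) (gap_le hP hK t hk _ _) (gap_nonneg _ _ _)
          (by positivity)
      have h2 : 0 ≤ 1 / N ^ 2 := by positivity
      have h3 : 0 ≤ 3 * (K * t ^ 2 / N) / N ^ 2 := by positivity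
      linarith
    · simp only [Bad, A, mem_union, mem_filter, mem_univ, true_and, not_or] at hu
      have h1 : gap P t (ν u) u * gap P t u (ν u) ≤ ((1 + K * t ^ 2 / N) / N) ^ 2 := by
        rw [pow_two (_ / N)]
        exact mul_le_mul (gap_le_of_notMem hP hK ht hk hu.2.1 hu.1.2)
          (gap_le_of_notMem hP hK ht hk hu.1.1 hu.2.2) (gap_nonneg _ _ _) (by positivity)
      have h2 : 0 ≤ (K : ℝ) * t ^ 2 / N := by positivity
      calc _ ≤ ((1 + K * t ^ 2 / N) / N) ^ 2 - 1 / N ^ 2 := by gcongr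
        _ = ((1 + K * t ^ 2 / N) ^ 2 - 1) / N ^ 2 := by ring
        _ ≤ 3 * (K * t ^ 2 / N) / N ^ 2 := by gcongr; nlinarith
        _ = _ := by ring
  calc _ ≤ ∑ u, ((if u ∈ Bad then (3 * t ^ 2 / N) ^ 2 else 0) + 3 * (K * t ^ 2 / N) / N ^ 2) :=
        sum_le_sum fun u _ => hterm u
    _ = #Bad * (3 * t ^ 2 / N) ^ 2 + N * (3 * (K * t ^ 2 / N) / N ^ 2) := by
        rw [sum_add_distrib, sum_ite_mem]
        simp [hNdef]
    _ ≤ (4 * K : ℕ) * (3 * t ^ 2 / N) ^ 2 + N * (3 * (K * t ^ 2 / N) / N ^ 2) := by gcongr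
    _ = (36 * K * t ^ 4 + 3 * K * t ^ 2) / N ^ 2 := by push_cast; field_simp; ring
    _ ≤ (36 * K * t ^ 4 + 3 * K * t ^ 4) / N ^ 2 := by
        gcongr
        · exact_mod_cast ht
        · norm_num
    _ = _ := by ring

/-- Under a partial injection a walk is determined by its start, and the start is one of at most `K`
sources as soon as `t ≥ 1`. -/
theorem sum_stepMat_pow_le (hP : IsPartialInj P) (hK : #P ≤ K) {t : ℕ} (ht : 1 ≤ t)
    {σ τ : V → V} (hσ : Function.Injective σ) :
    ∑ u, (stepMat P ^ t) (σ u) (τ u) ≤ K := by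
  calc ∑ u, (stepMat P ^ t) (σ u) (τ u)
      ≤ ∑ u, (if σ u ∈ P.image Prod.fst then (1 : ℝ) else 0) :=
        sum_le_sum fun u _ => stepMat_pow_le hP ht _ _
    _ = #(univ.filter fun u => σ u ∈ P.image Prod.fst) := by rw [sum_boole]
    _ ≤ #(P.image Prod.fst) := by
        exact_mod_cast card_le_card_of_injOn σ (fun u hu => (mem_filter.1 hu).2) hσ.injOn
    _ ≤ K := by exact_mod_cast card_image_le.trans hK

/-- One half of a closed walk has no jump. -/
theorem sum_stepMat_mul_gap_le [Nonempty V] (hP : IsPartialInj P) (hK : #P ≤ K) {t : ℕ}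
    (ht : 1 ≤ t) (hk : K * t ^ 2 ≤ Fintype.card V) {ν : V → V} (hν : Function.Injective ν) :
    ∑ u, ((stepMat P ^ t) (ν u) u * gap P t u (ν u) +
        gap P t (ν u) u * (stepMat P ^ t) u (ν u)) ≤
      6 * K * t ^ 2 / (Fintype.card V : ℝ) := by
  set N : ℝ := ((Fintype.card V : ℕ) : ℝ)
  have hN : (0 : ℝ) ≤ N := Nat.cast_nonneg _
  have h1 : ∀ u, (stepMat P ^ t) (ν u) u * gap P t u (ν u) +
      gap P t (ν u) u * (stepMat P ^ t) u (ν u) ≤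
      (3 * t ^ 2 / N) * ((stepMat P ^ t) (ν u) u + (stepMat P ^ t) u (ν u)) := by
    intro u
    have a1 := gap_le hP hK t hk u (ν u)
    have a2 := gap_le hP hK t hk (ν u) u
    have b1 := pow_apply_nonneg (M := stepMat P) stepMat_nonneg t (ν u) u
    have b2 := pow_apply_nonneg (M := stepMat P) stepMat_nonneg t u (ν u)
    nlinarith [mul_le_mul_of_nonneg_left a1 b1, mul_le_mul_of_nonneg_left a2 b2]
  refine (sum_le_sum fun u _ => h1 u).trans ?_
  rw [← mul_sum, sum_add_distrib]
  have e1 := sum_stepMat_pow_le hP hK ht (τ := id) hν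
  have e2 := sum_stepMat_pow_le hP hK ht (τ := ν) Function.injective_id
  simp only [id] at e1 e2
  calc _ ≤ (3 * t ^ 2 / N) * (K + K) := by gcongr
    _ = _ := by ring

end Walks

/-! ### Literals and the existential walk of a snake -/

theorem Lit.neg_neg {V : Type} (l : Lit V) : l.neg.neg = l := by simp [Lit.neg]

theorem Lit.neg_ne {V : Type} (l : Lit V) : l.neg ≠ l := by
  intro h
  have := congrArg Prod.snd h
  simp [Lit.neg] at this

theorem Lit.neg_injective {V : Type} : Function.Injective (Lit.neg : Lit V → Lit V) := fun a b h => by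
  rw [← a.neg_neg, h, b.neg_neg]

theorem Lit.neg_eq_iff {V : Type} {a b : Lit V} : a.neg = b ↔ a = b.neg :=
  ⟨fun h => by rw [← h, Lit.neg_neg], fun h => by rw [h, Lit.neg_neg]⟩

theorem pair_eq_pair {V : Type} [DecidableEq V] {a b c d : V}
    (h : ({a, b} : Finset V) = {c, d}) : a = c ∧ b = d ∨ a = d ∧ b = c := by
  have h' : ({a, b} : Set V) = {c, d} := by
    have := congrArg (fun s : Finset V => (s : Set V)) h
    simpa using this
  exact Set.pair_eq_pair_iff.1 h'

/-- The existential literals of a pure snake of length `2 * t`. -/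
structure IsSnakeWalk {V : Type} (t : ℕ) (w : ℕ → Lit V) : Prop where
  injOn : Set.InjOn (fun r => (w r).1) (Set.Icc 1 (2 * t - 1))
  zero : w 0 = (w t).neg
  last : w (2 * t) = (w t).neg

namespace IsSnakeWalk

variable {V : Type} {t : ℕ} {w : ℕ → Lit V} (h : IsSnakeWalk t w) (ht : 2 ≤ t)
include h ht

/-- The ends carry the variable of the middle, so every position can be moved into `[1, 2t - 1]`,
where the variables are distinct. -/
theorem eq_or_of_fst_eq {r r' : ℕ} (hr : r ≤ 2 * t) (hr' : r' ≤ 2 * t)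
    (e : (w r).1 = (w r').1) :
    r = r' ∨ (r = 0 ∨ r = t ∨ r = 2 * t) ∧ (r' = 0 ∨ r' = t ∨ r' = 2 * t) := by
  have key : ∀ r ≤ 2 * t, ∃ k, 1 ≤ k ∧ k ≤ 2 * t - 1 ∧ (w r).1 = (w k).1 ∧
      (k = r ∨ k = t ∧ (r = 0 ∨ r = t ∨ r = 2 * t)) := by
    intro r hr
    by_cases h0 : r = 0
    · exact ⟨t, by omega, by omega, by rw [h0, h.zero]; rfl, by omega⟩
    · by_cases h1 : r = 2 * t
      · exact ⟨t, by omega, by omega, by rw [h1, h.last]; rfl, by omega⟩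
      · exact ⟨r, by omega, by omega, rfl, Or.inl rfl⟩
  obtain ⟨k, k1, k2, k3, k4⟩ := key r hr
  obtain ⟨k', k1', k2', k3', k4'⟩ := key r' hr'
  have : k = k' := h.injOn ⟨k1, k2⟩ ⟨k1', k2'⟩ (by
    change (w k).1 = (w k').1
    rw [← k3, ← k3', e])
  omega

/-- Among the sources the middle variable occurs only at `0` and `t`, with opposite signs. The same
holds for the targets, at `t` and `2t`. -/
theorem src_injective {r r' : ℕ} (hr : r < 2 * t) (hr' : r' < 2 * t) (e : w r = w r') :
    r = r' := by
  rcases h.eq_or_of_fst_eq ht hr.le hr'.le (congrArg Prod.fst e) with h1 | ⟨h1, h2⟩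
  · exact h1
  · have n1 := (w t).neg_ne
    have z := h.zero
    rcases h1 with rfl | rfl | rfl <;> rcases h2 with h2 | h2 | h2 <;>
      first | omega | (subst h2; rw [z] at e; first | exact absurd e n1 | exact absurd e.symm n1)

theorem tgt_injective {r r' : ℕ} (hr : r < 2 * t) (hr' : r' < 2 * t) (e : w (r + 1) = w (r' + 1)) :
    r = r' := by
  rcases h.eq_or_of_fst_eq ht (r := r + 1) (r' := r' + 1) hr hr' (congrArg Prod.fst e) with h1 | ⟨h1, h2⟩
  · omega
  · have n1 := (w t).neg_ne
    have z := h.last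
    rcases h1 with h1 | h1 | h1 <;> rcases h2 with h2 | h2 | h2 <;>
      first | omega | (rw [h1, h2, z] at e; first | exact absurd e n1 | exact absurd e.symm n1)

theorem conflict {r r' : ℕ} (hr : r < 2 * t) (hr' : r' < 2 * t) (e : w r = (w (r' + 1)).neg) :
    (r = 0 ∨ r = t) ∧ (r' + 1 = t ∨ r' + 1 = 2 * t) := by
  rcases h.eq_or_of_fst_eq ht (r' := r' + 1) hr.le hr' (congrArg (fun l => l.1) e) with
    h1 | ⟨h1, h2⟩
  · rw [h1] at e
    exact absurd e.symm (Lit.neg_ne _)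
  · omega

/-- By `conflict` a reversal starts at `0` or `t`; its next position would have to be one of `0, t,
2t`, impossible for `t ≥ 2`. Hence no clause is read in both directions. -/
theorem not_reversed {r r' : ℕ} (hr : r < 2 * t) (hr' : r' < 2 * t)
    (e : w r = (w (r' + 1)).neg) (e' : w (r + 1) = (w r').neg) : False := by
  have h1 := h.conflict ht hr hr' e
  rcases h.eq_or_of_fst_eq ht (r := r + 1) hr hr'.le (congrArg (fun l => l.1) e') with h2 | h2
  · rw [h2] at e'
    exact absurd e'.symm (Lit.neg_ne _)
  · omega

end IsSnakeWalk

/-! ### Snakes coded by two half walks, and their implication edges -/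

section Codes

variable {V : Type} {t : ℕ}

/-- Two walks of length `t`, one after the other. -/
def joinWalk (x y : Fin (t + 1) → V) (r : ℕ) : V :=
  -- The `min` only keeps the index in range; it has no effect for `r ≤ 2 * t`.
  if h : r ≤ t then x ⟨r, by omega⟩ else y ⟨min (r - t) t, by omega⟩

/-- The sources of the steps of two walks. -/
def src (x y : Fin (t + 1) → V) : Fin t ⊕ Fin t → V :=
  Sum.elim (fun i => x i.castSucc) fun i => y i.castSucc

/-- The targets of the steps of two walks. -/
def tgt (x y : Fin (t + 1) → V) : Fin t ⊕ Fin t → V :=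
  Sum.elim (fun i => x i.succ) fun i => y i.succ

/-- The position of a step of two walks that follow each other. -/
def stepIdx (i : Fin t ⊕ Fin t) : ℕ := (finSumFinEquiv i : Fin (t + t))

theorem stepIdx_lt (i : Fin t ⊕ Fin t) : stepIdx i < 2 * t := by
  have := (finSumFinEquiv i : Fin (t + t)).2
  rw [stepIdx]; omega

theorem stepIdx_injective : Function.Injective (stepIdx : Fin t ⊕ Fin t → ℕ) :=
  Fin.val_injective.comp finSumFinEquiv.injective

theorem exists_stepIdx {r : ℕ} (hr : r < 2 * t) : ∃ i : Fin t ⊕ Fin t, stepIdx i = r :=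
  ⟨finSumFinEquiv.symm ⟨r, by omega⟩, by simp [stepIdx]⟩

/-- The two halves of the sequence of the existential literals of a pure snake. -/
def IsCode (x y : Fin (t + 1) → Lit V) : Prop :=
  y 0 = x (Fin.last t) ∧ IsSnakeWalk t (joinWalk x y)

noncomputable instance (x y : Fin (t + 1) → Lit V) : Decidable (IsCode x y) :=
  Classical.propDecidable _

theorem joinWalk_add {x y : Fin (t + 1) → V} (h : y 0 = x (Fin.last t)) (i : Fin (t + 1)) :
    joinWalk x y (t + i) = y i := by
  rw [joinWalk]
  split_ifs with h1
  · have h0 : i = 0 := Fin.ext (by rw [Fin.val_zero]; omega)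
    subst h0
    rw [h]
    congr 1
  · congr 1
    refine Fin.ext ?_
    simp only []
    have := i.2
    omega

theorem joinWalk_of_le (x y : Fin (t + 1) → V) (i : Fin (t + 1)) :
    joinWalk x y i = x i := by
  rw [joinWalk, dif_pos (by omega)]

theorem src_eq {x y : Fin (t + 1) → V} (h : y 0 = x (Fin.last t)) (i : Fin t ⊕ Fin t) :
    src x y i = joinWalk x y (stepIdx i) := by
  rcases i with i | i
  · exact (joinWalk_of_le x y i.castSucc).symm
  · exact (joinWalk_add h i.castSucc).symm

theorem tgt_eq {x y : Fin (t + 1) → V} (h : y 0 = x (Fin.last t)) (i : Fin t ⊕ Fin t) :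
    tgt x y i = joinWalk x y (stepIdx i + 1) := by
  rcases i with i | i
  · exact (joinWalk_of_le x y i.succ).symm
  · exact (joinWalk_add h i.succ).symm

variable [DecidableEq V]

/-- The implications of the existential parts of the clauses, and their contrapositives. -/
def edges (x y : Fin (t + 1) → Lit V) : Finset (Lit V × Lit V) :=
  univ.image (fun i => (src x y i, tgt x y i)) ∪
    univ.image fun i => ((tgt x y i).neg, (src x y i).neg)

theorem card_edges_le (x y : Fin (t + 1) → Lit V) : #(edges x y) ≤ 4 * t := by
  refine (card_union_le _ _).trans ?_
  have h1 : #(univ.image fun i => (src x y i, tgt x y i)) ≤ #(univ : Finset (Fin t ⊕ Fin t)) :=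
    card_image_le
  have h2 : #(univ.image fun i => ((tgt x y i).neg, (src x y i).neg)) ≤
    #(univ : Finset (Fin t ⊕ Fin t)) := card_image_le
  have h3 : #(univ : Finset (Fin t ⊕ Fin t)) = 2 * t := by simp; omega
  omega

/-- The edges at the literals where the walk branches. -/
def branchEdges (x y : Fin (t + 1) → Lit V) : Finset (Lit V × Lit V) :=
  (edges x y).filter fun e => e.1 ∈ ({x (Fin.last t), (x (Fin.last t)).neg} : Finset (Lit V)) ∨
    e.2 ∈ ({x (Fin.last t), (x (Fin.last t)).neg} : Finset (Lit V))

namespace IsCode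

variable {x y : Fin (t + 1) → Lit V} (h : IsCode x y) (ht : 2 ≤ t)

include h in
theorem x_zero : x 0 = (x (Fin.last t)).neg := by
  have e1 := joinWalk_of_le x y 0
  have e2 := joinWalk_of_le x y (Fin.last t)
  simp only [Fin.val_last, Fin.val_zero] at e1 e2
  rw [← e1, ← e2]
  exact h.2.zero

include h in
theorem y_last : y (Fin.last t) = (x (Fin.last t)).neg := by
  have := h.2.last
  rw [two_mul] at this
  have e1 := joinWalk_add h.1 (Fin.last t)
  have e2 := joinWalk_of_le x y (Fin.last t)
  simp only [Fin.val_last] at e1 e2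
  rwa [e1, e2] at this

include h ht

theorem src_injective : Function.Injective (src x y) := fun i j e => by
  rw [src_eq h.1, src_eq h.1] at e
  exact stepIdx_injective (h.2.src_injective ht (stepIdx_lt i) (stepIdx_lt j) e)

theorem tgt_injective : Function.Injective (tgt x y) := fun i j e => by
  rw [tgt_eq h.1, tgt_eq h.1] at e
  exact stepIdx_injective (h.2.tgt_injective ht (stepIdx_lt i) (stepIdx_lt j) e)

theorem conflict {i j : Fin t ⊕ Fin t} (e : src x y i = (tgt x y j).neg) :
    src x y i ∈ ({x (Fin.last t), (x (Fin.last t)).neg} : Finset (Lit V)) := by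
  rw [src_eq h.1] at e ⊢
  rw [tgt_eq h.1] at e
  have e2 := joinWalk_of_le x y (Fin.last t)
  simp only [Fin.val_last] at e2
  rcases (h.2.conflict ht (stepIdx_lt i) (stepIdx_lt j) e).1 with h1 | h1
  · rw [h1, h.2.zero, e2]; simp
  · rw [h1, e2]; simp

theorem not_reversed {i j : Fin t ⊕ Fin t} (e : src x y i = (tgt x y j).neg)
    (e' : tgt x y i = (src x y j).neg) : False := by
  rw [src_eq h.1, tgt_eq h.1] at e e'
  exact h.2.not_reversed ht (stepIdx_lt i) (stepIdx_lt j) e e'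

theorem pair_injective {i j : Fin t ⊕ Fin t}
    (e : ({(src x y i).neg, tgt x y i} : Finset (Lit V)) = {(src x y j).neg, tgt x y j}) :
    i = j := by
  rcases pair_eq_pair e with ⟨h1, -⟩ | ⟨h1, h2⟩
  · exact h.src_injective ht (Lit.neg_injective h1)
  · exact (h.not_reversed ht (Lit.neg_eq_iff.1 h1) h2).elim

/-- The two literals of the middle variable are hit by at most two sources and two targets, hence at
most 4 positions are involved, each with an implication and a contrapositive. -/
theorem card_branchEdges_le : #(branchEdges x y) ≤ 8 := by
  set T : Finset (Lit V) := {x (Fin.last t), (x (Fin.last t)).neg} with hT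
  have hTc : #T ≤ 2 := card_le_two
  have hTn : ∀ l, l.neg ∈ T ↔ l ∈ T := by
    intro l
    simp only [hT, mem_insert, mem_singleton, Lit.neg_eq_iff, Lit.neg_neg]
    tauto
  let I := univ.filter fun i => src x y i ∈ T
  let J := univ.filter fun i => tgt x y i ∈ T
  have hI : #I ≤ 2 := (card_le_card_of_injOn (src x y) (fun i hi => (mem_filter.1 hi).2)
    (h.src_injective ht).injOn).trans hTc
  have hJ : #J ≤ 2 := (card_le_card_of_injOn (tgt x y) (fun i hi => (mem_filter.1 hi).2)
    (h.tgt_injective ht).injOn).trans hTc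
  have hsub : branchEdges x y ⊆ (I ∪ J).image (fun i => (src x y i, tgt x y i)) ∪
      (I ∪ J).image fun i => ((tgt x y i).neg, (src x y i).neg) := by
    intro e he
    obtain ⟨he1, he2⟩ := mem_filter.1 he
    rw [← hT] at he2
    rcases mem_union.1 he1 with he1 | he1
    · obtain ⟨i, -, rfl⟩ := mem_image.1 he1
      refine mem_union_left _ (mem_image_of_mem _ ?_)
      simpa [I, J] using he2
    · obtain ⟨i, -, rfl⟩ := mem_image.1 he1
      refine mem_union_right _ (mem_image_of_mem _ ?_)
      simp only [hTn] at he2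
      simpa [I, J, or_comm] using he2
  refine (card_le_card hsub).trans ((card_union_le _ _).trans ?_)
  have h1 : #(I ∪ J) ≤ 4 := (card_union_le _ _).trans (by omega)
  have h2 : #((I ∪ J).image fun i => (src x y i, tgt x y i)) ≤ #(I ∪ J) := card_image_le
  have h3 : #((I ∪ J).image fun i => ((tgt x y i).neg, (src x y i).neg)) ≤ #(I ∪ J) :=
    card_image_le
  omega

/-- Sources and targets are injective, so two edges can only clash when one is an implication and
the other a contrapositive, and `conflict` locates this at the middle variable. -/
theorem mem_branchEdges_of_conflict {e e' : Lit V × Lit V} (he : e ∈ edges x y)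
    (he' : e' ∈ edges x y) (hc : e.1 = e'.1 ∨ e.2 = e'.2) (hne : e ≠ e') :
    e ∈ branchEdges x y ∧ e' ∈ branchEdges x y := by
  set T : Finset (Lit V) := {x (Fin.last t), (x (Fin.last t)).neg} with hT
  have hTn : ∀ l, l.neg ∈ T ↔ l ∈ T := by
    intro l
    simp only [hT, mem_insert, mem_singleton, Lit.neg_eq_iff, Lit.neg_neg]
    tauto
  suffices h1 : (e.1 = e'.1 ∧ e.1 ∈ T) ∨ (e.2 = e'.2 ∧ e.2 ∈ T) by
    rcases h1 with ⟨h1, h2⟩ | ⟨h1, h2⟩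
    · exact ⟨mem_filter.2 ⟨he, Or.inl h2⟩, mem_filter.2 ⟨he', Or.inl (h1 ▸ h2)⟩⟩
    · exact ⟨mem_filter.2 ⟨he, Or.inr h2⟩, mem_filter.2 ⟨he', Or.inr (h1 ▸ h2)⟩⟩
  rcases mem_union.1 he with he | he <;> rcases mem_union.1 he' with he' | he' <;>
    obtain ⟨i, -, rfl⟩ := mem_image.1 he <;> obtain ⟨j, -, rfl⟩ := mem_image.1 he'
  · exfalso
    rcases hc with hc | hc
    · exact hne (by rw [h.src_injective ht hc])
    · exact hne (by rw [h.tgt_injective ht hc])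
  · rcases hc with hc | hc
    · exact Or.inl ⟨hc, h.conflict ht hc⟩
    · refine Or.inr ⟨hc, ?_⟩
      have := h.conflict ht (Lit.neg_eq_iff.1 hc.symm)
      simp only at hc ⊢
      rw [hc, hTn]
      exact this
  · rcases hc with hc | hc
    · refine Or.inl ⟨hc, ?_⟩
      simp only at hc ⊢
      rw [hc]
      exact h.conflict ht hc.symm
    · refine Or.inr ⟨hc, ?_⟩
      have := h.conflict ht (Lit.neg_eq_iff.1 hc)
      simp only at hc ⊢
      rw [hTn]
      exact this
  · exfalso
    rcases hc with hc | hc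
    · exact hne (by rw [h.tgt_injective ht (Lit.neg_injective hc)])
    · exact hne (by rw [h.src_injective ht (Lit.neg_injective hc)])

/-- The edges that two codes have in common lie in one of few partial injections. -/
theorem exists_isPartialInj {x' y' : Fin (t + 1) → Lit V} (h' : IsCode x' y') :
    ∃ X ∈ (branchEdges x y).powerset, IsPartialInj (edges x y \ X) ∧
      ∀ i, (src x' y' i, tgt x' y' i) ∈ edges x y →
        (src x' y' i, tgt x' y' i) ∈ edges x y \ X := by
  -- Delete the branching edges that the second code does not traverse. A remaining clash would be
  -- between two steps of the second code, contradicting injectivity of its sources or targets.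
  refine ⟨branchEdges x y \ univ.image fun i => (src x' y' i, tgt x' y' i),
    mem_powerset.2 sdiff_subset, ?_, ?_⟩
  · intro e he e' he' hc
    by_contra hne
    obtain ⟨h1, h2⟩ := mem_sdiff.1 he
    obtain ⟨h1', h2'⟩ := mem_sdiff.1 he'
    obtain ⟨b, b'⟩ := h.mem_branchEdges_of_conflict ht h1 h1' hc hne
    have c : e ∈ univ.image fun i => (src x' y' i, tgt x' y' i) := by
      by_contra hcon; exact h2 (mem_sdiff.2 ⟨b, hcon⟩)
    have c' : e' ∈ univ.image fun i => (src x' y' i, tgt x' y' i) := by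
      by_contra hcon; exact h2' (mem_sdiff.2 ⟨b', hcon⟩)
    obtain ⟨i, -, rfl⟩ := mem_image.1 c
    obtain ⟨j, -, rfl⟩ := mem_image.1 c'
    rcases hc with hc | hc
    · exact hne (by rw [h'.src_injective ht hc])
    · exact hne (by rw [h'.tgt_injective ht hc])
  · intro i hi
    refine mem_sdiff.2 ⟨hi, fun hX => (mem_sdiff.1 hX).2 (mem_image_of_mem _ (mem_univ i))⟩

end IsCode

end Codes

/-! ### Pure snakes as images of codes -/

section Snakes

variable {m n t : ℕ}

/-- A clause of a pure snake given by its code. -/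
def snakeClause (x y : Fin (t + 1) → Lit (Fin n)) (v : Fin t ⊕ Fin t → Lit (Fin m))
    (i : Fin t ⊕ Fin t) : PreClause m n := (v i, {(src x y i).neg, tgt x y i})

/-- The pure snake given by its code. -/
def snake (x y : Fin (t + 1) → Lit (Fin n)) (v : Fin t ⊕ Fin t → Lit (Fin m)) :
    Finset (PreClause m n) := univ.image (snakeClause x y v)

variable {x y : Fin (t + 1) → Lit (Fin n)} {v : Fin t ⊕ Fin t → Lit (Fin m)}

theorem IsCode.snakeClause_injective (h : IsCode x y) (ht : 2 ≤ t) :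
    Function.Injective (snakeClause x y v) := fun _ _ e =>
  h.pair_injective ht (congrArg Prod.snd e)

theorem IsCode.card_snake (h : IsCode x y) (ht : 2 ≤ t) : #(snake x y v) = 2 * t := by
  rw [snake, card_image_of_injective _ (h.snakeClause_injective ht)]
  simp; omega

/-- The existential part is an unordered pair, so another snake may traverse the clause as its
contrapositive; this is why `edges` contains both directions. -/
theorem mem_edges_of_mem_snake {l : Lit (Fin m)} {a b : Lit (Fin n)}
    (h : (l, {a.neg, b}) ∈ snake x y v) : (a, b) ∈ edges x y := by
  obtain ⟨i, -, hi⟩ := mem_image.1 h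
  rcases pair_eq_pair (congrArg Prod.snd hi) with ⟨h1, h2⟩ | ⟨h1, h2⟩
  · rw [← Lit.neg_injective h1, ← h2]
    exact mem_union_left _ (mem_image_of_mem _ (mem_univ i))
  · refine mem_union_right _ (mem_image.2 ⟨i, mem_univ i, ?_⟩)
    rw [h1, h2, Lit.neg_neg]

/-- The existential part identifies the position in the snake and so forces the universal literal:
shared positions leave no freedom for `v`. -/
theorem IsCode.eq_of_mem_snake (h : IsCode x y) (ht : 2 ≤ t) {l l' : Lit (Fin m)}
    {s : Finset (Lit (Fin n))} (h1 : (l, s) ∈ snake x y v) (h2 : (l', s) ∈ snake x y v) :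
    l = l' := by
  obtain ⟨i, -, hi⟩ := mem_image.1 h1
  obtain ⟨j, -, hj⟩ := mem_image.1 h2
  have : i = j := h.pair_injective ht ((congrArg Prod.snd hi).trans (congrArg Prod.snd hj).symm)
  subst this
  exact (congrArg Prod.fst hi).symm.trans (congrArg Prod.fst hj)

theorem snake_eq_image_range (h : y 0 = x (Fin.last t)) (v' : ℕ → Lit (Fin m))
    (hv : ∀ i, v' (stepIdx i) = v i) :
    snake x y v = (range (2 * t)).image fun r =>
      (v' r, {(joinWalk x y r).neg, joinWalk x y (r + 1)}) := by
  ext C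
  simp only [snake, mem_image, mem_univ, true_and, mem_range, snakeClause, src_eq h, tgt_eq h]
  constructor
  · rintro ⟨i, rfl⟩
    exact ⟨stepIdx i, stepIdx_lt i, by rw [hv]⟩
  · rintro ⟨r, hr, rfl⟩
    obtain ⟨i, rfl⟩ := exists_stepIdx hr
    exact ⟨i, by rw [hv]⟩

theorem IsCode.isPureSnake (h : IsCode x y) (ht : 2 ≤ t) (hv : IsPure v) {s : ℕ}
    (hs : s + 1 = 2 * t) : IsPureSnake s (snake x y v) := by
  have ht0 : 0 < t + t := by omega
  -- Periodic extension keeps every value in the family `v`, hence pure.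
  let v' : ℕ → Lit (Fin m) := fun r => v (finSumFinEquiv.symm ⟨r % (t + t), Nat.mod_lt _ ht0⟩)
  have hv' : ∀ i, v' (stepIdx i) = v i := by
    intro i
    have h1 : stepIdx i % (t + t) = stepIdx i :=
      Nat.mod_eq_of_lt (by have := stepIdx_lt i; omega)
    simp only [v', h1]
    congr 1
    simp [stepIdx]
  refine ⟨by omega, t, hs, joinWalk x y, v', ?_, h.2.zero, ?_, fun r _ r' _ => hv _ _, ?_⟩
  · rw [show s = 2 * t - 1 by omega]; exact h.2.injOn
  · rw [hs]; exact h.2.last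
  · rw [hs]; exact snake_eq_image_range h.1 v' hv'

theorem IsPureSnake.exists_code {s : ℕ} {A : Finset (PreClause m n)} (hA : IsPureSnake s A)
    (hs : s + 1 = 2 * t) : ∃ x y : Fin (t + 1) → Lit (Fin n),
      ∃ v : Fin t ⊕ Fin t → Lit (Fin m), IsCode x y ∧ IsPure v ∧ A = snake x y v := by
  obtain ⟨h4, t', ht', w, v, hinj, h0, hl, hp, hA⟩ := hA
  obtain rfl : t' = t := by omega
  let x : Fin (t' + 1) → Lit (Fin n) := fun i => w i
  let y : Fin (t' + 1) → Lit (Fin n) := fun i => w (t' + i)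
  have hxy : y 0 = x (Fin.last t') := by simp [x, y]
  have hw : ∀ r ≤ 2 * t', joinWalk x y r = w r := by
    intro r hr
    rw [joinWalk]
    split_ifs with h
    · rfl
    · simp only [y]
      congr 1
      omega
  refine ⟨x, y, fun i => v (stepIdx i), ⟨hxy, ?_, ?_, ?_⟩, ?_, ?_⟩
  · intro r hr r' hr' e
    have hr2 := hr.2
    have hr2' := hr'.2
    simp only at e
    rw [hw r (by omega), hw r' (by omega)] at e
    refine hinj ?_ ?_ e
    · rwa [show s = 2 * t' - 1 by omega]
    · rwa [show s = 2 * t' - 1 by omega]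
  · rw [hw 0 (by omega), hw t' (by omega), h0]
  · rw [hw (2 * t') le_rfl, hw t' (by omega), ← hs, hl]
  · intro i j
    have hi := stepIdx_lt i
    have hj := stepIdx_lt j
    exact hp _ (by omega) _ (by omega)
  · rw [snake_eq_image_range hxy v (fun i => rfl), hA, hs]
    refine image_congr fun r hr => ?_
    have hr : r < 2 * t' := by simpa using hr
    rw [hw r hr.le, hw (r + 1) hr]

theorem IsCode.snake_subset (h : IsCode x y) (ht : 2 ≤ t) : snake x y v ⊆ allClauses m n := by
  intro C hC
  obtain ⟨i, -, rfl⟩ := mem_image.1 hC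
  have hne : (src x y i).1 ≠ (tgt x y i).1 := by
    rw [src_eq h.1, tgt_eq h.1]
    intro e
    have hi := stepIdx_lt i
    rcases h.2.eq_or_of_fst_eq ht hi.le hi e with h1 | h1 <;> omega
  refine mem_filter.2 ⟨mem_univ _, ?_, ?_⟩
  · refine card_pair fun e => hne ?_
    exact congrArg (fun l => l.1) e
  · simp only [snakeClause, image_insert, image_singleton]
    exact card_pair hne

theorem mem_pureSnakes_iff (ht : 2 ≤ t) {s : ℕ} (hs : s + 1 = 2 * t)
    {A : Finset (PreClause m n)} : A ∈ pureSnakes m n s ↔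
    ∃ x y : Fin (t + 1) → Lit (Fin n), ∃ v : Fin t ⊕ Fin t → Lit (Fin m),
      IsCode x y ∧ IsPure v ∧ A = snake x y v := by
  classical
  rw [pureSnakes, mem_filter, mem_powerset]
  constructor
  · rintro ⟨-, h⟩
    exact h.exists_code hs
  · rintro ⟨x, y, v, h, hv, rfl⟩
    exact ⟨h.snake_subset ht, h.isPureSnake ht hv hs⟩

end Snakes

/-! ### Weighted sums over closed walks -/

section ClosedWalks

variable {V : Type} [Fintype V] [DecidableEq V] {t : ℕ}

/-- The steps of a walk that follow a relation. -/
def halfSteps (P : Finset (V × V)) (x : Fin (t + 1) → V) : Finset (Fin t) :=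
  univ.filter fun i => (x i.castSucc, x i.succ) ∈ P

/-- The steps of two walks that follow a relation. -/
def pairSteps (P : Finset (V × V)) (x y : Fin (t + 1) → V) : Finset (Fin t ⊕ Fin t) :=
  univ.filter fun i => (src x y i, tgt x y i) ∈ P

theorem toLeft_pairSteps (P : Finset (V × V)) (x y : Fin (t + 1) → V) :
    (pairSteps P x y).toLeft = halfSteps P x := by
  ext i
  rw [mem_toLeft, pairSteps, halfSteps, mem_filter, mem_filter]
  simp [src, tgt]

theorem toRight_pairSteps (P : Finset (V × V)) (x y : Fin (t + 1) → V) :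
    (pairSteps P x y).toRight = halfSteps P y := by
  ext i
  rw [mem_toRight, pairSteps, halfSteps, mem_filter, mem_filter]
  simp [src, tgt]

/-- Two walks that form a closed walk through `u` and `ν u`. -/
def IsClosedPair (ν : V → V) (x y : Fin (t + 1) → V) : Prop :=
  x 0 = ν (x (Fin.last t)) ∧ y 0 = x (Fin.last t) ∧ y (Fin.last t) = ν (x (Fin.last t))

noncomputable instance (ν : V → V) (x y : Fin (t + 1) → V) : Decidable (IsClosedPair ν x y) :=
  Classical.propDecidable _

/-- Once the middle vertex `u` is fixed, the two halves are independent. -/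
theorem sum_isClosedPair (ν : V → V) (F G : (Fin (t + 1) → V) → ℝ) :
    ∑ x, ∑ y, (if IsClosedPair ν x y then F x * G y else 0) =
      ∑ u, (∑ x, if x 0 = ν u ∧ x (Fin.last t) = u then F x else 0) *
        (∑ y, if y 0 = u ∧ y (Fin.last t) = ν u then G y else 0) := by
  simp_rw [sum_mul_sum]
  conv_rhs => rw [sum_comm]
  refine sum_congr rfl fun x _ => ?_
  conv_rhs => rw [sum_comm]
  refine sum_congr rfl fun y _ => ?_
  rw [sum_eq_single (x (Fin.last t))]
  · by_cases h1 : x 0 = ν (x (Fin.last t)) <;> simp [IsClosedPair, h1]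
  · intro u _ hu
    rw [if_neg (fun h => hu h.2.symm), zero_mul]
  · simp

theorem prod_stepMat (P : Finset (V × V)) (x : Fin (t + 1) → V) :
    ∏ i : Fin t, stepMat P (x i.castSucc) (x i.succ) =
      if halfSteps P x = univ then 1 else 0 := by
  simp_rw [stepMat_apply]
  rw [Finset.prod_ite_zero]
  simp [halfSteps, eq_univ_iff_forall]

/-- Expanding the product chooses the set `S` of steps charged to the relation; each other step is
charged as a jump, even if it also follows the relation. -/
theorem prod_mixMat (P : Finset (V × V)) (x : Fin (t + 1) → V) :
    ∏ i : Fin t, mixMat P (x i.castSucc) (x i.succ) =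
      ∑ S ∈ (halfSteps P x).powerset, (1 / (Fintype.card V : ℝ)) ^ (t - #S) := by
  simp_rw [mixMat_apply, stepMat_apply]
  rw [prod_add, ← sum_subset (powerset_mono.2 (subset_univ (halfSteps P x)))]
  · refine sum_congr rfl fun S hS => ?_
    rw [prod_eq_one, one_mul, prod_const, card_sdiff_of_subset (subset_univ _), card_univ,
      Fintype.card_fin]
    intro i hi
    exact if_pos (mem_filter.1 (mem_powerset.1 hS hi)).2
  · intro S _ hS
    rw [mem_powerset, not_subset] at hS
    obtain ⟨i, hi, hi'⟩ := hS
    rw [prod_eq_zero hi, zero_mul]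
    refine if_neg fun h => hi' (mem_filter.2 ⟨mem_univ i, h⟩)

/-- The uniform matrix is idempotent. This is the exact contribution of `S = ∅` in one half. -/
theorem sum_walks_const [Nonempty V] (ht : 1 ≤ t) (a b : V) :
    ∑ x : Fin (t + 1) → V, (if x 0 = a ∧ x (Fin.last t) = b then
      (1 / (Fintype.card V : ℝ)) ^ t else 0) = 1 / (Fintype.card V : ℝ) := by
  have hN : (Fintype.card V : ℝ) ≠ 0 := by exact_mod_cast Fintype.card_ne_zero
  let M : Matrix V V ℝ := Matrix.of fun _ _ => 1 / (Fintype.card V : ℝ)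
  have hM : IsIdempotentElem M := by
    ext i j
    simp [M, Matrix.mul_apply, hN]
  have h := sum_walks_prod M t a b
  obtain ⟨k, rfl⟩ := Nat.exists_eq_add_of_le' ht
  rw [hM.pow_succ_eq] at h
  simpa [M] using h

/-- The weight of a set of steps: the remaining steps are jumps. The bound depends on whether
one of the halves is contained in the set. -/
noncomputable def stepWeight (r Q₁ Q₂ : ℝ) (S : Finset (Fin t ⊕ Fin t)) : ℝ :=
  (if S.toLeft = univ ∨ S.toRight = univ then Q₂ else Q₁) * r ^ (2 * t - #S)

/-- The total weight of the sets of steps that are neither empty nor full. -/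
noncomputable def totalWeight (r Q₁ Q₂ : ℝ) (U : Finset (Fin t ⊕ Fin t)) : ℝ :=
  ∑ S ∈ U.powerset.filter fun S => S ≠ ∅ ∧ S ≠ univ, stepWeight r Q₁ Q₂ S

variable {r Q₁ Q₂ : ℝ}

theorem stepWeight_nonneg (hr : 0 ≤ r) (h1 : 0 ≤ Q₁) (h2 : 0 ≤ Q₂)
    (S : Finset (Fin t ⊕ Fin t)) : 0 ≤ stepWeight r Q₁ Q₂ S := by
  unfold stepWeight
  split_ifs <;> positivity

theorem totalWeight_nonneg (hr : 0 ≤ r) (h1 : 0 ≤ Q₁) (h2 : 0 ≤ Q₂)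
    (U : Finset (Fin t ⊕ Fin t)) : 0 ≤ totalWeight r Q₁ Q₂ U :=
  sum_nonneg fun S _ => stepWeight_nonneg hr h1 h2 S

theorem totalWeight_mono (hr : 0 ≤ r) (h1 : 0 ≤ Q₁) (h2 : 0 ≤ Q₂)
    {U U' : Finset (Fin t ⊕ Fin t)} (h : U ⊆ U') :
    totalWeight r Q₁ Q₂ U ≤ totalWeight r Q₁ Q₂ U' :=
  sum_le_sum_of_subset_of_nonneg (filter_subset_filter _ (powerset_mono.2 h))
    fun S _ _ => stepWeight_nonneg hr h1 h2 S

theorem sum_powerset_ne_univ (U : Finset (Fin t)) (r : ℝ) :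
    ∑ S ∈ U.powerset, (if S = univ then 0 else r ^ (t - #S)) =
      ∑ S ∈ U.powerset, r ^ (t - #S) - if U = univ then 1 else 0 := by
  have h : ∀ S : Finset (Fin t), (if S = univ then (0 : ℝ) else r ^ (t - #S)) =
      r ^ (t - #S) - if S = univ then 1 else 0 := by
    intro S
    split_ifs with hS
    · subst hS; simp
    · simp
  simp_rw [h]
  rw [sum_sub_distrib, sum_ite_eq']
  congr 1
  simp [mem_powerset, univ_subset_iff]

/-- Split `S` into its halves. In each half `h` is the weight of all subsets and `f` that of the
full one. The factor of `Q₁` collects two proper halves without `S = ∅`; that of `Q₂` collects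
exactly one full half. Two full halves would be `S = univ`, which is excluded. -/
theorem totalWeight_le (ht : 1 ≤ t) (hr : 0 ≤ r)
    (U : Finset (Fin t ⊕ Fin t)) {f₁ f₂ h₁ h₂ : ℝ}
    (hf₁ : f₁ = if U.toLeft = univ then 1 else 0) (hf₂ : f₂ = if U.toRight = univ then 1 else 0)
    (hh₁ : h₁ = ∑ S ∈ U.toLeft.powerset, r ^ (t - #S))
    (hh₂ : h₂ = ∑ S ∈ U.toRight.powerset, r ^ (t - #S)) :
    totalWeight r Q₁ Q₂ U ≤ Q₁ * ((h₁ - f₁) * (h₂ - f₂) - r ^ t * r ^ t) +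
      Q₂ * (f₁ * (h₂ - f₂) + (h₁ - f₁) * f₂) := by
  let a : Finset (Fin t) → ℝ := fun S => r ^ (t - #S)
  let b : Finset (Fin t) → ℝ := fun S => if S = univ then 0 else r ^ (t - #S)
  let d : Finset (Fin t) → ℝ := fun S => if S = univ then 1 else 0
  let z : Finset (Fin t) → ℝ := fun S => if S = ∅ then r ^ t else 0
  have hb₁ : ∑ S ∈ U.toLeft.powerset, b S = h₁ - f₁ := by
    rw [hh₁, hf₁]; exact sum_powerset_ne_univ _ _
  have hb₂ : ∑ S ∈ U.toRight.powerset, b S = h₂ - f₂ := by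
    rw [hh₂, hf₂]; exact sum_powerset_ne_univ _ _
  have hd : ∀ W : Finset (Fin t), ∑ S ∈ W.powerset, d S = if W = univ then 1 else 0 := by
    intro W
    simp [d, sum_ite_eq', mem_powerset, univ_subset_iff]
  have hz : ∀ W : Finset (Fin t), ∑ S ∈ W.powerset, z S = r ^ t := by
    intro W
    simp [z, sum_ite_eq', mem_powerset]
  have hne : (∅ : Finset (Fin t)) ≠ univ := by
    intro h
    have := congrArg card h
    simp at this
    omega
  have hrhs : Q₁ * ((h₁ - f₁) * (h₂ - f₂) - r ^ t * r ^ t) +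
      Q₂ * (f₁ * (h₂ - f₂) + (h₁ - f₁) * f₂) =
      ∑ S₁ ∈ U.toLeft.powerset, ∑ S₂ ∈ U.toRight.powerset,
        (Q₁ * (b S₁ * b S₂ - z S₁ * z S₂) + Q₂ * (d S₁ * b S₂ + b S₁ * d S₂)) := by
    simp only [sum_add_distrib, ← mul_sum, sum_sub_distrib, ← sum_mul]
    rw [hb₁, hb₂, hz, hz, hd, hd, ← hf₁, ← hf₂]
  rw [hrhs, ← sum_product']
  have hterm : ∀ S₁ S₂ : Finset (Fin t), (if S₁.disjSum S₂ ≠ ∅ ∧ S₁.disjSum S₂ ≠ univ then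
      stepWeight r Q₁ Q₂ (S₁.disjSum S₂) else 0) ≤
      Q₁ * (b S₁ * b S₂ - z S₁ * z S₂) + Q₂ * (d S₁ * b S₂ + b S₁ * d S₂) := by
    intro S₁ S₂
    have c1 : #S₁ ≤ t := by simpa using card_le_univ S₁
    have c2 : #S₂ ≤ t := by simpa using card_le_univ S₂
    have e0 : S₁.disjSum S₂ = ∅ ↔ S₁ = ∅ ∧ S₂ = ∅ := by
      simp [Finset.disjSum_eq_empty]
    have e1 : S₁.disjSum S₂ = univ ↔ S₁ = univ ∧ S₂ = univ := by
      constructor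
      · intro h
        constructor
        · rw [← toLeft_disjSum (s := S₁) (t := S₂), h]; ext; simp
        · rw [← toRight_disjSum (s := S₁) (t := S₂), h]; ext; simp
      · rintro ⟨rfl, rfl⟩; ext (i | i) <;> simp
    have e2 : r ^ (2 * t - (#S₁ + #S₂)) = r ^ (t - #S₁) * r ^ (t - #S₂) := by
      rw [← pow_add]; congr 1; omega
    rw [stepWeight, toLeft_disjSum, toRight_disjSum, card_disjSum, e2]
    simp only [ne_eq, e0, e1]
    have p1 : 0 ≤ r ^ (t - #S₁) := by positivity
    have p2 : 0 ≤ r ^ (t - #S₂) := by positivity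
    by_cases u1 : S₁ = univ <;> by_cases u2 : S₂ = univ
    · subst u1; subst u2
      simp [b, d, z, hne.symm]
    · subst u1
      simp [b, d, z, hne.symm, u2]
    · subst u2
      simp [b, d, z, hne.symm, u1]
    · by_cases v1 : S₁ = ∅ ∧ S₂ = ∅
      · obtain ⟨rfl, rfl⟩ := v1
        simp [b, d, z, hne]
      · have : z S₁ * z S₂ = 0 := by
          by_cases w1 : S₁ = ∅
          · have w2 : S₂ ≠ ∅ := fun w => v1 ⟨w1, w⟩
            simp [z, w2]
          · simp [z, w1]
        rw [this]
        simp [b, d, u1, u2, v1]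
  rw [totalWeight, sum_filter]
  have hre : ∑ S ∈ U.powerset, (if S ≠ ∅ ∧ S ≠ univ then stepWeight r Q₁ Q₂ S else 0) =
      ∑ p ∈ U.toLeft.powerset ×ˢ U.toRight.powerset,
        if p.1.disjSum p.2 ≠ ∅ ∧ p.1.disjSum p.2 ≠ univ then
          stepWeight r Q₁ Q₂ (p.1.disjSum p.2) else 0 := by
    refine sum_bij' (fun S _ => (S.toLeft, S.toRight)) (fun p _ => p.1.disjSum p.2) ?_ ?_ ?_ ?_ ?_
    · intro S hS
      rw [mem_powerset] at hS
      exact mem_product.2 ⟨mem_powerset.2 (toLeft_subset_toLeft hS),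
        mem_powerset.2 (toRight_subset_toRight hS)⟩
    · intro p hp
      obtain ⟨q1, q2⟩ := mem_product.1 hp
      rw [mem_powerset] at q1 q2 ⊢
      rw [← toLeft_disjSum_toRight (u := U)]
      exact disjSum_mono q1 q2
    · intro S _; exact toLeft_disjSum_toRight
    · intro p _; simp
    · intro S _; simp only [toLeft_disjSum_toRight]
  rw [hre]
  exact sum_le_sum fun p _ => hterm p.1 p.2

/-- The total weight of the closed walks with respect to a partial injection. -/
theorem sum_totalWeight_le [Nonempty V] {P : Finset (V × V)} (hP : IsPartialInj P) {K : ℕ}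
    (hK : #P ≤ K) (ht : 1 ≤ t) (hk : K * t ^ 2 ≤ Fintype.card V) {ν : V → V}
    (hν : Function.Injective ν) (h1 : 0 ≤ Q₁) (h2 : 0 ≤ Q₂) :
    ∑ x : Fin (t + 1) → V, ∑ y : Fin (t + 1) → V, (if IsClosedPair ν x y then
        totalWeight (1 / (Fintype.card V : ℝ)) Q₁ Q₂ (pairSteps P x y) else 0) ≤
      Q₁ * (39 * K * t ^ 4 / (Fintype.card V : ℝ) ^ 2) +
        Q₂ * (6 * K * t ^ 2 / (Fintype.card V : ℝ)) := by
  set r : ℝ := 1 / (Fintype.card V : ℝ) with hr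
  let h : (Fin (t + 1) → V) → ℝ := fun x => ∏ i : Fin t, mixMat P (x i.castSucc) (x i.succ)
  let f : (Fin (t + 1) → V) → ℝ := fun x => ∏ i : Fin t, stepMat P (x i.castSucc) (x i.succ)
  have hgap : ∀ a b, ∑ x : Fin (t + 1) → V,
      (if x 0 = a ∧ x (Fin.last t) = b then h x - f x else 0) = gap P t a b := by
    intro a b
    rw [gap, ← sum_walks_prod, ← sum_walks_prod, ← sum_sub_distrib]
    refine sum_congr rfl fun x _ => ?_
    split_ifs <;> simp [h, f]
  have hf : ∀ a b, ∑ x : Fin (t + 1) → V,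
      (if x 0 = a ∧ x (Fin.last t) = b then f x else 0) = (stepMat P ^ t) a b :=
    fun a b => sum_walks_prod _ _ _ _
  have hc : ∀ a b : V, ∑ x : Fin (t + 1) → V,
      (if x 0 = a ∧ x (Fin.last t) = b then r ^ t else 0) = r := fun a b => sum_walks_const ht a b
  calc _ ≤ ∑ x : Fin (t + 1) → V, ∑ y : Fin (t + 1) → V, (if IsClosedPair ν x y then
        Q₁ * ((h x - f x) * (h y - f y) - r ^ t * r ^ t) +
          Q₂ * (f x * (h y - f y) + (h x - f x) * f y) else 0) := by
        refine sum_le_sum fun x _ => sum_le_sum fun y _ => ?_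
        split_ifs with hxy
        · refine totalWeight_le ht (by positivity) _ ?_ ?_ ?_ ?_
          · rw [toLeft_pairSteps]; exact prod_stepMat P x
          · rw [toRight_pairSteps]; exact prod_stepMat P y
          · rw [toLeft_pairSteps]; exact prod_mixMat P x
          · rw [toRight_pairSteps]; exact prod_mixMat P y
        · exact le_rfl
    _ = Q₁ * (∑ x : Fin (t + 1) → V, ∑ y : Fin (t + 1) → V, (if IsClosedPair ν x y then
          (h x - f x) * (h y - f y) else 0) -
          ∑ x : Fin (t + 1) → V, ∑ y : Fin (t + 1) → V, (if IsClosedPair ν x y then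
          r ^ t * r ^ t else 0)) +
        Q₂ * (∑ x : Fin (t + 1) → V, ∑ y : Fin (t + 1) → V, (if IsClosedPair ν x y then
          f x * (h y - f y) else 0) +
          ∑ x : Fin (t + 1) → V, ∑ y : Fin (t + 1) → V, (if IsClosedPair ν x y then
          (h x - f x) * f y else 0)) := by
        simp only [mul_add, mul_sub, mul_sum, ← sum_add_distrib, ← sum_sub_distrib]
        refine sum_congr rfl fun x _ => sum_congr rfl fun y _ => ?_
        split_ifs <;> ring
    _ = Q₁ * ∑ u, (gap P t (ν u) u * gap P t u (ν u) - 1 / (Fintype.card V : ℝ) ^ 2) +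
        Q₂ * ∑ u, ((stepMat P ^ t) (ν u) u * gap P t u (ν u) +
          gap P t (ν u) u * (stepMat P ^ t) u (ν u)) := by
        rw [sum_isClosedPair ν (fun x => h x - f x) fun y => h y - f y,
          sum_isClosedPair ν (fun _ => r ^ t) fun _ => r ^ t,
          sum_isClosedPair ν f fun y => h y - f y,
          sum_isClosedPair ν (fun x => h x - f x) f]
        simp only [hgap, hf, hc]
        rw [sum_sub_distrib, sum_add_distrib]
        congr 3
        refine sum_congr rfl fun u _ => ?_
        rw [hr]; ring
    _ ≤ _ := by
        gcongr
        · exact sum_gap_mul_gap_le hP hK ht hk hν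
        · exact sum_stepMat_mul_gap_le hP hK ht hk hν

/-- The number of the closed walks inside a partial injection. -/
theorem card_closed_le {P : Finset (V × V)} (hP : IsPartialInj P) {K : ℕ}
    (hK : #P ≤ K) (ht : 1 ≤ t) {ν : V → V} (hν : Function.Injective ν) :
    ∑ x : Fin (t + 1) → V, ∑ y : Fin (t + 1) → V, (if IsClosedPair ν x y then
        (if pairSteps P x y = univ then (1 : ℝ) else 0) else 0) ≤ K := by
  let f : (Fin (t + 1) → V) → ℝ := fun x => ∏ i : Fin t, stepMat P (x i.castSucc) (x i.succ)
  have hf : ∀ a b, ∑ x : Fin (t + 1) → V,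
      (if x 0 = a ∧ x (Fin.last t) = b then f x else 0) = (stepMat P ^ t) a b :=
    fun a b => sum_walks_prod _ _ _ _
  have hff : ∀ x y, (if pairSteps P x y = univ then (1 : ℝ) else 0) ≤ f x * f y := by
    intro x y
    simp only [f, prod_stepMat]
    rw [← toLeft_pairSteps P x y, ← toRight_pairSteps P x y]
    split_ifs with a b c d <;> try norm_num
    · exact c (by rw [a]; ext; simp)
    · exact b (by rw [a]; ext; simp)
    · exact b (by rw [a]; ext; simp)
  calc _ ≤ ∑ x : Fin (t + 1) → V, ∑ y : Fin (t + 1) → V, (if IsClosedPair ν x y then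
        f x * f y else 0) := by
        refine sum_le_sum fun x _ => sum_le_sum fun y _ => ?_
        by_cases hxy : IsClosedPair ν x y
        · rw [if_pos hxy, if_pos hxy]
          exact hff x y
        · rw [if_neg hxy, if_neg hxy]
    _ = ∑ u, (stepMat P ^ t) (ν u) u * (stepMat P ^ t) u (ν u) := by
        rw [sum_isClosedPair ν f f]
        simp only [hf]
    _ ≤ ∑ u, (stepMat P ^ t) (ν u) u := by
        refine sum_le_sum fun u _ => mul_le_of_le_one_right ?_ (stepMat_pow_le_one hP _ _ _)
        exact pow_apply_nonneg stepMat_nonneg _ _ _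
    _ ≤ K := sum_stepMat_pow_le hP hK ht (τ := id) hν

end ClosedWalks

/-! ### From codes to closed walks under partial injections -/

section CodeSums

variable {V : Type} {t : ℕ}

theorem IsCode.isClosedPair [DecidableEq V] {x y : Fin (t + 1) → Lit V} (h : IsCode x y) :
    IsClosedPair Lit.neg x y := ⟨h.x_zero, h.1, h.y_last⟩

/-- Sums over codes are controlled by sums over closed walks that respect a partial injection. -/
theorem sum_isCode_le [Fintype V] [DecidableEq V] (ht : 2 ≤ t) {x₀ y₀ : Fin (t + 1) → Lit V}
    (h₀ : IsCode x₀ y₀) {g : Finset (Fin t ⊕ Fin t) → ℝ} (hg : ∀ U, 0 ≤ g U) (hm : Monotone g)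
    {B : ℝ} (hB : ∀ P : Finset (Lit V × Lit V), IsPartialInj P → #P ≤ 4 * t →
      ∑ x : Fin (t + 1) → Lit V, ∑ y : Fin (t + 1) → Lit V,
        (if IsClosedPair Lit.neg x y then g (pairSteps P x y) else 0) ≤ B) :
    ∑ x : Fin (t + 1) → Lit V, ∑ y : Fin (t + 1) → Lit V,
      (if IsCode x y then g (pairSteps (edges x₀ y₀) x y) else 0) ≤ 256 * B := by
  let E := edges x₀ y₀
  let 𝒳 := (branchEdges x₀ y₀).powerset.filter fun X => IsPartialInj (E \ X)
  have hB0 : 0 ≤ B := by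
    refine le_trans ?_ (hB ∅ (fun e he => absurd he (notMem_empty e)) (by simp))
    refine sum_nonneg fun x _ => sum_nonneg fun y _ => ?_
    split_ifs
    · exact hg _
    · exact le_rfl
  -- There are at most `2 ^ 8` sets of branching edges to delete.
  have hcard : (#𝒳 : ℝ) ≤ 256 := by
    have h1 : #𝒳 ≤ 2 ^ #(branchEdges x₀ y₀) := by
      rw [← card_powerset]; exact card_filter_le _ _
    have h2 : 2 ^ #(branchEdges x₀ y₀) ≤ 2 ^ 8 :=
      Nat.pow_le_pow_right (by norm_num) (h₀.card_branchEdges_le ht)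
    have h3 : #𝒳 ≤ 256 := h1.trans h2
    exact_mod_cast h3
  have hterm : ∀ x y : Fin (t + 1) → Lit V, (if IsCode x y then g (pairSteps E x y) else 0) ≤
      ∑ X ∈ 𝒳, if IsClosedPair Lit.neg x y then g (pairSteps (E \ X) x y) else 0 := by
    intro x y
    have hnn : ∀ X ∈ 𝒳, 0 ≤ if IsClosedPair Lit.neg x y then g (pairSteps (E \ X) x y) else 0 := by
      intro X _
      split_ifs
      · exact hg _
      · exact le_rfl
    by_cases hxy : IsCode x y
    · rw [if_pos hxy]
      obtain ⟨X, hX, hP, hs⟩ := h₀.exists_isPartialInj ht hxy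
      refine le_trans ?_ (single_le_sum hnn (mem_filter.2 ⟨hX, hP⟩))
      rw [if_pos hxy.isClosedPair]
      refine hm fun i hi => ?_
      exact mem_filter.2 ⟨mem_univ i, hs i (mem_filter.1 hi).2⟩
    · rw [if_neg hxy]
      exact sum_nonneg hnn
  calc _ ≤ ∑ x : Fin (t + 1) → Lit V, ∑ y : Fin (t + 1) → Lit V, ∑ X ∈ 𝒳,
        (if IsClosedPair Lit.neg x y then g (pairSteps (E \ X) x y) else 0) :=
        sum_le_sum fun x _ => sum_le_sum fun y _ => hterm x y
    _ = ∑ X ∈ 𝒳, ∑ x : Fin (t + 1) → Lit V, ∑ y : Fin (t + 1) → Lit V,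
        (if IsClosedPair Lit.neg x y then g (pairSteps (E \ X) x y) else 0) := by
        rw [sum_comm]
        refine Eq.trans ?_ (sum_comm)
        rw [sum_comm]
        exact sum_congr rfl fun x _ => sum_comm
    _ ≤ ∑ X ∈ 𝒳, B := by
        refine sum_le_sum fun X hX => hB _ (mem_filter.1 hX).2 ?_
        exact (card_le_card sdiff_subset).trans (card_edges_le _ _)
    _ = #𝒳 * B := by rw [sum_const, nsmul_eq_mul]
    _ ≤ 256 * B := by gcongr

end CodeSums

/-! ### Snakes that overlap a fixed snake -/

section Overlap

variable {m n t : ℕ}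

/-- The triples that describe pure snakes. -/
abbrev SnakeData (m n t : ℕ) :=
  ((Fin (t + 1) → Lit (Fin n)) × (Fin (t + 1) → Lit (Fin n))) × (Fin t ⊕ Fin t → Lit (Fin m))

/-- The positions of the clauses that belong to the formula `A`. -/
def shared (A : Finset (PreClause m n)) (d : SnakeData m n t) : Finset (Fin t ⊕ Fin t) :=
  univ.filter fun i => snakeClause d.1.1 d.1.2 d.2 i ∈ A

theorem card_shared (ht : 2 ≤ t) (A : Finset (PreClause m n)) {d : SnakeData m n t}
    (hd : IsCode d.1.1 d.1.2) : #(shared A d) = #(A ∩ snake d.1.1 d.1.2 d.2) := by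
  rw [← card_image_of_injective (shared A d) (hd.snakeClause_injective (v := d.2) ht)]
  congr 1
  ext C
  simp only [shared, mem_image, mem_filter, mem_univ, true_and, mem_inter, snake]
  constructor
  · rintro ⟨i, hi, rfl⟩; exact ⟨hi, i, rfl⟩
  · rintro ⟨hC, i, rfl⟩; exact ⟨i, hC, rfl⟩

/-- On `S` the universal literals are forced by the fixed snake, and off `S` they form a pure
sequence. Shared positions must follow its edges. -/
theorem card_pure_shared_le (ht : 2 ≤ t) {x₀ y₀ x y : Fin (t + 1) → Lit (Fin n)}
    {v₀ : Fin t ⊕ Fin t → Lit (Fin m)} (h₀ : IsCode x₀ y₀) (S : Finset (Fin t ⊕ Fin t)) :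
    #(univ.filter fun v : Fin t ⊕ Fin t → Lit (Fin m) =>
      IsPure v ∧ shared (snake x₀ y₀ v₀) ((x, y), v) = S) ≤
      if S ⊆ pairSteps (edges x₀ y₀) x y then pureCount m (2 * t - #S) else 0 := by
  split_ifs with hS
  · have hc : Fintype.card {i // i ∉ S} = 2 * t - #S := by
      rw [Fintype.card_subtype_compl]
      simp
      omega
    rw [← hc, ← card_isPure]
    refine card_le_card_of_injOn (fun v i => v i.1) ?_ ?_
    · intro v hv
      have hv := (mem_filter.1 hv).2.1
      exact mem_filter.2 ⟨mem_univ _, fun i j => hv i.1 j.1⟩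
    · intro v hv v' hv' e
      have hs := (mem_filter.1 hv).2.2
      have hs' := (mem_filter.1 hv').2.2
      funext i
      by_cases hi : i ∈ S
      · have a1 := hi
        have a2 := hi
        rw [← hs] at a1
        rw [← hs'] at a2
        exact h₀.eq_of_mem_snake ht (mem_filter.1 a1).2 (mem_filter.1 a2).2
      · exact congrFun e ⟨i, hi⟩
  · refine (card_eq_zero.2 ?_).le
    rw [filter_eq_empty_iff]
    rintro v - ⟨-, rfl⟩
    refine hS fun i hi => mem_filter.2 ⟨mem_univ i, ?_⟩
    exact mem_edges_of_mem_snake (mem_filter.1 hi).2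

theorem sum_overlapCount (A : Finset (PreClause m n)) (s : ℕ) (p : ℝ) :
    ∑ i ∈ Icc 1 s, (overlapCount s A i : ℝ) * p ^ (s + 1 - i) =
      ∑ B ∈ (pureSnakes m n s).filter fun B => #(A ∩ B) ∈ Icc 1 s, p ^ (s + 1 - #(A ∩ B)) := by
  rw [← sum_fiberwise_of_maps_to (g := fun B => #(A ∩ B)) (t := Icc 1 s)
    (fun B hB => (mem_filter.1 hB).2)]
  refine sum_congr rfl fun i hi => ?_
  rw [overlapCount, filter_filter, sum_congr rfl (g := fun _ => p ^ (s + 1 - i)), sum_const,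
    nsmul_eq_mul]
  · congr 3
    ext B
    simp only [mem_filter]
    constructor
    · rintro ⟨h1, h⟩; exact ⟨h1, h ▸ hi, h⟩
    · rintro ⟨h1, -, h⟩; exact ⟨h1, h⟩
  · intro B hB
    rw [(mem_filter.1 hB).2.2]

/-- Every snake has at least one description, and overcounting is harmless for nonnegative summands.
-/
theorem sum_pureSnakes_le_sum_data (ht : 2 ≤ t) {s : ℕ} (hs : s + 1 = 2 * t)
    {Q : Finset (PreClause m n) → Prop} [DecidablePred Q]
    {f : Finset (PreClause m n) → ℝ} (hf : ∀ B, 0 ≤ f B) :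
    ∑ B ∈ (pureSnakes m n s).filter Q, f B ≤
      ∑ d : SnakeData m n t, if IsCode d.1.1 d.1.2 ∧ IsPure d.2 ∧ Q (snake d.1.1 d.1.2 d.2) then
        f (snake d.1.1 d.1.2 d.2) else 0 := by
  rw [← sum_filter]
  have hmaps : ∀ d ∈ univ.filter fun d : SnakeData m n t =>
      IsCode d.1.1 d.1.2 ∧ IsPure d.2 ∧ Q (snake d.1.1 d.1.2 d.2),
      snake d.1.1 d.1.2 d.2 ∈ (pureSnakes m n s).filter Q := by
    intro d hd
    obtain ⟨h1, h2, h3⟩ := (mem_filter.1 hd).2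
    exact mem_filter.2 ⟨(mem_pureSnakes_iff ht hs).2 ⟨_, _, _, h1, h2, rfl⟩, h3⟩
  rw [← sum_fiberwise_of_maps_to hmaps]
  refine sum_le_sum fun B hB => ?_
  obtain ⟨hB1, hB2⟩ := mem_filter.1 hB
  obtain ⟨x, y, v, h1, h2, rfl⟩ := (mem_pureSnakes_iff ht hs).1 hB1
  exact single_le_sum (f := fun d : SnakeData m n t => f (snake d.1.1 d.1.2 d.2))
    (fun d _ => hf _) (a := ((x, y), v))
    (mem_filter.2 ⟨mem_filter.2 ⟨mem_univ _, h1, h2, hB2⟩, rfl⟩)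

theorem card_lit : Fintype.card (Lit (Fin n)) = 2 * n := by
  simp [Lit, mul_comm]

/-- The weighted number of the pure snakes that share some, but not all clauses with `A`. -/
theorem sum_overlapCount_le (ht : 2 ≤ t) {s : ℕ} (hs : s + 1 = 2 * t)
    {A : Finset (PreClause m n)} (hA : A ∈ pureSnakes m n s) {p Q₁ Q₂ : ℝ} (hp : 0 ≤ p)
    (hQ₁ : ∀ k ≤ 2 * t, (pureCount m k : ℝ) * (2 * n * p) ^ k ≤ Q₁)
    (hQ₂ : ∀ k ≤ t, (pureCount m k : ℝ) * (2 * n * p) ^ k ≤ Q₂)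
    (hn : 4 * t * t ^ 2 ≤ 2 * n) :
    ∑ i ∈ Icc 1 s, (overlapCount s A i : ℝ) * p ^ (s + 1 - i) ≤
      256 * (Q₁ * (39 * (4 * t) * t ^ 4 / (2 * n) ^ 2) + Q₂ * (6 * (4 * t) * t ^ 2 / (2 * n))) := by
  have hn0 : 0 < n := by
    have : 0 < 4 * t * t ^ 2 := by positivity
    omega
  have : Nonempty (Lit (Fin n)) := ⟨(⟨0, hn0⟩, true)⟩
  have hN : (Fintype.card (Lit (Fin n)) : ℝ) = 2 * n := by rw [card_lit]; push_cast; ring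
  have hNpos : (0 : ℝ) < 2 * n := by positivity
  have hQ₁0 : 0 ≤ Q₁ := le_trans (by positivity) (hQ₁ 0 (by omega))
  have hQ₂0 : 0 ≤ Q₂ := le_trans (by positivity) (hQ₂ 0 (by omega))
  obtain ⟨x₀, y₀, v₀, h₀, -, rfl⟩ := (mem_pureSnakes_iff ht hs).1 hA
  set A := snake x₀ y₀ v₀
  set r : ℝ := 1 / (Fintype.card (Lit (Fin n)) : ℝ) with hr
  have hr0 : 0 ≤ r := by positivity
  -- Writing `p = (2np) * r` with `r = 1/(2n)` separates the number of universal choices, bounded by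
  -- `Q₁` or `Q₂`, from the jump weight.
  have hweight : ∀ S : Finset (Fin t ⊕ Fin t),
      (pureCount m (2 * t - #S) : ℝ) * p ^ (2 * t - #S) ≤ stepWeight r Q₁ Q₂ S := by
    intro S
    have e : (pureCount m (2 * t - #S) : ℝ) * p ^ (2 * t - #S) =
        (pureCount m (2 * t - #S) : ℝ) * (2 * n * p) ^ (2 * t - #S) * r ^ (2 * t - #S) := by
      rw [mul_assoc, ← mul_pow, hr, hN]
      congr 2
      field_simp
    rw [e, stepWeight]
    refine mul_le_mul_of_nonneg_right ?_ (by positivity)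
    split_ifs with hS
    -- A full half leaves at most `t` positions unshared.
    · refine hQ₂ _ ?_
      have h1 := card_toLeft_add_card_toRight (u := S)
      rcases hS with hS | hS <;> rw [hS] at h1 <;> simp at h1 <;> omega
    · exact hQ₁ _ (by omega)
  have hcode : ∀ x y : Fin (t + 1) → Lit (Fin n), IsCode x y →
      ∑ v : Fin t ⊕ Fin t → Lit (Fin m),
        (if IsPure v ∧ shared A ((x, y), v) ≠ ∅ ∧ shared A ((x, y), v) ≠ univ then
          p ^ (2 * t - #(shared A ((x, y), v))) else 0) ≤
      totalWeight r Q₁ Q₂ (pairSteps (edges x₀ y₀) x y) := by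
    intro x y hxy
    -- Group the universal sequences by the exact set of shared positions.
    rw [← sum_fiberwise (g := fun v => shared A ((x, y), v))]
    have hS : ∀ S : Finset (Fin t ⊕ Fin t),
        ∑ v : Fin t ⊕ Fin t → Lit (Fin m) with shared A ((x, y), v) = S,
        (if IsPure v ∧ shared A ((x, y), v) ≠ ∅ ∧ shared A ((x, y), v) ≠ univ then
          p ^ (2 * t - #(shared A ((x, y), v))) else 0) ≤
        if S ⊆ pairSteps (edges x₀ y₀) x y ∧ S ≠ ∅ ∧ S ≠ univ then
          stepWeight r Q₁ Q₂ S else 0 := by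
      intro S
      have e1 : ∑ v : Fin t ⊕ Fin t → Lit (Fin m) with shared A ((x, y), v) = S,
          (if IsPure v ∧ shared A ((x, y), v) ≠ ∅ ∧ shared A ((x, y), v) ≠ univ then
            p ^ (2 * t - #(shared A ((x, y), v))) else 0) =
          if S ≠ ∅ ∧ S ≠ univ then (#(univ.filter fun v : Fin t ⊕ Fin t → Lit (Fin m) =>
            IsPure v ∧ shared A ((x, y), v) = S) : ℝ) * p ^ (2 * t - #S) else 0 := by
        split_ifs with hne
        · rw [← nsmul_eq_mul, ← sum_const, ← sum_filter, filter_filter]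
          refine sum_congr ?_ ?_
          · ext v
            simp only [mem_filter, mem_univ, true_and]
            constructor
            · rintro ⟨a, b, -⟩; exact ⟨b, a⟩
            · rintro ⟨a, b⟩; exact ⟨b, a, b ▸ hne⟩
          · intro v hv
            rw [(mem_filter.1 hv).2.2]
        · refine sum_eq_zero fun v hv => if_neg ?_
          rintro ⟨-, h⟩
          rw [(mem_filter.1 hv).2] at h
          exact hne h
      rw [e1]
      have hc := card_pure_shared_le (m := m) (x := x) (y := y) (v₀ := v₀) ht h₀ S
      by_cases hne : S ≠ ∅ ∧ S ≠ univ
      · rw [if_pos hne]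
        by_cases hsub : S ⊆ pairSteps (edges x₀ y₀) x y
        · rw [if_pos ⟨hsub, hne⟩]
          rw [if_pos hsub] at hc
          refine le_trans ?_ (hweight S)
          gcongr
        · rw [if_neg (fun h => hsub h.1)]
          rw [if_neg hsub] at hc
          rw [Nat.le_zero.1 hc]
          simp
      · rw [if_neg hne, if_neg (fun h => hne h.2)]
    refine (sum_le_sum fun S _ => hS S).trans (le_of_eq ?_)
    rw [totalWeight, ← sum_filter]
    refine sum_congr ?_ fun _ _ => rfl
    ext S
    simp
  have hs' : ∀ k, s + 1 - k = 2 * t - k := fun k => by rw [hs]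
  rw [sum_overlapCount]
  refine (sum_pureSnakes_le_sum_data (t := t) ht hs (Q := fun B => #(A ∩ B) ∈ Icc 1 s)
    (f := fun B => p ^ (s + 1 - #(A ∩ B))) fun B => by positivity).trans ?_
  calc _ ≤ ∑ x : Fin (t + 1) → Lit (Fin n), ∑ y : Fin (t + 1) → Lit (Fin n),
      ∑ v : Fin t ⊕ Fin t → Lit (Fin m), (if IsCode x y then
        (if IsPure v ∧ shared A ((x, y), v) ≠ ∅ ∧ shared A ((x, y), v) ≠ univ then
          p ^ (2 * t - #(shared A ((x, y), v))) else 0) else 0) := by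
        rw [Fintype.sum_prod_type, Fintype.sum_prod_type]
        refine sum_le_sum fun x _ => sum_le_sum fun y _ => sum_le_sum fun v _ => ?_
        simp only []
        by_cases hxy : IsCode x y
        · have hcs := card_shared (d := ((x, y), v)) ht A hxy
          simp only [] at hcs
          rw [if_pos hxy, ← hcs, hs']
          split_ifs with h1 h2 h2
          · exact le_rfl
          · exfalso
            obtain ⟨-, h3, h4⟩ := h1
            rw [mem_Icc] at h4
            refine h2 ⟨h3, ?_, ?_⟩
            · intro h5; rw [h5] at h4; simp at h4
            · intro h5; rw [h5] at h4; simp at h4; omega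
          · positivity
          · exact le_rfl
        · rw [if_neg hxy, if_neg (fun h => hxy h.1)]
    _ ≤ ∑ x : Fin (t + 1) → Lit (Fin n), ∑ y : Fin (t + 1) → Lit (Fin n), (if IsCode x y then
          totalWeight r Q₁ Q₂ (pairSteps (edges x₀ y₀) x y) else 0) := by
        refine sum_le_sum fun x _ => sum_le_sum fun y _ => ?_
        split_ifs with hxy
        · exact hcode x y hxy
        · simp
    _ ≤ _ := by
        refine sum_isCode_le ht h₀ (fun U => totalWeight_nonneg hr0 hQ₁0 hQ₂0 U)
          (fun U U' h => totalWeight_mono hr0 hQ₁0 hQ₂0 h) fun P hP hPc => ?_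
        have := sum_totalWeight_le (t := t) (Q₁ := Q₁) (Q₂ := Q₂) hP hPc (by omega)
          (by rw [card_lit]; exact hn) Lit.neg_injective hQ₁0 hQ₂0
        rw [hN] at this
        push_cast at this
        rw [hr, hN]
        exact this

end Overlap

/-! ### The number of pure snakes -/

section Count

variable {m n t : ℕ}

/-- A description of a given snake is a closed walk inside its edges, with universal literals
forced. Each of the at most 256 partial injections contains at most `4t` closed walks, so a snake
has at most `1024 t` descriptions. -/
theorem card_data_le (ht : 2 ≤ t) {s : ℕ} (hs : s + 1 = 2 * t) :
    (#(univ.filter fun d : SnakeData m n t => IsCode d.1.1 d.1.2 ∧ IsPure d.2) : ℝ) ≤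
      1024 * t * #(pureSnakes m n s) := by
  have hfib : ∀ A ∈ pureSnakes m n s,
      (#((univ.filter fun d : SnakeData m n t => IsCode d.1.1 d.1.2 ∧ IsPure d.2).filter
        fun d => snake d.1.1 d.1.2 d.2 = A) : ℝ) ≤ 1024 * t := by
    intro A hA
    obtain ⟨x₀, y₀, v₀, h₀, -, rfl⟩ := (mem_pureSnakes_iff ht hs).1 hA
    have h1 : #((univ.filter fun d : SnakeData m n t => IsCode d.1.1 d.1.2 ∧ IsPure d.2).filter
        fun d => snake d.1.1 d.1.2 d.2 = snake x₀ y₀ v₀) ≤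
        #(univ.filter fun e : (Fin (t + 1) → Lit (Fin n)) × (Fin (t + 1) → Lit (Fin n)) =>
          IsCode e.1 e.2 ∧ pairSteps (edges x₀ y₀) e.1 e.2 = univ) := by
      have hmem : ∀ d : SnakeData m n t, snake d.1.1 d.1.2 d.2 = snake x₀ y₀ v₀ → ∀ i,
          snakeClause d.1.1 d.1.2 d.2 i ∈ snake x₀ y₀ v₀ := fun d hd i => by
        rw [← hd]; exact mem_image_of_mem _ (mem_univ i)
      refine card_le_card_of_injOn Prod.fst ?_ ?_
      · intro d hd
        obtain ⟨hd1, hd2⟩ := mem_filter.1 hd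
        refine mem_filter.2 ⟨mem_univ _, (mem_filter.1 hd1).2.1, eq_univ_iff_forall.2 fun i => ?_⟩
        exact mem_filter.2 ⟨mem_univ i, mem_edges_of_mem_snake (hmem d hd2 i)⟩
      · intro d hd d' hd' e
        have b := hmem d (mem_filter.1 hd).2
        have b' := hmem d' (mem_filter.1 hd').2
        obtain ⟨e1, v⟩ := d
        obtain ⟨e2, v'⟩ := d'
        obtain rfl : e1 = e2 := e
        refine Prod.ext rfl (funext fun i => ?_)
        exact h₀.eq_of_mem_snake ht (b i) (b' i)
    have h2 := sum_isCode_le (V := Fin n) ht h₀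
      (g := fun U => if U = univ then (1 : ℝ) else 0) (B := 4 * t)
      (fun U => by split_ifs <;> norm_num)
      (fun U U' h => by
        simp only []
        split_ifs with c1 c2 c2
        · exact le_rfl
        · exact absurd (univ_subset_iff.1 (c1 ▸ h)) c2
        · norm_num
        · exact le_rfl)
      (fun P hP hPc => by
        have := card_closed_le (t := t) hP hPc (by omega) (Lit.neg_injective (V := Fin n))
        push_cast at this
        exact this)
    have h3 : (#(univ.filter fun e : (Fin (t + 1) → Lit (Fin n)) × (Fin (t + 1) → Lit (Fin n)) =>
          IsCode e.1 e.2 ∧ pairSteps (edges x₀ y₀) e.1 e.2 = univ) : ℝ) =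
        ∑ x : Fin (t + 1) → Lit (Fin n), ∑ y : Fin (t + 1) → Lit (Fin n), (if IsCode x y then
          (if pairSteps (edges x₀ y₀) x y = univ then (1 : ℝ) else 0) else 0) := by
      rw [← sum_boole, Fintype.sum_prod_type]
      refine sum_congr rfl fun x _ => sum_congr rfl fun y _ => ?_
      simp only [ite_and]
    calc _ ≤ _ := Nat.cast_le.2 h1
      _ = _ := h3
      _ ≤ _ := h2
      _ = _ := by ring
  rw [card_eq_sum_card_fiberwise (f := fun d : SnakeData m n t => snake d.1.1 d.1.2 d.2)
    (t := pureSnakes m n s)]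
  · push_cast
    calc _ ≤ ∑ A ∈ pureSnakes m n s, (1024 * t : ℝ) := sum_le_sum hfib
      _ = _ := by rw [sum_const, nsmul_eq_mul]; ring
  · intro d hd
    obtain ⟨h1, h2⟩ := (mem_filter.1 hd).2
    exact (mem_pureSnakes_iff ht hs).2 ⟨_, _, _, h1, h2, rfl⟩

/-- The sequence of literals with given distinct variables and signs, closed up as in a snake. -/
def closeUp (t : ℕ) (f : Fin (2 * t - 1) → Fin n) (σ : Fin (2 * t - 1) → Bool) (hmid : t - 1 < 2 * t - 1)
    (r : ℕ) : Lit (Fin n) :=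
  if h : 1 ≤ r ∧ r ≤ 2 * t - 1 then (f ⟨r - 1, by omega⟩, σ ⟨r - 1, by omega⟩)
  else Lit.neg (f ⟨t - 1, hmid⟩, σ ⟨t - 1, hmid⟩)

theorem joinWalk_restrict {V : Type} (w : ℕ → V) {r : ℕ} (hr : r ≤ 2 * t) :
    joinWalk (fun i : Fin (t + 1) => w i) (fun i => w (t + i)) r = w r := by
  rw [joinWalk]
  split_ifs with h
  · rfl
  · simp only []
    congr 1
    omega

theorem le_card_isCode (ht : 2 ≤ t) : n.descFactorial (2 * t - 1) * 2 ^ (2 * t - 1) ≤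
    #(univ.filter fun e : (Fin (t + 1) → Lit (Fin n)) × (Fin (t + 1) → Lit (Fin n)) =>
      IsCode e.1 e.2) := by
  have hmid : t - 1 < 2 * t - 1 := by omega
  have hc : n.descFactorial (2 * t - 1) * 2 ^ (2 * t - 1) =
      #(univ : Finset ((Fin (2 * t - 1) ↪ Fin n) × (Fin (2 * t - 1) → Bool))) := by
    rw [card_univ, Fintype.card_prod, Fintype.card_embedding_eq]
    simp
  rw [hc]
  refine card_le_card_of_injOn (fun a => (fun i => closeUp t a.1 a.2 hmid i,
    fun i => closeUp t a.1 a.2 hmid (t + i))) ?_ ?_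
  · rintro ⟨f, σ⟩ -
    refine mem_filter.2 ⟨mem_univ _, by simp, ?_, ?_, ?_⟩
    · intro r hr r' hr' e
      have hr2 := hr.1
      have hr3 := hr.2
      have hr2' := hr'.1
      have hr3' := hr'.2
      simp only at e
      rw [joinWalk_restrict _ (by omega), joinWalk_restrict _ (by omega), closeUp, closeUp,
        dif_pos ⟨hr2, hr3⟩, dif_pos ⟨hr2', hr3'⟩] at e
      have := congrArg Fin.val (f.injective e)
      simp only at this
      omega
    · rw [joinWalk_restrict _ (by omega), joinWalk_restrict _ (by omega), closeUp, closeUp,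
        dif_neg (by omega), dif_pos (by omega)]
    · rw [joinWalk_restrict _ (by omega), joinWalk_restrict _ (by omega), closeUp, closeUp,
        dif_neg (by omega), dif_pos (by omega)]
  · rintro ⟨f, σ⟩ - ⟨f', σ'⟩ - e
    have key : ∀ r ≤ 2 * t, closeUp t f σ hmid r = closeUp t f' σ' hmid r := by
      intro r hr
      have e1 := congrArg Prod.fst e
      have e2 := congrArg Prod.snd e
      simp only at e1 e2
      rw [← joinWalk_restrict (closeUp t f σ hmid) hr, ← joinWalk_restrict (closeUp t f' σ' hmid) hr,
        e1, e2]
    have key2 : ∀ i : Fin (2 * t - 1), (f i, σ i) = (f' i, σ' i) := by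
      intro i
      have hi := i.2
      have := key (i + 1) (by omega)
      rw [closeUp, closeUp, dif_pos (by omega), dif_pos (by omega)] at this
      simpa using this
    refine Prod.ext (DFunLike.ext _ _ fun i => congrArg Prod.fst (key2 i))
      (funext fun i => congrArg Prod.snd (key2 i))

/-- A lower bound for the number of the pure snakes. -/
theorem le_card_pureSnakes (ht : 2 ≤ t) {s : ℕ} (hs : s + 1 = 2 * t) :
    (n.descFactorial s : ℝ) * 2 ^ s * pureCount m (2 * t) ≤
      1024 * t * #(pureSnakes m n s) := by
  refine le_trans ?_ (card_data_le ht hs)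
  have h1 : (univ.filter fun d : SnakeData m n t => IsCode d.1.1 d.1.2 ∧ IsPure d.2) =
      (univ.filter fun e : (Fin (t + 1) → Lit (Fin n)) × (Fin (t + 1) → Lit (Fin n)) =>
        IsCode e.1 e.2) ×ˢ univ.filter fun v : Fin t ⊕ Fin t → Lit (Fin m) => IsPure v := by
    ext d; simp
  have h2 : Fintype.card (Fin t ⊕ Fin t) = 2 * t := by simp; omega
  rw [h1, card_product, card_isPure, h2]
  have h3 := le_card_isCode (n := n) ht
  rw [show 2 * t - 1 = s by omega] at h3
  push_cast
  gcongr
  exact_mod_cast h3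

end Count

/-! ### Moments of the snake count -/

section Probability

variable {m n t s : ℕ}

theorem sum_weight_superset {p : ℝ} {A : Finset (PreClause m n)} (hA : A ⊆ allClauses m n) :
    ∑ F ∈ (allClauses m n).powerset, (if A ⊆ F then weight p F else 0) = p ^ #A := by
  -- Replacing `1 - p` by `0` on `A` leaves in the expansion exactly the formulas that contain `A`.
  have h := prod_add (fun _ : PreClause m n => p) (fun C => if C ∈ A then 0 else 1 - p)
    (allClauses m n)
  have h1 : ∏ C ∈ allClauses m n, (p + if C ∈ A then 0 else 1 - p) = p ^ #A := by
    rw [← prod_subset hA]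
    · rw [← prod_const]
      exact prod_congr rfl fun C hC => by rw [if_pos hC, add_zero]
    · intro C _ hC
      rw [if_neg hC]; ring
  rw [← h1, h]
  refine sum_congr rfl fun F hF => ?_
  rw [mem_powerset] at hF
  split_ifs with hAF
  · rw [weight, prod_const, ← card_sdiff_of_subset hF, ← prod_const (s := allClauses m n \ F)]
    congr 1
    refine prod_congr rfl fun C hC => ?_
    rw [if_neg fun h => (mem_sdiff.1 hC).2 (hAF h)]
  · obtain ⟨C, hC, hC'⟩ := not_subset.1 hAF
    have h0 : ∏ C ∈ allClauses m n \ F, (if C ∈ A then 0 else 1 - p) = 0 :=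
      prod_eq_zero (mem_sdiff.2 ⟨hA hC, hC'⟩) (if_pos hC)
    rw [h0, mul_zero]

theorem sum_weight (p : ℝ) : ∑ F ∈ (allClauses m n).powerset, weight p F = 1 := by
  have := sum_weight_superset (p := p) (empty_subset (allClauses m n))
  simpa using this

theorem weight_nonneg {p : ℝ} (h0 : 0 ≤ p) (h1 : p ≤ 1) (F : Finset (PreClause m n)) :
    0 ≤ weight p F := mul_nonneg (pow_nonneg h0 _) (pow_nonneg (by linarith) _)

theorem subset_of_mem_pureSnakes {A : Finset (PreClause m n)} (hA : A ∈ pureSnakes m n s) :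
    A ⊆ allClauses m n := by
  classical
  exact mem_powerset.1 (mem_filter.1 hA).1

theorem card_of_mem_pureSnakes (ht : 2 ≤ t) (hs : s + 1 = 2 * t) {A : Finset (PreClause m n)}
    (hA : A ∈ pureSnakes m n s) : #A = s + 1 := by
  obtain ⟨x, y, v, h, -, rfl⟩ := (mem_pureSnakes_iff ht hs).1 hA
  rw [h.card_snake ht, hs]

theorem snakeCount_eq_sum (F : Finset (PreClause m n)) :
    (snakeCount s F : ℝ) = ∑ A ∈ pureSnakes m n s, if A ⊆ F then 1 else 0 := by
  rw [snakeCount, sum_boole]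

theorem expectedSnakes_eq (ht : 2 ≤ t) (hs : s + 1 = 2 * t) (p : ℝ) :
    expectedSnakes m n s p = #(pureSnakes m n s) * p ^ (s + 1) := by
  rw [expectedSnakes]
  simp_rw [snakeCount_eq_sum, mul_sum]
  rw [sum_comm, ← nsmul_eq_mul, ← sum_const]
  refine sum_congr rfl fun A hA => ?_
  rw [← card_of_mem_pureSnakes ht hs hA, ← sum_weight_superset (subset_of_mem_pureSnakes hA)]
  simp

theorem sum_weight_mul_sq (p : ℝ) :
    ∑ F ∈ (allClauses m n).powerset, weight p F * (snakeCount s F : ℝ) ^ 2 =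
      ∑ A ∈ pureSnakes m n s, ∑ B ∈ pureSnakes m n s, p ^ #(A ∪ B) := by
  simp_rw [pow_two, snakeCount_eq_sum, sum_mul_sum, mul_sum]
  rw [sum_comm]
  refine sum_congr rfl fun A hA => ?_
  rw [sum_comm]
  refine sum_congr rfl fun B hB => ?_
  rw [← sum_weight_superset (union_subset (subset_of_mem_pureSnakes hA)
    (subset_of_mem_pureSnakes hB))]
  refine sum_congr rfl fun F _ => ?_
  by_cases h1 : A ⊆ F <;> by_cases h2 : B ⊆ F <;> simp [h1, h2, union_subset_iff]

/-- The second moment of the number of pure snakes. -/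
theorem second_moment_le (ht : 2 ≤ t) (hs : s + 1 = 2 * t) {p R : ℝ} (hp : 0 ≤ p)
    (hR : ∀ A ∈ pureSnakes m n s,
      ∑ i ∈ Icc 1 s, (overlapCount s A i : ℝ) * p ^ (s + 1 - i) ≤ R) :
    ∑ F ∈ (allClauses m n).powerset, weight p F * (snakeCount s F : ℝ) ^ 2 ≤
      expectedSnakes m n s p * (expectedSnakes m n s p + R + 1) := by
  rw [sum_weight_mul_sq]
  have hA : ∀ A ∈ pureSnakes m n s, ∑ B ∈ pureSnakes m n s, p ^ #(A ∪ B) ≤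
      p ^ (s + 1) * (expectedSnakes m n s p + R + 1) := by
    intro A hA
    have cA := card_of_mem_pureSnakes ht hs hA
    -- The summands cover the three kinds of overlap: none, which sums to at most the expectation;
    -- partial, which gives the overlap sum; complete, which forces `B = A` and gives the final 1.
    have hB : ∀ B ∈ pureSnakes m n s, p ^ #(A ∪ B) ≤ p ^ (s + 1) * (p ^ (s + 1) +
        (if #(A ∩ B) ∈ Icc 1 s then p ^ (s + 1 - #(A ∩ B)) else 0) + if B = A then 1 else 0) := by
      intro B hB
      have cB := card_of_mem_pureSnakes ht hs hB
      have h1 := card_union_add_card_inter A B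
      have h2 : #(A ∩ B) ≤ s + 1 := by rw [← cA]; exact card_le_card inter_subset_left
      have h3 : #(A ∪ B) = (s + 1) + (s + 1 - #(A ∩ B)) := by omega
      have p1 : 0 ≤ p ^ (s + 1) := by positivity
      rw [h3, pow_add]
      refine mul_le_mul_of_nonneg_left ?_ p1
      have q2 : (0 : ℝ) ≤ if B = A then 1 else 0 := by split_ifs <;> norm_num
      have q1 : (0 : ℝ) ≤ if #(A ∩ B) ∈ Icc 1 s then p ^ (s + 1 - #(A ∩ B)) else 0 := by
        split_ifs
        · positivity
        · exact le_rfl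
      by_cases h4 : #(A ∩ B) = 0
      · rw [h4, Nat.sub_zero] at q1 ⊢; linarith
      · by_cases h5 : #(A ∩ B) = s + 1
        · have e1 : A ∩ B = A := eq_of_subset_of_card_le inter_subset_left (by omega)
          have e2 : A ∩ B = B := eq_of_subset_of_card_le inter_subset_right (by omega)
          rw [h5, Nat.sub_self, pow_zero] at q1 ⊢
          rw [if_pos (e2.symm.trans e1)]
          linarith
        · rw [if_pos (mem_Icc.2 ⟨by omega, by omega⟩)]
          linarith
    refine (sum_le_sum hB).trans ?_
    rw [← mul_sum, sum_add_distrib, sum_add_distrib, sum_const, nsmul_eq_mul,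
      ← expectedSnakes_eq ht hs, sum_ite_eq', if_pos hA, ← sum_filter, ← sum_overlapCount]
    gcongr
    exact hR A hA
  refine (sum_le_sum hA).trans (le_of_eq ?_)
  rw [sum_const, nsmul_eq_mul, expectedSnakes_eq ht hs]
  ring

/-- A formula that contains a pure snake is false. -/
theorem not_isTrue_of_snake (ht : 2 ≤ t) (hs : s + 1 = 2 * t) {A F : Finset (PreClause m n)}
    (hA : A ∈ pureSnakes m n s) (hAF : A ⊆ F) : ¬ IsTrue F := by
  classical
  obtain ⟨x, y, v, h, hv, rfl⟩ := (mem_pureSnakes_iff ht hs).1 hA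
  intro hF
  -- By purity all universal literals of the snake can be falsified at once.
  obtain ⟨I, hI⟩ : ∃ I : Fin m → Bool, ∀ i, I (v i).1 ≠ (v i).2 := by
    refine ⟨fun a => !decide (∃ i, v i = (a, true)), fun i => ?_⟩
    cases h2 : (v i).2
    · have h3 : ¬ ∃ j, v j = ((v i).1, true) := by
        rintro ⟨j, hj⟩
        refine hv j i ?_
        rw [hj, Lit.neg, h2]
        rfl
      simp [h3]
    · have h3 : ∃ j, v j = ((v i).1, true) := ⟨i, Prod.ext rfl h2⟩
      simp [h3]
  obtain ⟨J, hJ⟩ := hF I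
  have hneg : ∀ l : Lit (Fin n), J l.neg.1 = l.neg.2 → J l.1 ≠ l.2 := by
    intro l h1 h2
    simp only [Lit.neg] at h1
    rw [h2] at h1
    simp at h1
  have hneg' : ∀ l : Lit (Fin n), J l.1 ≠ l.2 → J l.neg.1 = l.neg.2 := by
    intro l h1
    simp only [Lit.neg]
    cases h2 : J l.1 <;> cases h3 : l.2 <;> simp_all
  have hstep : ∀ i, J (src x y i).1 = (src x y i).2 → J (tgt x y i).1 = (tgt x y i).2 := by
    intro i hi
    rcases hJ _ (hAF (mem_image_of_mem (snakeClause x y v) (mem_univ i))) with h1 | ⟨l, hl, h1⟩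
    · exact absurd h1 (hI i)
    · simp only [snakeClause, mem_insert, mem_singleton] at hl
      rcases hl with rfl | rfl
      · exact absurd hi (hneg _ h1)
      · exact h1
  let w := joinWalk x y
  have hw : ∀ r < 2 * t, J (w r).1 = (w r).2 → J (w (r + 1)).1 = (w (r + 1)).2 := by
    intro r hr
    obtain ⟨i, rfl⟩ := exists_stepIdx hr
    have := hstep i
    rwa [src_eq h.1, tgt_eq h.1] at this
  have hchain : ∀ r k, r + k ≤ 2 * t → J (w r).1 = (w r).2 → J (w (r + k)).1 = (w (r + k)).2 := by
    intro r k
    induction k with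
    | zero => intro _ h; exact h
    | succ k ih => intro hk h1; exact hw (r + k) (by omega) (ih (by omega) h1)
  have hz : w 0 = (w t).neg := h.2.zero
  have hl : w (2 * t) = (w t).neg := h.2.last
  -- The first half derives `w t` from its negation; the second half then derives the negation from
  -- `w t`.
  have h1 : J (w t).1 = (w t).2 := by
    by_contra hcon
    have h2 := hneg' _ hcon
    rw [← hz] at h2
    have := hchain 0 t (by omega) h2
    rw [zero_add] at this
    exact hcon this
  have h2 := hchain t t (by omega) h1
  rw [← two_mul, hl] at h2
  exact hneg _ h2 h1

/-- The bound for the probability of truth that Chebyshev's inequality gives. -/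
theorem probTrue_le (ht : 2 ≤ t) (hs : s + 1 = 2 * t) {p R : ℝ} (hp : 0 ≤ p) (hp1 : p ≤ 1)
    (hR : ∀ A ∈ pureSnakes m n s,
      ∑ i ∈ Icc 1 s, (overlapCount s A i : ℝ) * p ^ (s + 1 - i) ≤ R)
    (hE : 0 < expectedSnakes m n s p) :
    probTrue m n p ≤ (R + 1) / expectedSnakes m n s p := by
  classical
  set E := expectedSnakes m n s p with hEdef
  have h2 := second_moment_le ht hs hp hR
  rw [← hEdef] at h2
  have hvar : ∑ F ∈ (allClauses m n).powerset, weight p F * ((snakeCount s F : ℝ) - E) ^ 2 ≤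
      E * (R + 1) := by
    have e : ∑ F ∈ (allClauses m n).powerset, weight p F * ((snakeCount s F : ℝ) - E) ^ 2 =
        ∑ F ∈ (allClauses m n).powerset, weight p F * (snakeCount s F : ℝ) ^ 2 -
          2 * E * ∑ F ∈ (allClauses m n).powerset, weight p F * (snakeCount s F : ℝ) +
          E ^ 2 * ∑ F ∈ (allClauses m n).powerset, weight p F := by
      rw [mul_sum, mul_sum, ← sum_sub_distrib, ← sum_add_distrib]
      exact sum_congr rfl fun F _ => by ring
    rw [e, sum_weight]
    have e2 : ∑ F ∈ (allClauses m n).powerset, weight p F * (snakeCount s F : ℝ) = E := rfl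
    rw [e2]
    nlinarith
  -- A true formula contains no snake, so its squared deviation is `E ^ 2`.
  have hprob : probTrue m n p * E ^ 2 ≤
      ∑ F ∈ (allClauses m n).powerset, weight p F * ((snakeCount s F : ℝ) - E) ^ 2 := by
    rw [probTrue, sum_mul]
    refine (sum_le_sum fun F hF => ?_).trans (sum_le_sum_of_subset_of_nonneg
      (filter_subset _ _) fun F _ _ => mul_nonneg (weight_nonneg hp hp1 F) (sq_nonneg _))
    have h0 : snakeCount s F = 0 := by
      rw [snakeCount, card_eq_zero, filter_eq_empty_iff]
      intro A hA hAF
      exact not_isTrue_of_snake ht hs hA hAF (mem_filter.1 hF).2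
    rw [h0]
    simp
  rw [le_div_iff₀ hE]
  have h3 := hprob.trans hvar
  nlinarith

end Probability

/-! ### Upper bound for pure sequences and the rate function -/

section Upper

/-- A crude Stirling bound, by induction from `(1 - 1/k)^k ≤ 1/e`; the factor `j + 1` instead of `j`
covers `j = 0`. -/
theorem factorial_mul_exp_le (j : ℕ) :
    (j.factorial : ℝ) * Real.exp j ≤ Real.exp 1 * (j + 1) * (j : ℝ) ^ j := by
  have main : ∀ k : ℕ, ((k + 1).factorial : ℝ) * Real.exp ((k + 1 : ℕ) : ℝ) ≤
      Real.exp 1 * ((k + 1 : ℕ) : ℝ) * ((k + 1 : ℕ) : ℝ) ^ (k + 1) := by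
    intro k
    induction k with
    | zero => simp
    | succ k ih =>
      have h1 : (1 - 1 / ((k + 2 : ℕ) : ℝ)) ^ (k + 2) ≤ Real.exp (-1) :=
        Real.one_sub_div_pow_le_exp_neg (n := k + 2) (t := 1) (by push_cast; linarith)
      have h2 : (1 - 1 / ((k + 2 : ℕ) : ℝ)) = (k + 1 : ℝ) / (k + 2) := by
        push_cast; field_simp; ring
      rw [h2, div_pow, Real.exp_neg, div_le_iff₀ (by positivity), inv_mul_eq_div,
        le_div_iff₀ (Real.exp_pos _)] at h1
      have e1 : ((k + 1 + 1).factorial : ℝ) * Real.exp ((k + 1 + 1 : ℕ) : ℝ) =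
          (k + 2) * Real.exp 1 * (((k + 1).factorial : ℝ) * Real.exp ((k + 1 : ℕ) : ℝ)) := by
        rw [Nat.factorial_succ (k + 1)]
        push_cast
        rw [Real.exp_add ((k : ℝ) + 1) 1]
        ring
      rw [e1]
      calc _ ≤ (k + 2) * Real.exp 1 *
            (Real.exp 1 * ((k + 1 : ℕ) : ℝ) * ((k + 1 : ℕ) : ℝ) ^ (k + 1)) := by gcongr
        _ = Real.exp 1 * (k + 2) * ((k + 1 : ℝ) ^ (k + 2) * Real.exp 1) := by push_cast; ring
        _ ≤ Real.exp 1 * (k + 2) * (k + 2) ^ (k + 2) := by gcongr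
        _ = _ := by push_cast; ring
  cases j with
  | zero => simp
  | succ k =>
    refine (main k).trans ?_
    gcongr
    simp

/-- The rate function of the number of pure sequences. -/
noncomputable def rate (c x : ℝ) : ℝ := Real.log (2 * Real.exp x - 1) - 2 * x / c

theorem two_mul_exp_sub_one_pos {x : ℝ} (hx : 0 ≤ x) : 0 < 2 * Real.exp x - 1 := by
  have := Real.one_le_exp hx
  linarith

/-- Evaluate the series bound at `x = c j / (2m)`, where `x ^ j` equals `(c / (2m)) ^ j * j ^ j`.
Stirling removes `j! / j ^ j` at the price of `exp (-j)`, and `j = m * (2x/c)` supplies the linear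
part of the rate. -/
theorem pureCount_mul_pow_le_rate {c : ℝ} (hc : 0 < c) {m : ℕ} (hm : 0 < m) (j : ℕ) :
    (pureCount m j : ℝ) * (c / (2 * m)) ^ j ≤
      Real.exp 1 * (j + 1) * Real.exp (m * rate c (c * j / (2 * m))) := by
  set x : ℝ := c * j / (2 * m) with hx
  have hm' : (0 : ℝ) < m := by exact_mod_cast hm
  have hx0 : 0 ≤ x := by positivity
  have h1 := pureCount_mul_pow_le m j hx0
  have h2 := factorial_mul_exp_le j
  have hpos := two_mul_exp_sub_one_pos hx0
  have hjj : (0 : ℝ) < (j : ℝ) ^ j := by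
    cases j with
    | zero => simp
    | succ k => positivity
  have e1 : Real.exp (m * rate c x) * Real.exp j = (2 * Real.exp x - 1) ^ m := by
    rw [← Real.exp_add, rate, mul_sub]
    have : (m : ℝ) * (2 * x / c) = j := by rw [hx]; field_simp
    rw [this, sub_add_cancel, Real.exp_nat_mul, Real.exp_log hpos]
  have e2 : x ^ j = (c / (2 * m)) ^ j * (j : ℝ) ^ j := by
    rw [← mul_pow, hx]; congr 1; ring
  rw [e2, ← e1] at h1
  have hE : 0 < Real.exp (j : ℝ) := Real.exp_pos _
  have hR : 0 < Real.exp (m * rate c x) := Real.exp_pos _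
  have h3 : ((pureCount m j : ℝ) * (c / (2 * m)) ^ j) * (j : ℝ) ^ j ≤
      (Real.exp 1 * (j + 1) * Real.exp (m * rate c x)) * (j : ℝ) ^ j := by
    calc _ = (pureCount m j : ℝ) * ((c / (2 * m)) ^ j * (j : ℝ) ^ j) := by ring
      _ ≤ (j.factorial : ℝ) * (Real.exp (m * rate c x) * Real.exp j) := h1
      _ = ((j.factorial : ℝ) * Real.exp j) * Real.exp (m * rate c x) := by ring
      _ ≤ (Real.exp 1 * (j + 1) * (j : ℝ) ^ j) * Real.exp (m * rate c x) := by gcongr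
      _ = _ := by ring
  exact le_of_mul_le_mul_right h3 hjj

variable {c : ℝ}

theorem rate_zero : rate c 0 = 0 := by
  simp only [rate, Real.exp_zero]; norm_num

/-- With `z = exp (-x)` the rate is `log (2 - z) + (2/c - 1) log z`. The tangents of `log` at `c`
and at `2 - c` bound the two terms, and their linear parts cancel. -/
theorem rate_le_H (hc1 : 1 < c) (hc2 : c < 2) {x : ℝ} (hx : 0 ≤ x) : rate c x ≤ H c := by
  have hE := Real.exp_pos x
  have hpos := two_mul_exp_sub_one_pos hx
  set z : ℝ := Real.exp (-x) with hz
  have hz0 : 0 < z := Real.exp_pos _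
  have hz1 : z ≤ 1 := by rw [hz]; exact Real.exp_le_one_iff.2 (by linarith)
  have hd : 0 < 2 - c := by linarith
  have hc0 : 0 < c := by linarith
  have e1 : Real.log (2 * Real.exp x - 1) = x + Real.log (2 - z) := by
    have : 2 * Real.exp x - 1 = Real.exp x * (2 - z) := by
      rw [mul_sub, hz, ← Real.exp_add]; simp; ring
    rw [this, Real.log_mul hE.ne' (by linarith), Real.log_exp]
  have hlogz : Real.log z = -x := by rw [hz, Real.log_exp]
  have t1 : Real.log z - Real.log (2 - c) ≤ z / (2 - c) - 1 := by
    rw [← Real.log_div hz0.ne' hd.ne']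
    exact Real.log_le_sub_one_of_pos (by positivity)
  have t2 : Real.log (2 - z) - Real.log c ≤ (2 - z) / c - 1 := by
    have : 0 < 2 - z := by linarith
    rw [← Real.log_div this.ne' hc0.ne']
    exact Real.log_le_sub_one_of_pos (by positivity)
  have hco : 0 < 2 / c - 1 := by
    rw [sub_pos, lt_div_iff₀ hc0]; linarith
  have t3 := mul_le_mul_of_nonneg_left t1 hco.le
  have t4 : (2 / c - 1) * (z / (2 - c) - 1) + ((2 - z) / c - 1) = 0 := by
    field_simp; ring
  rw [rate, e1, H]
  have t5 : (2 / c - 1) * (Real.log z - Real.log (2 - c)) =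
    -(2 * x / c) + x - (2 / c - 1) * Real.log (2 - c) := by rw [hlogz]; ring
  linarith

/-- The derivative is positive exactly while `exp x < 1 / (2 - c)`. Strictness makes walks of about
half the length exponentially rarer than `H c` would allow. -/
theorem rate_strictMonoOn (hc1 : 1 < c) (hc2 : c < 2) :
    StrictMonoOn (rate c) (Set.Icc 0 (-Real.log (2 - c))) := by
  have hd : 0 < 2 - c := by linarith
  have hc0 : 0 < c := by linarith
  have hder : ∀ x : ℝ, 0 ≤ x → HasDerivAt (rate c)
      (2 * Real.exp x / (2 * Real.exp x - 1) - 2 / c) x := by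
    intro x hx
    have hpos := two_mul_exp_sub_one_pos hx
    have h1 : HasDerivAt (fun x => 2 * Real.exp x - 1) (2 * Real.exp x) x :=
      ((Real.hasDerivAt_exp x).const_mul 2).sub_const 1
    have h2 : HasDerivAt (fun x : ℝ => 2 * x / c) (2 / c) x := by
      have := ((hasDerivAt_id x).const_mul 2).div_const c
      simpa using this
    exact (h1.log hpos.ne').sub h2
  refine strictMonoOn_of_deriv_pos (convex_Icc _ _) ?_ ?_
  · intro x hx
    exact (hder x hx.1).continuousAt.continuousWithinAt
  · intro x hx
    rw [interior_Icc] at hx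
    rw [(hder x hx.1.le).deriv, sub_pos]
    have hpos := two_mul_exp_sub_one_pos hx.1.le
    rw [div_lt_div_iff₀ hc0 hpos]
    have h3 : Real.exp x < 1 / (2 - c) := by
      rw [one_div, ← Real.exp_log hd, ← Real.exp_neg]
      exact Real.exp_lt_exp.2 hx.2
    rw [lt_div_iff₀ hd] at h3
    nlinarith

theorem rate_neg_log (hc1 : 1 < c) (hc2 : c < 2) : rate c (-Real.log (2 - c)) = H c := by
  have hd : 0 < 2 - c := by linarith
  have hc0 : 0 < c := by linarith
  have e : 2 * Real.exp (-Real.log (2 - c)) - 1 = c / (2 - c) := by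
    rw [Real.exp_neg, Real.exp_log hd]; field_simp; ring
  rw [rate, e, Real.log_div hc0.ne' hd.ne', H]
  ring

end Upper

/-! ### Lower bound for pure sequences near the saddle point -/

section Lower

theorem le_pow_mul_of_ratio {a : ℕ → ℝ} {B : ℝ} (hB : 0 ≤ B) (j k : ℕ)
    (h : ∀ i, j ≤ i → i < j + k → a i ≤ B * a (i + 1) ∧ a (i + 1) ≤ B * a i) :
    a j ≤ B ^ k * a (j + k) ∧ a (j + k) ≤ B ^ k * a j := by
  induction k with
  | zero => simp
  | succ k ih =>
    obtain ⟨h1, h2⟩ := ih fun i hi hi' => h i hi (by omega)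
    obtain ⟨h3, h4⟩ := h (j + k) (by omega) (by omega)
    constructor
    · calc a j ≤ B ^ k * a (j + k) := h1
        _ ≤ B ^ k * (B * a (j + k + 1)) := by gcongr
        _ = _ := by rw [pow_succ]; ring_nf
    · calc a (j + (k + 1)) ≤ B * a (j + k) := h4
        _ ≤ B * (B ^ k * a j) := by gcongr
        _ = _ := by ring

/-- Large deviation estimates for both tails. -/
theorem exists_tilt {ρ η : ℝ} (hρ : 0 < ρ) (hη : 0 < η) {κ : ℝ}
    (hκ : κ = 2 * Real.exp ρ * ρ / (2 * Real.exp ρ - 1)) :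
    (∃ s > 0, Real.log (2 * Real.exp (ρ * Real.exp s) - 1) <
      Real.log (2 * Real.exp ρ - 1) + (κ + η) * s) ∧
    ∃ s < 0, Real.log (2 * Real.exp (ρ * Real.exp s) - 1) <
      Real.log (2 * Real.exp ρ - 1) + (κ - η) * s := by
  have hpos := two_mul_exp_sub_one_pos hρ.le
  let g : ℝ → ℝ := fun s => Real.log (2 * Real.exp (ρ * Real.exp s) - 1)
  have hg0 : g 0 = Real.log (2 * Real.exp ρ - 1) := by simp [g]
  -- `κ` is the logarithmic derivative of the generating function, so small tilts in either
  -- direction beat slopes `κ + η` and `κ - η`.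
  have hder : HasDerivAt g κ 0 := by
    have h1 : HasDerivAt (fun s => ρ * Real.exp s) (ρ * Real.exp 0) 0 :=
      (Real.hasDerivAt_exp 0).const_mul ρ
    have h2 := ((h1.exp.const_mul 2).sub_const 1).log (by simpa using hpos.ne')
    convert h2 using 1
    rw [hκ]; simp; ring
  have hs := hasDerivAt_iff_tendsto_slope.1 hder
  have h1 : ∀ᶠ s in 𝓝[≠] (0 : ℝ), slope g 0 s < κ + η := hs.eventually (gt_mem_nhds (by linarith))
  have h2 : ∀ᶠ s in 𝓝[≠] (0 : ℝ), κ - η < slope g 0 s := hs.eventually (lt_mem_nhds (by linarith))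
  have h1' := h1.filter_mono (nhdsWithin_mono (0 : ℝ) (s := Set.Ioi 0) fun x hx => ne_of_gt hx)
  have h2' := h2.filter_mono (nhdsWithin_mono (0 : ℝ) (s := Set.Iio 0) fun x hx => ne_of_lt hx)
  obtain ⟨s, hs1, hs2⟩ := (h1'.and self_mem_nhdsWithin).exists
  obtain ⟨s', hs1', hs2'⟩ := (h2'.and self_mem_nhdsWithin).exists
  have hs2 : 0 < s := hs2
  have hs2' : s' < 0 := hs2'
  rw [slope_def_field, sub_zero, div_lt_iff₀ hs2, hg0] at hs1
  rw [slope_def_field, sub_zero, lt_div_iff_of_neg hs2', hg0] at hs1'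
  refine ⟨⟨s, hs2, ?_⟩, s', hs2', ?_⟩
  · change g s < _
    linarith
  · change g s' < _
    linarith

/-- The terms of the generating function of the numbers of pure sequences. -/
noncomputable def pureTerm (ρ : ℝ) (m j : ℕ) : ℝ :=
  (pureCount m j : ℝ) * ρ ^ j / (j.factorial : ℝ)

theorem pureTerm_nonneg {ρ : ℝ} (hρ : 0 < ρ) (m j : ℕ) : 0 ≤ pureTerm ρ m j := by
  unfold pureTerm; positivity

/-- Consecutive terms have a ratio between `ρ m / (i + 1)` and `2 ρ m / (i + 1)`, and in the window
`i + 1` lies between `κ m / 2` and `2 κ m`. -/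
theorem pureTerm_ratio {ρ κ η B : ℝ} (hρ : 0 < ρ) (hκ : 0 < κ) (hη : η ≤ κ / 2)
    (hB2 : 4 * ρ / κ ≤ B) (hB3 : 2 * κ / ρ ≤ B) {m i : ℕ} (hm : 0 < m)
    (hi : (κ - η) * m ≤ i) (hi' : (i + 1 : ℝ) ≤ (κ + η) * m) :
    pureTerm ρ m i ≤ B * pureTerm ρ m (i + 1) ∧ pureTerm ρ m (i + 1) ≤ B * pureTerm ρ m i := by
  have hm' : (0 : ℝ) < m := by exact_mod_cast hm
  have q1 : (m : ℝ) * pureCount m i ≤ pureCount m (i + 1) := by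
    exact_mod_cast mul_pureCount_le m i
  have q2 : (pureCount m (i + 1) : ℝ) ≤ 2 * m * pureCount m i := by
    exact_mod_cast pureCount_succ_le m i
  have hi0 : (0 : ℝ) < i + 1 := by positivity
  have ea : pureTerm ρ m (i + 1) =
      pureCount m (i + 1) * (ρ / (i + 1)) * (ρ ^ i / (i.factorial : ℝ)) := by
    rw [pureTerm, Nat.factorial_succ]
    push_cast
    field_simp
    ring
  have ea' : pureTerm ρ m i = pureCount m i * (ρ ^ i / (i.factorial : ℝ)) := by
    rw [pureTerm, mul_div_assoc]
  have hr : 0 ≤ ρ ^ i / (i.factorial : ℝ) := by positivity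
  have hB : 0 < B := lt_of_lt_of_le (by positivity) hB2
  rw [ea, ea']
  constructor
  · rw [← mul_assoc]
    refine mul_le_mul_of_nonneg_right ?_ hr
    have h1 : 1 ≤ B * (m * (ρ / (i + 1))) := by
      have h2 : (i + 1 : ℝ) ≤ 2 * κ * m := hi'.trans (by gcongr; linarith)
      calc (1 : ℝ) ≤ 2 * κ * m / (i + 1) := by rw [le_div_iff₀ hi0]; linarith
        _ = 2 * κ / ρ * (m * (ρ / (i + 1))) := by field_simp
        _ ≤ _ := by gcongr
    calc (pureCount m i : ℝ) ≤ pureCount m i * (B * (m * (ρ / (i + 1)))) :=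
          le_mul_of_one_le_right (by positivity) h1
      _ = B * ((m * pureCount m i) * (ρ / (i + 1))) := by ring
      _ ≤ _ := by gcongr
  · rw [← mul_assoc]
    refine mul_le_mul_of_nonneg_right ?_ hr
    have h1 : 2 * m * (ρ / (i + 1)) ≤ B := by
      refine le_trans ?_ hB2
      have h2 : κ / 2 * m ≤ i + 1 := by nlinarith
      rw [mul_div_assoc', div_le_div_iff₀ hi0 hκ]
      nlinarith
    calc (pureCount m (i + 1) : ℝ) * (ρ / (i + 1)) ≤ 2 * m * pureCount m i * (ρ / (i + 1)) := by
          gcongr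
      _ = (2 * m * (ρ / (i + 1))) * pureCount m i := by ring
      _ ≤ _ := by gcongr

/-- Two indices of the window are at most `2 η m` apart, and each unit step costs a factor at most
`B`. -/
theorem pureTerm_window {ρ κ η B b : ℝ} (hρ : 0 < ρ) (hκ : 0 < κ) (hη : η ≤ κ / 2)
    (hB1 : 1 ≤ B) (hB2 : 4 * ρ / κ ≤ B) (hB3 : 2 * κ / ρ ≤ B) {m L j : ℕ} (hm : 0 < m)
    (hb : 2 * η * Real.log B ≤ b)
    (hL : |(L : ℝ) - κ * m| ≤ η * m) (hj : |(j : ℝ) - κ * m| ≤ η * m) :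
    pureTerm ρ m j ≤ Real.exp (b * m) * pureTerm ρ m L := by
  obtain ⟨hL1, hL2⟩ := abs_le.1 hL
  obtain ⟨hj1, hj2⟩ := abs_le.1 hj
  have hB0 : 0 < B := by linarith
  have hpow : ∀ k : ℕ, (k : ℝ) ≤ 2 * η * m → B ^ k ≤ Real.exp (b * m) := by
    intro k hk
    rw [← Real.exp_log hB0, ← Real.exp_nat_mul]
    refine Real.exp_le_exp.2 ?_
    have hlogB : 0 ≤ Real.log B := Real.log_nonneg hB1
    calc (k : ℝ) * Real.log B ≤ 2 * η * m * Real.log B := by gcongr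
      _ = 2 * η * Real.log B * m := by ring
      _ ≤ _ := by gcongr
  rcases le_total j L with hjL | hjL
  · obtain ⟨k, rfl⟩ := Nat.exists_eq_add_of_le hjL
    have h1 := (le_pow_mul_of_ratio (a := pureTerm ρ m) hB0.le j k fun i hi hi' => by
      have c1 : (j : ℝ) ≤ i := by exact_mod_cast hi
      have c2 : (i + 1 : ℝ) ≤ ((j + k : ℕ) : ℝ) := by exact_mod_cast hi'
      exact pureTerm_ratio hρ hκ hη hB2 hB3 hm (by linarith) (by linarith)).1
    refine h1.trans (mul_le_mul_of_nonneg_right (hpow k ?_) (pureTerm_nonneg hρ _ _))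
    push_cast at hL2
    linarith
  · obtain ⟨k, rfl⟩ := Nat.exists_eq_add_of_le hjL
    have h1 := (le_pow_mul_of_ratio (a := pureTerm ρ m) hB0.le L k fun i hi hi' => by
      have c1 : (L : ℝ) ≤ i := by exact_mod_cast hi
      have c2 : (i + 1 : ℝ) ≤ ((L + k : ℕ) : ℝ) := by exact_mod_cast hi'
      exact pureTerm_ratio hρ hκ hη hB2 hB3 hm (by linarith) (by linarith)).2
    refine h1.trans (mul_le_mul_of_nonneg_right (hpow k ?_) (pureTerm_nonneg hρ _ _))
    push_cast at hj2
    linarith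

theorem hasSum_tilted {ρ : ℝ} (hρ : 0 < ρ) (m : ℕ) (s d : ℝ) :
    HasSum (fun j : ℕ => pureTerm ρ m j * Real.exp (s * (j - d * m)))
      (Real.exp (m * (Real.log (2 * Real.exp (ρ * Real.exp s) - 1) - d * s))) := by
  have h1 := (hasSum_pureCount m (ρ * Real.exp s)).mul_right (Real.exp (-(d * s * m)))
  have e1 : (2 * Real.exp (ρ * Real.exp s) - 1) ^ m * Real.exp (-(d * s * m)) =
      Real.exp (m * (Real.log (2 * Real.exp (ρ * Real.exp s) - 1) - d * s)) := by
    rw [show m * (Real.log (2 * Real.exp (ρ * Real.exp s) - 1) - d * s) =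
      m * Real.log (2 * Real.exp (ρ * Real.exp s) - 1) + -(d * s * m) by ring,
      Real.exp_add, Real.exp_nat_mul, Real.exp_log (two_mul_exp_sub_one_pos (by positivity))]
  have e2 : (fun j : ℕ => (pureCount m j : ℝ) * (ρ * Real.exp s) ^ j / (j.factorial : ℝ) *
      Real.exp (-(d * s * m))) =
      fun j : ℕ => pureTerm ρ m j * Real.exp (s * (j - d * m)) := by
    funext j
    have e3 : Real.exp (s * (j - d * m)) = Real.exp s ^ j * Real.exp (-(d * s * m)) := by
      rw [← Real.exp_nat_mul, ← Real.exp_add]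
      congr 1
      ring
    rw [e3, pureTerm, mul_pow]
    ring
  rwa [e1, e2] at h1

/-- The indices close to the saddle point. -/
noncomputable def window (κ η : ℝ) (m : ℕ) : Finset ℕ :=
  (range (⌊(κ + η) * m⌋₊ + 1)).filter fun j => |(j : ℝ) - κ * m| ≤ η * m

/-- Chernoff's argument: outside the window one of the two exponential weights is at least 1, so the
tilted series dominate both tails. -/
theorem pow_le_window_add_tails {ρ κ η s₁ s₂ : ℝ} (hρ : 0 < ρ)
    (hs₁ : 0 < s₁) (hs₂ : s₂ < 0) (m : ℕ) :
    (2 * Real.exp ρ - 1) ^ m ≤ ∑ j ∈ window κ η m, pureTerm ρ m j +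
      Real.exp (m * (Real.log (2 * Real.exp (ρ * Real.exp s₁) - 1) - (κ + η) * s₁)) +
      Real.exp (m * (Real.log (2 * Real.exp (ρ * Real.exp s₂) - 1) - (κ - η) * s₂)) := by
  have ha := pureTerm_nonneg hρ m
  have hW : HasSum (fun j => if j ∈ window κ η m then pureTerm ρ m j else 0)
      (∑ j ∈ window κ η m, pureTerm ρ m j) := by
    have := hasSum_sum_of_ne_finset_zero
      (f := fun j => if j ∈ window κ η m then pureTerm ρ m j else 0) (s := window κ η m)
      (fun j hj => if_neg hj) (L := SummationFilter.unconditional ℕ)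
    rwa [sum_congr rfl (fun j hj => if_pos hj)] at this
  refine hasSum_le (fun j => ?_) (hasSum_pureCount m ρ)
    ((hW.add (hasSum_tilted hρ m s₁ (κ + η))).add (hasSum_tilted hρ m s₂ (κ - η)))
  change pureTerm ρ m j ≤ _
  have p1 := mul_nonneg (ha j) (Real.exp_pos (s₁ * (j - (κ + η) * m))).le
  have p2 := mul_nonneg (ha j) (Real.exp_pos (s₂ * (j - (κ - η) * m))).le
  have p3 : 0 ≤ if j ∈ window κ η m then pureTerm ρ m j else 0 := by
    split_ifs
    · exact ha j
    · exact le_rfl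
  by_cases h1 : (κ + η) * m < j
  · have : 1 ≤ Real.exp (s₁ * (j - (κ + η) * m)) :=
      Real.one_le_exp (mul_nonneg hs₁.le (by linarith))
    have := le_mul_of_one_le_right (ha j) this
    linarith
  · by_cases h2 : (j : ℝ) < (κ - η) * m
    · have : 1 ≤ Real.exp (s₂ * (j - (κ - η) * m)) :=
        Real.one_le_exp (mul_nonneg_of_nonpos_of_nonpos hs₂.le (by linarith))
      have := le_mul_of_one_le_right (ha j) this
      linarith
    · have hj : j ∈ window κ η m := by
        refine mem_filter.2 ⟨mem_range.2 (Nat.lt_succ_of_le (Nat.le_floor (not_lt.1 h1))), ?_⟩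
        rw [abs_le]
        constructor <;> linarith
      rw [if_pos hj] at p3 ⊢
      linarith

theorem eventually_exp_le_quarter {d g₀ : ℝ} (hd : d < g₀) : ∀ᶠ m : ℕ in atTop,
    Real.exp (m * d) ≤ Real.exp (m * g₀) / 4 := by
  have h1 : Tendsto (fun m : ℕ => (m : ℝ) * (g₀ - d)) atTop atTop :=
    tendsto_natCast_atTop_atTop.atTop_mul_const (by linarith)
  filter_upwards [(Real.tendsto_exp_atTop.comp h1).eventually_ge_atTop 4] with m hm
  simp only [Function.comp] at hm
  have e : Real.exp (m * g₀) = Real.exp (m * (g₀ - d)) * Real.exp (m * d) := by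
    rw [← Real.exp_add]; ring_nf
  rw [e]
  have := Real.exp_pos (m * d)
  nlinarith

theorem eventually_linear_le_exp {ε : ℝ} (hε : 0 < ε) (κ : ℝ) : ∀ᶠ m : ℕ in atTop,
    2 * (2 * κ * (m : ℝ) + 1) ≤ Real.exp (ε * m) := by
  have h1 : (fun x : ℝ => x) =o[atTop] fun x => Real.exp (ε * x) := by
    simpa using isLittleO_pow_exp_pos_mul_atTop 1 hε
  have h2 : (fun _ : ℝ => (1 : ℝ)) =o[atTop] fun x => Real.exp (ε * x) := by
    simpa using isLittleO_pow_exp_pos_mul_atTop 0 hε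
  have h3 : (fun x : ℝ => 2 * (2 * κ * x + 1)) =o[atTop] fun x => Real.exp (ε * x) :=
    ((h1.const_mul_left (2 * κ)).add h2).const_mul_left 2
  have h4 := (h3.bound (c := 1) one_pos)
  filter_upwards [tendsto_natCast_atTop_atTop.eventually h4] with m hm
  rw [one_mul, Real.norm_eq_abs, Real.norm_eq_abs, Real.abs_exp] at hm
  exact (le_abs_self _).trans hm

/-- Near the saddle point, the terms of the generating function are as large as possible. -/
theorem eventually_le_pureTerm {ρ ε K₀ : ℝ} (hρ : 0 < ρ) (hε : 0 < ε) {κ : ℝ}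
    (hκ : κ = 2 * Real.exp ρ * ρ / (2 * Real.exp ρ - 1)) :
    ∀ᶠ m : ℕ in atTop, ∀ L : ℕ, |(L : ℝ) - κ * m| ≤ K₀ →
      Real.exp (-ε * m) * (2 * Real.exp ρ - 1) ^ m ≤ pureTerm ρ m L := by
  have hpos := two_mul_exp_sub_one_pos hρ.le
  have hκ0 : 0 < κ := by rw [hκ]; positivity
  obtain ⟨B, hB1, hB2, hB3⟩ : ∃ B : ℝ, 1 ≤ B ∧ 4 * ρ / κ ≤ B ∧ 2 * κ / ρ ≤ B :=
    ⟨max 1 (max (4 * ρ / κ) (2 * κ / ρ)), le_max_left _ _,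
      (le_max_left _ _).trans (le_max_right _ _), (le_max_right _ _).trans (le_max_right _ _)⟩
  have hlogB : 0 ≤ Real.log B := Real.log_nonneg hB1
  -- Half of `ε` pays for moving across the window, the other half for the number of its terms; the
  -- two tails take at most half of the total sum.
  obtain ⟨η, hη, hηκ, hηε⟩ : ∃ η : ℝ, 0 < η ∧ η ≤ κ / 2 ∧ 2 * η * Real.log B ≤ ε / 2 := by
    refine ⟨min (κ / 2) (ε / (4 * (Real.log B + 1))), lt_min (by positivity) (by positivity),
      min_le_left _ _, ?_⟩
    have h1 : min (κ / 2) (ε / (4 * (Real.log B + 1))) ≤ ε / (4 * (Real.log B + 1)) :=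
      min_le_right _ _
    have h0 : 0 < min (κ / 2) (ε / (4 * (Real.log B + 1))) :=
      lt_min (by positivity) (by positivity)
    rw [le_div_iff₀ (by positivity)] at h1
    nlinarith
  obtain ⟨⟨s₁, hs₁, hd₁⟩, s₂, hs₂, hd₂⟩ := exists_tilt hρ hη hκ
  set g₀ := Real.log (2 * Real.exp ρ - 1) with hg₀
  have hK : ∀ᶠ m : ℕ in atTop, K₀ ≤ η * m :=
    (tendsto_natCast_atTop_atTop.const_mul_atTop hη).eventually_ge_atTop K₀
  filter_upwards [eventually_exp_le_quarter
      (by linarith : Real.log (2 * Real.exp (ρ * Real.exp s₁) - 1) - (κ + η) * s₁ < g₀),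
    eventually_exp_le_quarter
      (by linarith : Real.log (2 * Real.exp (ρ * Real.exp s₂) - 1) - (κ - η) * s₂ < g₀),
    eventually_linear_le_exp (half_pos hε) κ, hK, eventually_gt_atTop 0]
    with m ht₁ ht₂ hlin hK hm L hL
  have hm' : (0 : ℝ) < m := by exact_mod_cast hm
  have ha : 0 ≤ Real.exp (ε / 2 * m) * pureTerm ρ m L :=
    mul_nonneg (Real.exp_pos _).le (pureTerm_nonneg hρ m L)
  have hle := pow_le_window_add_tails (κ := κ) (η := η) hρ hs₁ hs₂ m
  have hf : (2 * Real.exp ρ - 1) ^ m = Real.exp (m * g₀) := by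
    rw [Real.exp_nat_mul, Real.exp_log hpos]
  rw [hf] at hle ⊢
  have hWc : (#(window κ η m) : ℝ) ≤ 2 * κ * m + 1 := by
    have h1 : #(window κ η m) ≤ ⌊(κ + η) * m⌋₊ + 1 := (card_filter_le _ _).trans (by simp)
    have h2 : (⌊(κ + η) * m⌋₊ : ℝ) ≤ (κ + η) * m := Nat.floor_le (by positivity)
    have h3 : (#(window κ η m) : ℝ) ≤ (⌊(κ + η) * m⌋₊ : ℝ) + 1 := by exact_mod_cast h1
    nlinarith
  have hWs : ∑ j ∈ window κ η m, pureTerm ρ m j ≤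
      (2 * κ * m + 1) * (Real.exp (ε / 2 * m) * pureTerm ρ m L) := by
    calc ∑ j ∈ window κ η m, pureTerm ρ m j
        ≤ ∑ j ∈ window κ η m, Real.exp (ε / 2 * m) * pureTerm ρ m L :=
          sum_le_sum fun j hj => pureTerm_window hρ hκ0 hηκ hB1 hB2 hB3 hm hηε (hL.trans hK)
            (mem_filter.1 hj).2
      _ = #(window κ η m) * (Real.exp (ε / 2 * m) * pureTerm ρ m L) := by
          rw [sum_const, nsmul_eq_mul]
      _ ≤ _ := mul_le_mul_of_nonneg_right hWc ha
  have h5 : Real.exp (m * g₀) ≤ Real.exp (ε * m) * pureTerm ρ m L := by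
    have e : Real.exp (ε * m) = Real.exp (ε / 2 * m) * Real.exp (ε / 2 * m) := by
      rw [← Real.exp_add]; ring_nf
    have h6 : Real.exp (m * g₀) ≤
        2 * (2 * κ * m + 1) * (Real.exp (ε / 2 * m) * pureTerm ρ m L) := by linarith
    refine h6.trans ?_
    rw [e, mul_assoc (Real.exp _)]
    exact mul_le_mul_of_nonneg_right hlin ha
  calc Real.exp (-ε * m) * Real.exp (m * g₀)
      ≤ Real.exp (-ε * m) * (Real.exp (ε * m) * pureTerm ρ m L) := by gcongr
    _ = pureTerm ρ m L := by rw [← mul_assoc, ← Real.exp_add]; simp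

end Lower

/-! ### Asymptotics in `n` -/

section Asymptotics

variable {α c : ℝ}

theorem tendsto_log_natCast : Tendsto (fun n : ℕ => Real.log n) atTop atTop :=
  Real.tendsto_log_atTop.comp tendsto_natCast_atTop_atTop

theorem eventually_polylog_le {ε : ℝ} (hε : 0 < ε) (C : ℝ) (k : ℕ) :
    ∀ᶠ n : ℕ in atTop, C * (Real.log n + 1) ^ k ≤ (n : ℝ) ^ ε := by
  have h1 : (fun x : ℝ => C * (x + 1) ^ k) =o[atTop] fun x => Real.exp (ε * x) := by
    have h2 : (fun x : ℝ => x ^ k) =o[atTop] fun x => Real.exp (ε * x) :=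
      isLittleO_pow_exp_pos_mul_atTop k hε
    have h3 : (fun x : ℝ => (x + 1) ^ k) =o[atTop] fun x => Real.exp (ε * (x + 1)) :=
      h2.comp_tendsto (tendsto_atTop_add_const_right _ 1 tendsto_id)
    have h4 : (fun x : ℝ => Real.exp (ε * (x + 1))) =O[atTop] fun x => Real.exp (ε * x) := by
      have : (fun x : ℝ => Real.exp (ε * (x + 1))) =
          fun x => Real.exp ε * Real.exp (ε * x) := by
        funext x; rw [← Real.exp_add]; ring_nf
      rw [this]
      exact (Asymptotics.isBigO_refl _ _).const_mul_left _
    exact (h3.trans_isBigO h4).const_mul_left C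
  have h5 := tendsto_log_natCast.eventually (h1.bound one_pos)
  filter_upwards [h5, eventually_gt_atTop 0] with n hn hn0
  rw [one_mul, Real.norm_eq_abs, Real.norm_eq_abs, Real.abs_exp] at hn
  have hn' : (0 : ℝ) < n := by exact_mod_cast hn0
  rw [Real.rpow_def_of_pos hn', mul_comm (Real.log n)]
  exact (le_abs_self _).trans hn

theorem two_mul_mul_clauseProb {m n : ℕ} (hn : 0 < n) :
    2 * (n : ℝ) * clauseProb c m n = c / (2 * m) := by
  have : (n : ℝ) ≠ 0 := by positivity
  rw [clauseProb]
  rcases Nat.eq_zero_or_pos m with rfl | hm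
  · simp
  · field_simp; ring

/-- The positive saddle point. -/
theorem neg_log_pos (hc1 : 1 < c) (hc2 : c < 2) : 0 < -Real.log (2 - c) := by
  rw [Left.neg_pos_iff]
  exact Real.log_neg (by linarith) (by linarith)

theorem gammaHat_eq : gammaHat α c = 2 * α * (-Real.log (2 - c)) / c := by
  rw [gammaHat]; ring

theorem gammaHat_pos (hα : 0 < α) (hc1 : 1 < c) (hc2 : c < 2) : 0 < gammaHat α c := by
  have := neg_log_pos hc1 hc2
  rw [gammaHat_eq]
  positivity

-- Up to powers of `log n` the overlap sum consists of `n ^ (α H c - 2)` and `n ^ (α φ - 1)`, where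
-- `φ < H c` bounds the rate when at most `t` positions are free. The smaller loss is `e`; half of
-- it absorbs the logarithms.
set_option maxHeartbeats 1000000 in
theorem overlap_asymptotic (hα : 0 < α) (hc1 : 1 < c) (hc2 : c < 2) (hH : 0 ≤ H c) :
    ∃ ε > 0, ∀ᶠ n : ℕ in atTop, ∀ s : ℕ,
      s + 1 = 2 * (⌊gammaHat α c * Real.log n⌋₊ / 2) →
      ∀ A ∈ pureSnakes (numUniv α n) n s,
        ∑ i ∈ Icc 1 s, (overlapCount s A i : ℝ) * clauseProb c (numUniv α n) n ^ (s + 1 - i) ≤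
          (n : ℝ) ^ (α * H c - 1 - ε) := by
  set ρ := -Real.log (2 - c) with hρdef
  have hρ : 0 < ρ := neg_log_pos hc1 hc2
  have hγ := gammaHat_pos hα hc1 hc2
  set γ := gammaHat α c with hγdef
  have hγρ : c * γ = 2 * α * ρ := by
    rw [hγdef, gammaHat_eq, ← hρdef]; field_simp
  have hc0 : 0 < c := by linarith
  -- Half the length would correspond to `ρ / 2` if `m` were `α ln n`. Rounding `m` down is absorbed
  -- by `3ρ/4`, since `α ln n ≥ 3` gives `m ≥ (2/3) α ln n`.
  set φ := rate c (3 * ρ / 4) with hφ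
  have hmono := (rate_strictMonoOn hc1 hc2)
  have hφ0 : 0 ≤ φ := by
    rw [← rate_zero (c := c)]
    exact hmono.monotoneOn ⟨le_rfl, hρ.le⟩ ⟨by linarith, by linarith⟩ (by linarith)
  have hφH : φ < H c := by
    rw [← rate_neg_log hc1 hc2]
    exact hmono ⟨by linarith, by linarith⟩ ⟨hρ.le, le_rfl⟩ (by linarith)
  set e := min 1 (α * (H c - φ)) with he
  have he0 : 0 < e := lt_min one_pos (mul_pos hα (by linarith))
  refine ⟨e / 2, by positivity, ?_⟩
  have hΛ3 : ∀ᶠ n : ℕ in atTop, 3 ≤ α * Real.log n :=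
    (tendsto_log_natCast.const_mul_atTop hα).eventually_ge_atTop 3
  have hΛ4 : ∀ᶠ n : ℕ in atTop, 4 ≤ γ * Real.log n :=
    (tendsto_log_natCast.const_mul_atTop hγ).eventually_ge_atTop 4
  filter_upwards [hΛ3, hΛ4, eventually_gt_atTop 0,
    eventually_polylog_le (ε := 1) one_pos (4 * (γ + 1) ^ 3) 3,
    eventually_polylog_le (half_pos he0) (256 * (3 * Real.exp 1) * 51 * (γ + 1) ^ 6) 6]
    with n hΛ3 hΛ4 hn hpoly3 hpoly6 s hs A hA
  set Λ := Real.log n with hΛ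
  set t := ⌊γ * Λ⌋₊ / 2 with htdef
  set m := numUniv α n with hm
  have hn' : (0 : ℝ) < n := by exact_mod_cast hn
  have hΛ0 : 0 < Λ := by
    by_contra hcon
    have : α * Λ ≤ 0 := mul_nonpos_of_nonneg_of_nonpos hα.le (not_lt.1 hcon)
    linarith
  have hfl : (⌊γ * Λ⌋₊ : ℝ) ≤ γ * Λ := Nat.floor_le (by positivity)
  have h4 : 4 ≤ ⌊γ * Λ⌋₊ := Nat.le_floor (by exact_mod_cast hΛ4)
  have ht2 : 2 ≤ t := by omega
  have h2t : 2 * (t : ℝ) ≤ γ * Λ := by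
    refine le_trans ?_ hfl
    have : 2 * t ≤ ⌊γ * Λ⌋₊ := by omega
    exact_mod_cast this
  have hmle : (m : ℝ) ≤ α * Λ := Nat.floor_le (by positivity)
  have hmge : α * Λ - 1 < m := Nat.sub_one_lt_floor _
  have hm0' : (0 : ℝ) < m := by linarith
  have hm0 : 0 < m := by exact_mod_cast hm0'
  set T := (γ + 1) * (Λ + 1) with hT
  have ht1 : (1 : ℝ) ≤ t := by exact_mod_cast (by omega : 1 ≤ t)
  have htT : (t : ℝ) ≤ T := by
    rw [hT]; nlinarith
  have hexpn : ∀ a : ℝ, Real.exp (Λ * a) = (n : ℝ) ^ a := fun a => by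
    rw [Real.rpow_def_of_pos hn']
  have hp : 0 ≤ clauseProb c m n := by unfold clauseProb; positivity
  have hQ : ∀ k : ℕ, k ≤ 2 * t → ∀ b : ℝ, 0 ≤ b → rate c (c * k / (2 * m)) ≤ b →
      (pureCount m k : ℝ) * (2 * n * clauseProb c m n) ^ k ≤ 3 * Real.exp 1 * T * n ^ (α * b) := by
    intro k hk b hb hrate
    rw [two_mul_mul_clauseProb hn]
    refine (pureCount_mul_pow_le_rate hc0 hm0 k).trans ?_
    have h1 : (k + 1 : ℝ) ≤ 3 * T := by
      have : (k : ℝ) ≤ 2 * t := by exact_mod_cast hk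
      linarith
    have h2 : Real.exp (m * rate c (c * k / (2 * m))) ≤ (n : ℝ) ^ (α * b) := by
      rw [← hexpn]
      refine Real.exp_le_exp.2 ?_
      calc (m : ℝ) * rate c (c * k / (2 * m)) ≤ m * b := by gcongr
        _ ≤ α * Λ * b := by gcongr
        _ = _ := by ring
    calc Real.exp 1 * (k + 1) * Real.exp (m * rate c (c * k / (2 * m)))
        ≤ Real.exp 1 * (3 * T) * (n : ℝ) ^ (α * b) := by gcongr
      _ = _ := by ring
  have hmain := sum_overlapCount_le (Q₁ := 3 * Real.exp 1 * T * n ^ (α * H c))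
    (Q₂ := 3 * Real.exp 1 * T * n ^ (α * φ)) ht2 hs hA hp
    (fun k hk => hQ k hk _ hH (rate_le_H hc1 hc2 (by positivity)))
    (fun k hk => hQ k (by omega) _ hφ0 (by
      have hx : c * k / (2 * m) ≤ 3 * ρ / 4 := by
        rw [div_le_iff₀ (by positivity)]
        have h1 : (k : ℝ) ≤ t := by exact_mod_cast hk
        have h2 : c * k ≤ c * (γ * Λ / 2) := by gcongr; linarith
        have h3 : c * (γ * Λ / 2) = ρ * (α * Λ) := by
          calc c * (γ * Λ / 2) = (c * γ) * Λ / 2 := by ring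
            _ = _ := by rw [hγρ]; ring
        nlinarith
      exact hmono.monotoneOn ⟨by positivity, by linarith⟩ ⟨by linarith, by linarith⟩ hx))
    (by
      have h1 : 4 * (t : ℝ) * t ^ 2 ≤ n := by
        calc 4 * (t : ℝ) * t ^ 2 = 4 * t ^ 3 := by ring
          _ ≤ 4 * T ^ 3 := by gcongr
          _ = 4 * (γ + 1) ^ 3 * (Λ + 1) ^ 3 := by rw [hT]; ring
          _ ≤ (n : ℝ) ^ (1 : ℝ) := hpoly3
          _ = n := Real.rpow_one _
      have h2 : 4 * t * t ^ 2 ≤ n := by exact_mod_cast h1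
      omega)
  refine hmain.trans ?_
  set b := α * H c - 1 - e with hb
  have hn1 : (1 : ℝ) ≤ n := by exact_mod_cast hn
  have p1 : (n : ℝ) ^ (α * H c) / (2 * n) ^ 2 ≤ (n : ℝ) ^ b / 4 := by
    have h1 : (n : ℝ) ^ (α * H c) = n ^ (α * H c - 2) * n ^ 2 := by
      rw [← Real.rpow_natCast (n : ℝ) 2, ← Real.rpow_add hn']
      congr 1; push_cast; ring
    have h2 : (n : ℝ) ^ (α * H c - 2) ≤ (n : ℝ) ^ b :=
      Real.rpow_le_rpow_of_exponent_le hn1 (by have := min_le_left 1 (α * (H c - φ)); linarith)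
    rw [h1]
    calc _ = (n : ℝ) ^ (α * H c - 2) / 4 := by field_simp; norm_num
      _ ≤ _ := by gcongr
  have p2 : (n : ℝ) ^ (α * φ) / (2 * n) ≤ (n : ℝ) ^ b / 2 := by
    have h1 : (n : ℝ) ^ (α * φ) = n ^ (α * φ - 1) * n := by
      conv_rhs => rw [← Real.rpow_one (n : ℝ), ← Real.rpow_mul hn'.le, ← Real.rpow_add hn']
      congr 1; ring
    have h2 : (n : ℝ) ^ (α * φ - 1) ≤ (n : ℝ) ^ b :=
      Real.rpow_le_rpow_of_exponent_le hn1 (by have := min_le_right 1 (α * (H c - φ)); linarith)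
    rw [h1]
    calc _ = (n : ℝ) ^ (α * φ - 1) / 2 := by field_simp
      _ ≤ _ := by gcongr
  have hT1 : 1 ≤ T := ht1.trans htT
  have hTpos : 0 < T := by linarith
  have t3 : (t : ℝ) ^ 3 ≤ T ^ 5 := by
    calc (t : ℝ) ^ 3 ≤ T ^ 3 := by gcongr
      _ ≤ T ^ 5 := pow_le_pow_right₀ hT1 (by norm_num)
  have t5 : (t : ℝ) ^ 5 ≤ T ^ 5 := by gcongr
  have hnb : 0 < (n : ℝ) ^ b := Real.rpow_pos_of_pos hn' _
  calc _ = 256 * (3 * Real.exp 1) * T * (156 * (t : ℝ) ^ 5 * ((n : ℝ) ^ (α * H c) / (2 * n) ^ 2) +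
        24 * (t : ℝ) ^ 3 * ((n : ℝ) ^ (α * φ) / (2 * n))) := by ring
    _ ≤ 256 * (3 * Real.exp 1) * T * (156 * T ^ 5 * ((n : ℝ) ^ b / 4) +
        24 * T ^ 5 * ((n : ℝ) ^ b / 2)) := by gcongr
    -- Here `51 = 156/4 + 24/2`.
    _ = (256 * (3 * Real.exp 1) * 51 * (γ + 1) ^ 6 * (Λ + 1) ^ 6) * (n : ℝ) ^ b := by
        rw [hT]; ring
    _ ≤ (n : ℝ) ^ (e / 2) * (n : ℝ) ^ b := by gcongr
    _ = _ := by
        rw [← Real.rpow_add hn']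
        congr 1
        rw [hb]; ring

theorem half_pow_le_descFactorial {n s : ℕ} (hn : 0 < n) (hs : 2 * s ^ 2 ≤ n) :
    (n : ℝ) ^ s / 2 ≤ (n.descFactorial s : ℝ) := by
  have hn' : (0 : ℝ) < n := by exact_mod_cast hn
  have hsn : s ≤ n := by nlinarith
  have h1 : ((n - s : ℕ) : ℝ) ^ s ≤ n.descFactorial s := by
    have := Nat.pow_sub_le_descFactorial n s
    have h2 : (n - s) ^ s ≤ (n + 1 - s) ^ s := Nat.pow_le_pow_left (by omega) s
    exact_mod_cast h2.trans this
  refine le_trans ?_ h1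
  rw [Nat.cast_sub hsn]
  have hq : (s : ℝ) / n ≤ 1 := by rw [div_le_one hn']; exact_mod_cast hsn
  have hB := one_add_mul_le_pow (a := -((s : ℝ) / n)) (by linarith) s
  have e : (n : ℝ) - s = n * (1 + -((s : ℝ) / n)) := by field_simp; ring
  rw [e, mul_pow, div_eq_mul_inv]
  gcongr
  refine le_trans ?_ hB
  have h3 : (s : ℝ) * ((s : ℝ) / n) ≤ 1 / 2 := by
    rw [← mul_div_assoc, div_le_iff₀ hn']
    have : (2 * s ^ 2 : ℝ) ≤ n := by exact_mod_cast hs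
    nlinarith
  linarith

/-- There are `2t` clauses but only `s = 2t - 1` free variables, whence the factor `1/n`. The
constant is `4 * 1024`: a 4 from `(2n)^(2t) = 4n * (n^s / 2 * 2^s)`, and the multiplicity of
descriptions. -/
theorem le_expectedSnakes {m n t s : ℕ} (ht : 2 ≤ t) (hs : s + 1 = 2 * t) (hn : 0 < n)
    (hsn : 2 * s ^ 2 ≤ n) (hc : 0 ≤ c) :
    (pureCount m (2 * t) : ℝ) * (c / (2 * m)) ^ (2 * t) / (4096 * t * n) ≤
      expectedSnakes m n s (clauseProb c m n) := by
  have hn' : (0 : ℝ) < n := by exact_mod_cast hn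
  have ht' : (0 : ℝ) < t := by exact_mod_cast (by omega : 0 < t)
  set p := clauseProb c m n with hp
  have hp0 : 0 ≤ p := by rw [hp, clauseProb]; positivity
  have h1 := le_card_pureSnakes (m := m) (n := n) ht hs
  have h2 := half_pow_le_descFactorial hn hsn
  rw [expectedSnakes_eq ht hs, ← two_mul_mul_clauseProb hn, ← hp, hs]
  rw [div_le_iff₀ (by positivity)]
  have h3 : (n : ℝ) ^ s / 2 * 2 ^ s * pureCount m (2 * t) ≤
      1024 * t * #(pureSnakes m n s) := le_trans (by gcongr) h1
  have e1 : (2 * (n : ℝ)) ^ (2 * t) = 4 * n * ((n : ℝ) ^ s / 2 * 2 ^ s) := by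
    rw [← hs, pow_succ, mul_pow]; ring
  calc (pureCount m (2 * t) : ℝ) * (2 * n * p) ^ (2 * t)
      = 4 * n * ((n : ℝ) ^ s / 2 * 2 ^ s * pureCount m (2 * t)) * p ^ (2 * t) := by
        rw [mul_pow _ p, e1]; ring
    _ ≤ 4 * n * (1024 * t * #(pureSnakes m n s)) * p ^ (2 * t) := by gcongr
    _ = _ := by ring

/-- This passes from the weights `ρ ^ L / L!` to `(c / (2m)) ^ L`. The factor `exp (-Γ)` comes from
`L! ≥ (L/e)^L`, and `exp (-2)` from `(L/(L+2))^L`, as `L` falls short of `Γ` by at most 2. -/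
theorem le_pureCount_mul_pow {ρ Γ : ℝ} (hρ : 0 < ρ) (hc : 0 < c) {m L : ℕ} (hm : 0 < m)
    (hL : 0 < L) (hΓ : 2 * m * ρ / c ≤ Γ) (hL1 : Γ ≤ L + 2) (hL2 : L ≤ Γ) :
    Real.exp (-2) * Real.exp (-Γ) * pureTerm ρ m L ≤
      (pureCount m L : ℝ) * (c / (2 * m)) ^ L := by
  have hm' : (0 : ℝ) < m := by exact_mod_cast hm
  have hL' : (0 : ℝ) < L := by exact_mod_cast hL
  have hfac : (0 : ℝ) < L.factorial := by positivity
  have h1 := Real.pow_div_factorial_le_exp (L : ℝ) hL'.le L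
  rw [div_le_iff₀ hfac] at h1
  have h2 : (L / (L + 2) : ℝ) ≤ c * L / (2 * m * ρ) := by
    rw [div_le_iff₀ hc] at hΓ
    rw [div_le_div_iff₀ (by positivity) (by positivity)]
    have : L * (2 * m * ρ) ≤ L * ((L + 2) * c) := by
      refine mul_le_mul_of_nonneg_left (hΓ.trans ?_) hL'.le
      gcongr
    linarith
  have h3 : Real.exp (-2) ≤ (L / (L + 2) : ℝ) ^ L := by
    have e1 : (L : ℝ) / (L + 2) = (1 + 2 / (L : ℝ))⁻¹ := by field_simp
    rw [e1, inv_pow, Real.exp_neg]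
    refine inv_anti₀ (by positivity) ?_
    have h4 : (1 + 2 / L : ℝ) ≤ Real.exp (2 / L) := by
      have := Real.add_one_le_exp (2 / L : ℝ); linarith
    calc (1 + 2 / L : ℝ) ^ L ≤ Real.exp (2 / L) ^ L := by gcongr
      _ = Real.exp 2 := by rw [← Real.exp_nat_mul]; congr 1; field_simp
  have h5 : Real.exp (-Γ) * (L : ℝ) ^ L ≤ L.factorial := by
    rw [Real.exp_neg, inv_mul_le_iff₀ (Real.exp_pos _)]
    refine h1.trans ?_
    gcongr
  have h6 : Real.exp (-2) ≤ (c * L / (2 * m * ρ)) ^ L := h3.trans (by gcongr)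
  have e2 : pureTerm ρ m L * (L.factorial * (c / (2 * m * ρ)) ^ L) =
      (pureCount m L : ℝ) * (c / (2 * m)) ^ L := by
    have e3 : (c / (2 * m)) ^ L = ρ ^ L * (c / (2 * m * ρ)) ^ L := by
      rw [← mul_pow]; congr 1; field_simp
    rw [pureTerm, e3]
    field_simp
  have e4 : (c * L / (2 * m * ρ)) ^ L = (L : ℝ) ^ L * (c / (2 * m * ρ)) ^ L := by
    rw [← mul_pow]; congr 1; ring
  have hP := pureTerm_nonneg hρ m L
  rw [← e2, mul_comm]
  refine mul_le_mul_of_nonneg_left ?_ hP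
  calc Real.exp (-2) * Real.exp (-Γ)
      ≤ (L : ℝ) ^ L * (c / (2 * m * ρ)) ^ L * Real.exp (-Γ) := by rw [← e4]; gcongr
    _ = Real.exp (-Γ) * (L : ℝ) ^ L * (c / (2 * m * ρ)) ^ L := by ring
    _ ≤ _ := by gcongr

-- With `g = 2 exp ρ - 1` the saddle point value `g ^ m` is about `n ^ (α log g)` and the change of
-- weights costs `n ^ (-γ)`; the exponents combine to `α log g - γ = α H c`.
set_option maxHeartbeats 1000000 in
theorem expectation_asymptotic (hα : 0 < α) (hc1 : 1 < c) (hc2 : c < 2) {ε : ℝ} (hε : 0 < ε) :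
    ∃ C > 0, ∀ᶠ n : ℕ in atTop, ∀ s : ℕ,
      s + 1 = 2 * (⌊gammaHat α c * Real.log n⌋₊ / 2) →
      C * (n : ℝ) ^ (α * H c - 1 - ε) ≤
        expectedSnakes (numUniv α n) n s (clauseProb c (numUniv α n) n) := by
  set ρ := -Real.log (2 - c) with hρdef
  have hρ : 0 < ρ := neg_log_pos hc1 hc2
  have hγ := gammaHat_pos hα hc1 hc2
  set γ := gammaHat α c with hγdef
  have hc0 : 0 < c := by linarith
  have hd : 0 < 2 - c := by linarith
  have hγρ : c * γ = 2 * α * ρ := by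
    rw [hγdef, gammaHat_eq, ← hρdef]; field_simp
  have hg : 2 * Real.exp ρ - 1 = c / (2 - c) := by
    rw [hρdef, Real.exp_neg, Real.exp_log hd]; field_simp; ring
  have hκ : 2 * ρ / c = 2 * Real.exp ρ * ρ / (2 * Real.exp ρ - 1) := by
    rw [hg, hρdef, Real.exp_neg, Real.exp_log hd]
    field_simp
  set g := c / (2 - c) with hgdef
  have hg1 : 1 < g := by rw [hgdef, lt_div_iff₀ hd]; linarith
  have hlogg : 0 < Real.log g := Real.log_pos hg1
  have hexpo : α * H c = α * Real.log g - γ := by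
    rw [hγdef, gammaHat, H, hgdef, Real.log_div hc0.ne' hd.ne']; field_simp; ring
  refine ⟨Real.exp (-2) / (4096 * g), by positivity, ?_⟩
  have hm_tendsto : Tendsto (fun n : ℕ => numUniv α n) atTop atTop :=
    tendsto_nat_floor_atTop.comp (tendsto_log_natCast.const_mul_atTop hα)
  -- The index `2t` differs from `κ m` by at most 2 from rounding to an even integer and by at most
  -- `2ρ/c` from rounding `m`.
  have hterm := hm_tendsto.eventually (eventually_le_pureTerm (ε := ε / (2 * α))
    (K₀ := 2 + 2 * ρ / c) hρ (by positivity) hκ)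
  have hΛ4 : ∀ᶠ n : ℕ in atTop, 4 ≤ γ * Real.log n :=
    (tendsto_log_natCast.const_mul_atTop hγ).eventually_ge_atTop 4
  filter_upwards [hterm, hΛ4, eventually_gt_atTop 0, hm_tendsto.eventually_gt_atTop 0,
    eventually_polylog_le (ε := 1) one_pos (8 * (γ + 1) ^ 2) 2,
    eventually_polylog_le (half_pos hε) (γ + 1) 1] with n hterm hΛ4 hn hm0 hpoly2 hpoly1 s hs
  set Λ := Real.log n with hΛ
  set t := ⌊γ * Λ⌋₊ / 2 with htdef
  set m := numUniv α n with hm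
  have hn' : (0 : ℝ) < n := by exact_mod_cast hn
  have hm0' : (0 : ℝ) < m := by exact_mod_cast hm0
  have hΛ0 : 0 < Λ := by
    by_contra hcon
    have : γ * Λ ≤ 0 := mul_nonpos_of_nonneg_of_nonpos hγ.le (not_lt.1 hcon)
    linarith
  have hfl : (⌊γ * Λ⌋₊ : ℝ) ≤ γ * Λ := Nat.floor_le (by positivity)
  have hfl' : γ * Λ < (⌊γ * Λ⌋₊ : ℝ) + 1 := Nat.lt_floor_add_one _
  have h4 : 4 ≤ ⌊γ * Λ⌋₊ := Nat.le_floor (by exact_mod_cast hΛ4)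
  have ht2 : 2 ≤ t := by omega
  have ht0 : (0 : ℝ) < t := by exact_mod_cast (by omega : 0 < t)
  have hLle : ((2 * t : ℕ) : ℝ) ≤ γ * Λ := by
    refine le_trans ?_ hfl
    have : 2 * t ≤ ⌊γ * Λ⌋₊ := by omega
    exact_mod_cast this
  have hLge : γ * Λ ≤ ((2 * t : ℕ) : ℝ) + 2 := by
    have h5 : ⌊γ * Λ⌋₊ ≤ 2 * t + 1 := by omega
    have h6 : (⌊γ * Λ⌋₊ : ℝ) ≤ ((2 * t : ℕ) : ℝ) + 1 := by exact_mod_cast h5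
    linarith
  have hmle : (m : ℝ) ≤ α * Λ := Nat.floor_le (by positivity)
  have hmge : α * Λ - 1 < m := Nat.sub_one_lt_floor _
  have hexpn : ∀ a : ℝ, Real.exp (Λ * a) = (n : ℝ) ^ a := fun a => by
    rw [Real.rpow_def_of_pos hn']
  have hγΛ : γ * Λ = 2 * ρ / c * (α * Λ) := by
    have : γ = 2 * ρ / c * α := by
      rw [hγdef, gammaHat_eq, ← hρdef]; ring
    rw [this]; ring
  have hκ0 : 0 < 2 * ρ / c := by positivity
  have htT : (t : ℝ) ≤ (γ + 1) * (Λ + 1) := by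
    push_cast at hLle
    nlinarith
  have hsn : 2 * s ^ 2 ≤ n := by
    have h1 : (s : ℝ) ≤ 2 * ((γ + 1) * (Λ + 1)) := by
      have : s ≤ 2 * t := by omega
      have : (s : ℝ) ≤ 2 * t := by exact_mod_cast this
      linarith
    have h2 : 2 * (s : ℝ) ^ 2 ≤ n := by
      calc 2 * (s : ℝ) ^ 2 ≤ 2 * (2 * ((γ + 1) * (Λ + 1))) ^ 2 := by gcongr
        _ = 8 * (γ + 1) ^ 2 * (Λ + 1) ^ 2 := by ring
        _ ≤ (n : ℝ) ^ (1 : ℝ) := hpoly2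
        _ = n := Real.rpow_one _
    exact_mod_cast h2
  have hE := le_expectedSnakes (m := m) ht2 hs hn hsn hc0.le
  have hΓ : 2 * m * ρ / c ≤ γ * Λ := by
    calc 2 * m * ρ / c = 2 * ρ / c * m := by ring
      _ ≤ 2 * ρ / c * (α * Λ) := by gcongr
      _ = _ := hγΛ.symm
  have hQ := le_pureCount_mul_pow hρ hc0 hm0 (by omega : 0 < 2 * t) hΓ hLge hLle
  have hP := hterm (2 * t) (by
    have h1 : 2 * ρ / c * m ≤ 2 * ρ / c * (α * Λ) := by gcongr
    have h2 : 2 * ρ / c * (α * Λ - 1) ≤ 2 * ρ / c * m := by gcongr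
    rw [← hγΛ] at h1
    rw [mul_sub, ← hγΛ] at h2
    rw [abs_le]
    constructor <;> linarith)
  -- Rounding `m` down costs at most one factor `g`.
  have hpow : (n : ℝ) ^ (α * Real.log g) / g ≤ (2 * Real.exp ρ - 1) ^ m := by
    have h1 : g ^ m = Real.exp (m * Real.log g) := by
      rw [Real.exp_nat_mul, Real.exp_log (by linarith)]
    rw [hg, h1, ← hexpn, div_le_iff₀ (by linarith)]
    conv_rhs => rw [← Real.exp_log (by linarith : 0 < g), ← Real.exp_add, Real.log_exp]
    refine Real.exp_le_exp.2 ?_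
    nlinarith
  have hsmall : (n : ℝ) ^ (-(ε / 2)) ≤ Real.exp (-(ε / (2 * α)) * m) := by
    rw [← hexpn]
    refine Real.exp_le_exp.2 ?_
    have : ε / (2 * α) * m ≤ ε / (2 * α) * (α * Λ) := by gcongr
    have e : ε / (2 * α) * (α * Λ) = Λ * (ε / 2) := by field_simp
    linarith
  have hγn : Real.exp (-(γ * Λ)) = (n : ℝ) ^ (-γ) := by rw [← hexpn]; ring_nf
  have htn : (t : ℝ) ≤ (n : ℝ) ^ (ε / 2) := by
    refine htT.trans ?_
    simpa using hpoly1
  have hε2 : 0 < (n : ℝ) ^ (ε / 2) := Real.rpow_pos_of_pos hn' _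
  calc Real.exp (-2) / (4096 * g) * (n : ℝ) ^ (α * H c - 1 - ε)
      = Real.exp (-2) * (n : ℝ) ^ (-γ) * ((n : ℝ) ^ (-(ε / 2)) * ((n : ℝ) ^ (α * Real.log g) / g)) /
          (4096 * (n : ℝ) ^ (ε / 2) * n) := by
        have e : (n : ℝ) ^ (α * H c - 1 - ε) =
            (n : ℝ) ^ (-γ) * (n : ℝ) ^ (-(ε / 2)) * (n : ℝ) ^ (α * Real.log g) /
              ((n : ℝ) ^ (ε / 2) * n) := by
          rw [eq_div_iff (by positivity), ← Real.rpow_add hn', ← Real.rpow_add hn',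
            ← mul_assoc, ← Real.rpow_add hn']
          conv_lhs => rw [← Real.rpow_one (n : ℝ), ← Real.rpow_mul hn'.le, ← Real.rpow_add hn']
          congr 1
          rw [hexpo]; ring
        rw [e]
        field_simp
    _ ≤ Real.exp (-2) * Real.exp (-(γ * Λ)) * (Real.exp (-(ε / (2 * α)) * m) *
          (2 * Real.exp ρ - 1) ^ m) / (4096 * t * n) := by
        rw [hγn]
        have hpos : 0 ≤ 2 * Real.exp ρ - 1 := (two_mul_exp_sub_one_pos hρ.le).le
        refine div_le_div₀ (by positivity) ?_ (by positivity) (by gcongr)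
        gcongr
    _ ≤ Real.exp (-2) * Real.exp (-(γ * Λ)) * pureTerm ρ m (2 * t) / (4096 * t * n) := by
        gcongr
    _ ≤ (pureCount m (2 * t) : ℝ) * (c / (2 * m)) ^ (2 * t) / (4096 * t * n) := by
        gcongr
    _ ≤ _ := hE

theorem probTrue_nonneg {m n : ℕ} {p : ℝ} (h0 : 0 ≤ p) (h1 : p ≤ 1) : 0 ≤ probTrue m n p := by
  classical
  exact sum_nonneg fun F _ => weight_nonneg h0 h1 F

end Asymptotics

end QSat

/-! ### The main theorem -/

theorem corollary2 (α c : ℝ) (hα : 1 / Real.log 2 < α) (hc1 : 1 < c) (hc2 : c < 2)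
    (hH : 1 < α * QSat.H c) :
    (∃ δ : ℝ, 0 < δ ∧ δ < 2 * (α * QSat.H c - 1) ∧ ∃ C > (0 : ℝ), ∃ D > (0 : ℝ),
      ∀ᶠ n : ℕ in atTop, ∀ s : ℕ,
        -- `s + 1` is `⌊γ̂ ln n⌋`, lowered by one if this is odd
        s + 1 = 2 * (⌊QSat.gammaHat α c * Real.log n⌋₊ / 2) →
          C * (n : ℝ) ^ (α * QSat.H c - 1 - δ / 2) ≤
              QSat.expectedSnakes (QSat.numUniv α n) n s
                (QSat.clauseProb c (QSat.numUniv α n) n) ∧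
          ∀ A ∈ QSat.pureSnakes (QSat.numUniv α n) n s,
            ∑ i ∈ Finset.Icc 1 s, (QSat.overlapCount s A i : ℝ) *
                QSat.clauseProb c (QSat.numUniv α n) n ^ (s + 1 - i) ≤
              D * (n : ℝ) ^ (α * QSat.H c - 1 - 2 * δ / 3)) ∧
    Tendsto (fun n : ℕ => QSat.probTrue (QSat.numUniv α n) n
      (QSat.clauseProb c (QSat.numUniv α n) n)) atTop (𝓝 0) := by
  have hα0 : 0 < α := lt_trans (by have := Real.log_pos one_lt_two; positivity) hα
  have hH0 : 0 < QSat.H c := by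
    by_contra hcon
    have := mul_nonpos_of_nonneg_of_nonpos hα0.le (not_lt.1 hcon)
    linarith
  obtain ⟨ε, hε, hover⟩ := QSat.overlap_asymptotic hα0 hc1 hc2 hH0.le
  set b := α * QSat.H c - 1 with hb
  have hb0 : 0 < b := by linarith
  -- The first bound makes the overlap loss `ε` at least `2δ/3`; the second gives `δ < 2b` and `b -
  -- δ/2 > 0`.
  set δ := min (3 * ε / 2) b with hδ
  have hδ0 : 0 < δ := lt_min (by positivity) hb0
  have hδε : 2 * δ / 3 ≤ ε := by have := min_le_left (3 * ε / 2) b; linarith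
  have hδb : δ ≤ b := min_le_right _ _
  obtain ⟨C, hC, hexp⟩ := QSat.expectation_asymptotic hα0 hc1 hc2 (half_pos hδ0)
  have hmain : ∀ᶠ n : ℕ in atTop, ∀ s : ℕ,
      s + 1 = 2 * (⌊QSat.gammaHat α c * Real.log n⌋₊ / 2) →
        C * (n : ℝ) ^ (b - δ / 2) ≤ QSat.expectedSnakes (QSat.numUniv α n) n s
            (QSat.clauseProb c (QSat.numUniv α n) n) ∧
        ∀ A ∈ QSat.pureSnakes (QSat.numUniv α n) n s,
          ∑ i ∈ Finset.Icc 1 s, (QSat.overlapCount s A i : ℝ) *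
              QSat.clauseProb c (QSat.numUniv α n) n ^ (s + 1 - i) ≤
            1 * (n : ℝ) ^ (b - 2 * δ / 3) := by
    filter_upwards [hover, hexp, eventually_ge_atTop 1] with n h1 h2 hn s hs
    refine ⟨h2 s hs, fun A hA => (h1 s hs A hA).trans ?_⟩
    rw [one_mul]
    exact Real.rpow_le_rpow_of_exponent_le (by exact_mod_cast hn) (by linarith)
  refine ⟨⟨δ, hδ0, by linarith, C, hC, 1, one_pos, hmain⟩, ?_⟩
  have hγ := QSat.gammaHat_pos hα0 hc1 hc2
  -- The ratio `(R + 1) / E` has two terms: `2δ/3 - δ/2 = δ/6` is the gain of `R` over `E`, and the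
  -- summand 1 is beaten because `E` itself diverges.
  have hlim : Tendsto (fun n : ℕ => C⁻¹ * ((n : ℝ) ^ (-(δ / 6)) + (n : ℝ) ^ (-(b - δ / 2))))
      atTop (𝓝 0) := by
    have h1 := (tendsto_rpow_neg_atTop (by positivity : 0 < δ / 6)).comp
      (tendsto_natCast_atTop_atTop (R := ℝ))
    have h2 := (tendsto_rpow_neg_atTop (by linarith : 0 < b - δ / 2)).comp
      (tendsto_natCast_atTop_atTop (R := ℝ))
    simpa using (h1.add h2).const_mul C⁻¹
  have hp : ∀ᶠ n : ℕ in atTop, 0 ≤ QSat.clauseProb c (QSat.numUniv α n) n ∧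
      QSat.clauseProb c (QSat.numUniv α n) n ≤ 1 := by
    filter_upwards [eventually_ge_atTop 1, (tendsto_nat_floor_atTop.comp
      (QSat.tendsto_log_natCast.const_mul_atTop hα0)).eventually_ge_atTop 1] with n hn hm
    have hn' : (1 : ℝ) ≤ n := by exact_mod_cast hn
    have hm' : (1 : ℝ) ≤ QSat.numUniv α n := by exact_mod_cast hm
    have hmn : 1 ≤ (QSat.numUniv α n : ℝ) * n := one_le_mul_of_one_le_of_one_le hm' hn'
    refine ⟨by unfold QSat.clauseProb; positivity, ?_⟩
    rw [QSat.clauseProb, div_le_one (by positivity)]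
    linarith
  refine squeeze_zero' ?_ ?_ hlim
  · filter_upwards [hp] with n hn
    exact QSat.probTrue_nonneg hn.1 hn.2
  · filter_upwards [hp, hmain, (QSat.tendsto_log_natCast.const_mul_atTop hγ).eventually_ge_atTop 4,
      eventually_gt_atTop 0] with n hp hn h4 hn0
    have hn' : (0 : ℝ) < n := by exact_mod_cast hn0
    have h4' : 4 ≤ ⌊QSat.gammaHat α c * Real.log n⌋₊ := Nat.le_floor (by exact_mod_cast h4)
    set t := ⌊QSat.gammaHat α c * Real.log n⌋₊ / 2 with ht
    have ht2 : 2 ≤ t := by omega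
    obtain ⟨s, hs⟩ : ∃ s, s + 1 = 2 * t := ⟨2 * t - 1, by omega⟩
    obtain ⟨hE, hR⟩ := hn s hs
    have hEpos : 0 < C * (n : ℝ) ^ (b - δ / 2) := mul_pos hC (Real.rpow_pos_of_pos hn' _)
    refine (QSat.probTrue_le ht2 hs hp.1 hp.2 hR (hEpos.trans_le hE)).trans ?_
    have hR0 : 0 ≤ 1 * (n : ℝ) ^ (b - 2 * δ / 3) + 1 := by positivity
    calc _ ≤ (1 * (n : ℝ) ^ (b - 2 * δ / 3) + 1) / (C * (n : ℝ) ^ (b - δ / 2)) := by gcongr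
      _ = _ := by
        have e1 : (n : ℝ) ^ (-(δ / 6)) = (n : ℝ) ^ (b - 2 * δ / 3) / (n : ℝ) ^ (b - δ / 2) := by
          rw [← Real.rpow_sub hn']; congr 1; ring
        rw [e1, Real.rpow_neg hn'.le]
        have := (Real.rpow_pos_of_pos hn' (b - δ / 2)).ne'
        field_simp
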